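/- Let $\beta\in(1,2)$ and let $T_\beta:[0,1)\to[0,1)$, $T_\beta(x)=\beta x \pmod 1$. For $t\in[0,1)$ put $$K_\beta(t)=\{x\in[0,1): T_\beta^n(x)\notin(0,t)\ \text{for all } n\ge 0\},\qquad E_\beta^+=\{t\in[0,1): T_\beta^n(t)\ge t\ \text{for all } n\ge 0\}.$$ *Farey intervals.* Let $F_0=(0,1)$ (an ordered list of two one-letter words) and let $F_{n+1}$ arise from $F_n$ by inserting between any two neighbouring words $u,v$ the concatenation $uv$. Let $\mathcal F=\bigcup_{n\ge0}F_n\setminus\{0,1\}$. For $\gamma\in(1,2]$ let $\alpha(\gamma)\in\{0,1\}^{\mathbb N}$ be the quasi-greedy $\gamma$-expansion of $1$: its $i$-th digit ($i\ge1$) is $0$ if $\widetilde T_\gamma^{\,i-1}(1)\le 1/\gamma$ and $1$ otherwise, where $\widetilde T_\gamma(x)=\gamma x$ for $x\in(0,1/\gamma]$ and $\widetilde T_\gamma(x)=\gamma x-1$ for $x\in(1/\gamma,1]$. For a word $a_1\ldots a_m$ whose reflection $(1-a_1)\ldots(1-a_m)$ belongs to $\mathcal F$ (so $a_m=0$), the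 Farey interval generated by $a_1\ldots a_m$ is $(\gamma_L,\gamma_R]$, where $\gamma_L,\gamma_R\in(1,2]$ are determined by $$\alpha(\gamma_L)=(a_1\ldots a_m)^\infty,\qquad \alpha(\gamma_R)=a_1\ldots a_{m-1}1\,(a_ma_{m-1}\ldots a_1)^\infty .$$ **Theorem.** For every $\beta\in(1,2)$ there is a unique real number $\tau_\beta$ such that, for all $t\in[0,1)$, $\dim_H K_\beta(t)>0$ if and only if $t<\tau_\beta$. It satisfies $\tau_\beta\le 1-\frac1\beta$. Moreover, the following are equivalent: 1. $\tau_\beta=1-\frac1\beta$; 2. the closure $\overline{E_\beta^+}$ is a Cantor set (nonempty, compact, perfect and totally disconnected); 3. $\beta$ belongs to no Farey interval $(\gamma_L,\gamma_R]$. -/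

import Mathlib

namespace BetaHole

/-- The map `x ↦ β x (mod 1)`; on `[0, 1)` it is the `β`-transformation. -/
noncomputable def betaMap (β x : ℝ) : ℝ := Int.fract (β * x)

/-- The survivor set: points of `[0, 1)` whose orbit never enters the hole `(0, t)`. -/
def survivorSet (β t : ℝ) : Set ℝ :=
  {x | x ∈ Set.Ico (0 : ℝ) 1 ∧ ∀ n : ℕ, (betaMap β)^[n] x ∉ Set.Ioo (0 : ℝ) t}

/-- The points of `[0, 1)` that are minimal in their own orbit. -/
def orbitMinimalSet (β : ℝ) : Set ℝ :=
  {t | t ∈ Set.Ico (0 : ℝ) 1 ∧ ∀ n : ℕ, t ≤ (betaMap β)^[n] t}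

/-- For holes `(0, t)` with `t ∈ [0, 1)`, the survivor set has positive Hausdorff dimension
exactly when `t < τ`. -/
def IsCriticalValue (β τ : ℝ) : Prop :=
  ∀ t ∈ Set.Ico (0 : ℝ) 1, 0 < dimH (survivorSet β t) ↔ t < τ

/-- A Cantor set in the line: nonempty, compact, perfect and totally disconnected. -/
structure IsCantorSet (C : Set ℝ) : Prop where
  nonempty : C.Nonempty
  isCompact : IsCompact C
  perfect : Perfect C
  isTotallyDisconnected : IsTotallyDisconnected C

/-- The quasi-greedy map on `(0, 1]`. -/
noncomputable def quasiGreedyMap (β x : ℝ) : ℝ :=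
  if x ≤ 1 / β then β * x else β * x - 1

/-- The quasi-greedy `β`-expansion of `1`, indexed from `0`
(`true` is the digit `1` and `false` is the digit `0`). -/
noncomputable def quasiGreedyOne (β : ℝ) : ℕ → Bool :=
  fun n => decide (1 / β < (quasiGreedyMap β)^[n] 1)

/-- The infinite repetition of a nonempty word. -/
def periodicSeq (w : List Bool) : ℕ → Bool :=
  fun n => w.getD (n % w.length) false

/-- The concatenation of a word and a sequence. -/
def prependWord (w : List Bool) (x : ℕ → Bool) : ℕ → Bool :=
  fun n => if n < w.length then w.getD n false else x (n - w.length)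

/-- Insert between any two neighbours of a list of words their concatenation. -/
def fareyStep : List (List Bool) → List (List Bool)
  | u :: v :: l => u :: (u ++ v) :: fareyStep (v :: l)
  | l => l

/-- The `n`-th ordered list of Farey words, starting from the words `0` and `1`. -/
def fareyList : ℕ → List (List Bool)
  | 0 => [[false], [true]]
  | n + 1 => fareyStep (fareyList n)

/-- The Farey words other than `0` and `1`. -/
def IsNondegenerateFareyWord (w : List Bool) : Prop :=
  (∃ n : ℕ, w ∈ fareyList n) ∧ w ≠ [false] ∧ w ≠ [true]

/-- The reflection of a word: every digit `d` is replaced by `1 - d`. -/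
def reflectWord (w : List Bool) : List Bool := w.map not

/-- The word with its last digit, a `0`, raised to `1`. -/
def raiseLast (w : List Bool) : List Bool := w.dropLast ++ [true]

/-- `J` is the interval `(γL, γR]` generated by a word `a` whose reflection is a nondegenerate
Farey word: the quasi-greedy expansions of `1` in the bases `γL` and `γR` are `a` repeated, and
`a` with its last digit raised followed by the repeated reversal of `a`. -/
def IsFareyInterval (J : Set ℝ) : Prop :=
  ∃ (a : List Bool) (γL γR : ℝ), IsNondegenerateFareyWord (reflectWord a) ∧
    γL ∈ Set.Ioc (1 : ℝ) 2 ∧ γR ∈ Set.Ioc (1 : ℝ) 2 ∧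
    quasiGreedyOne γL = periodicSeq a ∧
    quasiGreedyOne γR = prependWord (raiseLast a) (periodicSeq a.reverse) ∧
    J = Set.Ioc γL γR

end BetaHole

/-!
Counting the preimages of `1` whose orbits avoid the hole `(0, t)` gives a sequence whose
exponential growth decides whether the survivor set has positive dimension: subexponential growth
yields economical covers, and otherwise the generating function of the counts has a pole, at which
its rescaled partial sums converge to the tail function of a measure on the survivors with
polynomially small mass on short intervals. The generating function is the reciprocal of a kneading
function, which depends on `t` continuously enough from the right to make exponential growth an open
condition to the right. Hence the critical value exists.

At the threshold `1 - 1/β` the map restricted to `[1 - 1/β, 1)` is injective and preserves the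
cyclic order. If it has no periodic orbit there, backward orbits are forced to branch as soon as the
threshold is lowered; the growth is then exponential, the critical value is `1 - 1/β`, and orbits of
survivors can be used to perturb any orbit-minimal point, so that the closure is perfect. If it has
a periodic orbit there, that orbit is a rotation by some `k (mod q)`. Its smallest point repels
everything below it until it falls below `1 - 1/β`, so this point is isolated in the closure and the
critical value is smaller than `1 - 1/β`.

The rotation by `k (mod q)` occurs exactly for the bases in one Farey interval: the digits of its
orbits are the conjugates of the Christoffel word of slope `k / q`, the Farey words are the
Christoffel words by the mediant construction of fractions, and the end points of the interval are
the bases where the largest point of the orbit reaches `1` and where the smallest one reaches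
`1 - 1/β`.
-/

namespace BetaHole

open Filter Topology Set MeasureTheory
open scoped ENNReal NNReal

section

variable {β s t x y : ℝ}

/-! ### The map `x ↦ β x (mod 1)` -/

theorem one_div_lt_one_of_one_lt (hβ : 1 < β) : 1 / β < 1 :=
  (div_lt_one (zero_lt_one.trans hβ)).2 hβ

theorem one_sub_one_div_pos (hβ : 1 < β) : 0 < 1 - 1 / β :=
  sub_pos.2 (one_div_lt_one_of_one_lt hβ)

theorem one_sub_one_div_lt_one_div (hβ : β ∈ Ioo (1 : ℝ) 2) : 1 - 1 / β < 1 / β := by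
  have : 1 < 2 * (1 / β) := by rw [mul_one_div, one_lt_div (zero_lt_one.trans hβ.1)]; exact hβ.2
  linarith

theorem mul_one_sub_one_div (hβ : β ≠ 0) : β * (1 - 1 / β) = β - 1 := by
  field_simp

theorem betaMap_mem_Ico (β x : ℝ) : betaMap β x ∈ Ico (0 : ℝ) 1 :=
  ⟨Int.fract_nonneg _, Int.fract_lt_one _⟩

theorem betaMap_eq_of_eq_add (n : ℤ) (hy : y ∈ Ico (0 : ℝ) 1) (h : β * x = n + y) :
    betaMap β x = y := by
  rw [betaMap, h, Int.fract_intCast_add]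
  exact Int.fract_eq_self.2 hy

theorem mul_eq_floor_add_betaMap (β x : ℝ) : β * x = ⌊β * x⌋ + betaMap β x :=
  (Int.floor_add_fract _).symm

theorem betaMap_of_lt (hβ : 0 < β) (h0 : 0 ≤ x) (h : x < 1 / β) : betaMap β x = β * x :=
  betaMap_eq_of_eq_add 0 ⟨by positivity, by rwa [lt_div_iff₀' hβ] at h⟩ (by simp)

theorem betaMap_of_le (hβ : β ∈ Ioo (1 : ℝ) 2) (h : 1 / β ≤ x) (h1 : x ≤ 1) :
    betaMap β x = β * x - 1 := by
  rw [div_le_iff₀' (zero_lt_one.trans hβ.1)] at h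
  exact betaMap_eq_of_eq_add 1 ⟨by linarith, by nlinarith [hβ.1, hβ.2]⟩ (by push_cast; ring)

theorem betaMap_one (hβ : β ∈ Ico (1 : ℝ) 2) : betaMap β 1 = β - 1 :=
  betaMap_eq_of_eq_add 1 ⟨by linarith [hβ.1], by linarith [hβ.2]⟩ (by push_cast; ring)

theorem betaMap_zero (β : ℝ) : betaMap β 0 = 0 := by simp [betaMap]

theorem iterate_betaMap_zero (β : ℝ) (n : ℕ) : (betaMap β)^[n] 0 = 0 :=
  Function.iterate_fixed (betaMap_zero β) n

theorem iterate_betaMap_mem_Ico (hx : x ∈ Ico (0 : ℝ) 1) (n : ℕ) :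
    (betaMap β)^[n] x ∈ Ico (0 : ℝ) 1 := by
  cases n with
  | zero => exact hx
  | succ n => rw [Function.iterate_succ_apply']; exact betaMap_mem_Ico _ _

/-- A perturbed orbit stays on the branches of the original one as long as the perturbation, which
grows by the factor `β`, does not push it out of `[0, 1)`. -/
theorem iterate_betaMap_add {η : ℝ} {n : ℕ}
    (h : ∀ j ≤ n, (betaMap β)^[j] x + β ^ j * η ∈ Ico (0 : ℝ) 1) :
    ∀ j ≤ n, (betaMap β)^[j] (x + η) = (betaMap β)^[j] x + β ^ j * η := by
  intro j
  induction j with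
  | zero => intro _; simp
  | succ j ih =>
    intro hj
    have hfloor := mul_eq_floor_add_betaMap β ((betaMap β)^[j] x)
    rw [Function.iterate_succ_apply', ih (by omega)]
    refine betaMap_eq_of_eq_add ⌊β * (betaMap β)^[j] x⌋ (h _ hj) ?_
    rw [Function.iterate_succ_apply']
    linear_combination hfloor

/-- Every right neighbourhood of `x` contains a point at which a branch of an iterate that is
continuous at `x` ends. -/
theorem exists_branch_end {δ : ℝ} (hβ : 1 < β) (hx : x ∈ Ico (0 : ℝ) 1) (hδ : 0 < δ)
    (hxδ : x + δ < 1) :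
    ∃ (n : ℕ) (η : ℝ), 0 < η ∧ η ≤ δ ∧ (betaMap β)^[n + 1] x + β ^ (n + 1) * η = 1 ∧
      ∀ j ≤ n, (betaMap β)^[j] x + β ^ j * η < 1 := by
  have hex : ∃ n : ℕ, 1 ≤ (betaMap β)^[n] x + β ^ n * δ := by
    obtain ⟨n, hn⟩ := pow_unbounded_of_one_lt (1 / δ) hβ
    rw [div_lt_iff₀ hδ] at hn
    exact ⟨n, by linarith [(iterate_betaMap_mem_Ico (β := β) hx n).1]⟩
  classical
  obtain ⟨m, hm, hmin⟩ : ∃ m, (1 ≤ (betaMap β)^[m] x + β ^ m * δ) ∧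
      ∀ j < m, (betaMap β)^[j] x + β ^ j * δ < 1 :=
    ⟨Nat.find hex, Nat.find_spec hex, fun j hj => not_le.1 (Nat.find_min hex hj)⟩
  obtain ⟨n, rfl⟩ : ∃ n, m = n + 1 := Nat.exists_eq_succ_of_ne_zero fun h0 => by
    rw [h0, Function.iterate_zero_apply, pow_zero] at hm
    linarith
  have hp : 0 < β ^ (n + 1) := by positivity
  have hlt := (iterate_betaMap_mem_Ico (β := β) hx (n + 1)).2
  have hle : (1 - (betaMap β)^[n + 1] x) / β ^ (n + 1) ≤ δ := by
    rw [div_le_iff₀ hp]; linarith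
  refine ⟨n, _, div_pos (sub_pos.2 hlt) hp, hle, by field_simp; ring, fun j hj => ?_⟩
  have : β ^ j * ((1 - (betaMap β)^[n + 1] x) / β ^ (n + 1)) ≤ β ^ j * δ := by gcongr
  linarith [hmin j (by omega)]

theorem tendsto_fract_nhdsGE (x : ℝ) : Tendsto Int.fract (𝓝[≥] x) (𝓝[≥] (Int.fract x)) := by
  have hfloor : ∀ᶠ y : ℝ in 𝓝[≥] x, y - ⌊x⌋ = Int.fract y := by
    filter_upwards [tendsto_pure.1 (tendsto_floor_right_pure_floor x)] with y hy
    rw [← hy, Int.self_sub_floor]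
  refine Tendsto.congr' hfloor (tendsto_nhdsWithin_iff.2 ⟨?_, ?_⟩)
  · exact ((continuous_sub_right _).tendsto x).mono_left nhdsWithin_le_nhds
  · filter_upwards [self_mem_nhdsWithin] with y hy
    exact sub_le_sub_right (mem_Ici.1 hy) _

theorem tendsto_betaMap (hβ : 0 ≤ β) (x : ℝ) :
    Tendsto (betaMap β) (𝓝[≥] x) (𝓝[≥] (betaMap β x)) := by
  refine (tendsto_fract_nhdsGE (β * x)).comp (tendsto_nhdsWithin_iff.2 ⟨?_, ?_⟩)
  · exact ((continuous_const_mul β).tendsto x).mono_left nhdsWithin_le_nhds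
  · filter_upwards [self_mem_nhdsWithin] with y hy
    exact mul_le_mul_of_nonneg_left hy hβ

theorem tendsto_iterate_nhdsGE {α : Type*} [TopologicalSpace α] [Preorder α] {f : α → α}
    (hf : ∀ x, Tendsto f (𝓝[≥] x) (𝓝[≥] (f x))) (n : ℕ) (x : α) :
    Tendsto f^[n] (𝓝[≥] x) (𝓝[≥] (f^[n] x)) := by
  induction n generalizing x with
  | zero => exact tendsto_id
  | succ n ih => exact (ih (f x)).comp (hf x)

/-! ### Orbits that stay above a threshold -/

/-- The points whose whole orbit lies in `[t, 1)`. Up to the countably many points whose orbit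
reaches `0`, this is the survivor set of the hole `(0, t)`. -/
def forwardSet (β t : ℝ) : Set ℝ := {x | ∀ n : ℕ, (betaMap β)^[n] x ∈ Ico t 1}

theorem forwardSet_anti (h : s ≤ t) : forwardSet β t ⊆ forwardSet β s :=
  fun _ hx n => ⟨h.trans (hx n).1, (hx n).2⟩

theorem iterate_mem_forwardSet (hx : x ∈ forwardSet β t) (n : ℕ) :
    (betaMap β)^[n] x ∈ forwardSet β t := fun m => by
  rw [← Function.iterate_add_apply]; exact hx _

theorem betaMap_mem_forwardSet (hx : x ∈ forwardSet β t) : betaMap β x ∈ forwardSet β t :=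
  iterate_mem_forwardSet hx 1

theorem mem_forwardSet_of_betaMap (hx : x ∈ Ico t 1) (h : betaMap β x ∈ forwardSet β t) :
    x ∈ forwardSet β t
  | 0 => hx
  | n + 1 => h n

theorem forwardSet_subset_survivorSet (ht : 0 ≤ t) : forwardSet β t ⊆ survivorSet β t :=
  fun _ hx => ⟨⟨ht.trans (hx 0).1, (hx 0).2⟩, fun n h => (hx n).1.not_gt h.2⟩

theorem survivorSet_anti (h : s ≤ t) : survivorSet β t ⊆ survivorSet β s :=
  fun _ hx => ⟨hx.1, fun n hn => hx.2 n ⟨hn.1, hn.2.trans_le h⟩⟩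

theorem countable_preimage_betaMap (hβ : β ≠ 0) {A : Set ℝ} (hA : A.Countable) :
    (betaMap β ⁻¹' A).Countable := by
  refine ((hA.prod (countable_univ (α := ℤ))).image fun p : ℝ × ℤ => (p.2 + p.1) / β).mono ?_
  intro x hx
  refine ⟨(betaMap β x, ⌊β * x⌋), ⟨hx, mem_univ _⟩, ?_⟩
  exact (div_eq_iff hβ).2 (by rw [← mul_eq_floor_add_betaMap, mul_comm])

theorem countable_preimage_iterate_betaMap (hβ : β ≠ 0) {A : Set ℝ} (hA : A.Countable) (n : ℕ) :
    ((betaMap β)^[n] ⁻¹' A).Countable := by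
  induction n with
  | zero => exact hA
  | succ n ih => exact countable_preimage_betaMap hβ ih

theorem survivorSet_subset_forwardSet_union :
    survivorSet β t ⊆ forwardSet β t ∪ ⋃ n : ℕ, (betaMap β)^[n] ⁻¹' {0} := by
  intro x hx
  by_cases h0 : ∃ n : ℕ, (betaMap β)^[n] x = 0
  · exact Or.inr (mem_iUnion.2 h0)
  · push Not at h0
    refine Or.inl fun n => ?_
    have hn := iterate_betaMap_mem_Ico (β := β) hx.1 n
    exact ⟨not_lt.1 fun hlt => hx.2 n ⟨hn.1.lt_of_ne' (h0 n), hlt⟩, hn.2⟩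

theorem dimH_survivorSet (hβ : β ≠ 0) (ht : 0 ≤ t) :
    dimH (survivorSet β t) = dimH (forwardSet β t) := by
  refine le_antisymm ?_ (dimH_mono (forwardSet_subset_survivorSet ht))
  have hzero : (⋃ n : ℕ, (betaMap β)^[n] ⁻¹' {0}).Countable :=
    countable_iUnion fun n => countable_preimage_iterate_betaMap hβ (countable_singleton 0) n
  refine (dimH_mono survivorSet_subset_forwardSet_union).trans ?_
  rw [dimH_union, hzero.dimH_zero, max_eq_left zero_le]

/-- Right-continuity of the iterates keeps an orbit point from falling below the infimum. -/
theorem sInf_orbit_mem_orbitMinimalSet (hβ : 0 ≤ β) (hx : x ∈ Ico (0 : ℝ) 1) :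
    sInf (range fun n => (betaMap β)^[n] x) ∈ orbitMinimalSet β := by
  set m := sInf (range fun n => (betaMap β)^[n] x)
  have hnonneg : ∀ a ∈ range fun n => (betaMap β)^[n] x, 0 ≤ a := by
    rintro _ ⟨n, rfl⟩; exact (iterate_betaMap_mem_Ico hx n).1
  have hle (n : ℕ) : m ≤ (betaMap β)^[n] x := csInf_le ⟨0, hnonneg⟩ ⟨n, rfl⟩
  refine ⟨⟨le_csInf (range_nonempty _) hnonneg, (hle 0).trans_lt hx.2⟩, fun j => ?_⟩
  by_contra! hlt
  have hright := (tendsto_iterate_nhdsGE (tendsto_betaMap hβ) j m).mono_right nhdsWithin_le_nhds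
  obtain ⟨u, hu, hsub⟩ := mem_nhdsGE_iff_exists_Ico_subset.1 (hright.eventually (gt_mem_nhds hlt))
  obtain ⟨_, ⟨n, rfl⟩, hn⟩ := exists_lt_of_csInf_lt (range_nonempty _) (show m < u from hu)
  have hbelow : (betaMap β)^[j] ((betaMap β)^[n] x) < m := hsub ⟨hle n, hn⟩
  rw [← Function.iterate_add_apply] at hbelow
  exact hbelow.not_ge (hle _)

/-- There is a periodic orbit in `[1 - 1/β, 1)`. The negation turns out to be equivalent to each of
the three conditions of the theorem. -/
def HasPeriodicAbove (β : ℝ) : Prop :=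
  ∃ x ∈ forwardSet β (1 - 1 / β), x ∈ Function.periodicPts (betaMap β)

end

section

variable {β t u v : ℝ}

/-! ### Counting the pre-images of `1` along orbits that avoid the hole -/

/-- The ordered points `u ≤ v` lie on the same side of the discontinuity `1/β`, hence on the same
branch of `betaMap β`. -/
def SameBranch (β u v : ℝ) : Prop := v < 1 / β ∨ 1 / β ≤ u

theorem sameBranch_or (β u v : ℝ) : SameBranch β u v ∨ u < 1 / β ∧ 1 / β ≤ v := by
  rw [SameBranch]
  by_cases hv : v < 1 / β
  · exact Or.inl (Or.inl hv)
  · exact (le_or_gt (1 / β) u).imp Or.inr fun hu => ⟨hu, not_lt.1 hv⟩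

theorem SameBranch.betaMap_sub (h : SameBranch β u v) (hβ : β ∈ Ioo (1 : ℝ) 2) (hu : 0 ≤ u)
    (huv : u ≤ v) (hv : v ≤ 1) : betaMap β v - betaMap β u = β * (v - u) := by
  have hβ0 : 0 < β := zero_lt_one.trans hβ.1
  rcases h with h | h
  · rw [betaMap_of_lt hβ0 hu (huv.trans_lt h), betaMap_of_lt hβ0 (hu.trans huv) h]; ring
  · rw [betaMap_of_le hβ h (huv.trans hv), betaMap_of_le hβ (h.trans huv) hv]; ring

/-- The map `x ↦ β x (mod 1)` with values below `t` raised to `t`. -/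
noncomputable def clampMap (β t u : ℝ) : ℝ := max (betaMap β u) t

theorem clampMap_mem_Ico (ht : t < 1) (u : ℝ) : clampMap β t u ∈ Ico t 1 :=
  ⟨le_max_right _ _, max_lt (betaMap_mem_Ico β u).2 ht⟩

theorem clampMap_mem_Icc (ht : t < 1) (u : ℝ) : clampMap β t u ∈ Icc t 1 :=
  Ico_subset_Icc_self (clampMap_mem_Ico ht u)

theorem SameBranch.clampMap_le (h : SameBranch β u v) (hβ : β ∈ Ioo (1 : ℝ) 2) (hu : 0 ≤ u)
    (huv : u ≤ v) (hv : v ≤ 1) : clampMap β t u ≤ clampMap β t v := by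
  refine max_le_max_right t (sub_nonneg.1 ?_)
  rw [h.betaMap_sub hβ hu huv hv]
  exact mul_nonneg (by linarith [hβ.1]) (sub_nonneg.2 huv)

theorem SameBranch.clampMap_sub_le (h : SameBranch β u v) (hβ : β ∈ Ioo (1 : ℝ) 2) (hu : 0 ≤ u)
    (huv : u ≤ v) (hv : v ≤ 1) : clampMap β t v - clampMap β t u ≤ β * (v - u) := by
  have hpos : 0 ≤ β * (v - u) := mul_nonneg (by linarith [hβ.1]) (sub_nonneg.2 huv)
  have hsub := h.betaMap_sub hβ hu huv hv
  have hle := le_max_left (betaMap β u) t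
  have ht := le_max_right (betaMap β u) t
  rw [clampMap, clampMap, sub_le_iff_le_add]
  exact max_le (by linarith) (by linarith)

/-- The transfer operator of the map with the hole `(0, t)`, acting on tail functions
`u ↦ ν [u, 1)`: it turns `ν` into its pull-back under the two branches of the map. -/
noncomputable def tailOp (β t : ℝ) (f : ℝ → ℝ) (u : ℝ) : ℝ :=
  f (clampMap β t u) + (if u < 1 / β then f t else 0) - f (clampMap β t 1)

/-- `tailCount β t n u` counts the points of `[u, 1)` whose orbit stays in `[t, 1)` for `n` steps
and arrives at (the left limit at) `1`. -/
noncomputable def tailCount (β t : ℝ) (n : ℕ) : ℝ → ℝ :=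
  (tailOp β t)^[n] (fun u => if u < 1 then 1 else 0)

theorem tailCount_zero (β t : ℝ) : tailCount β t 0 = fun u => if u < 1 then 1 else 0 := rfl

theorem tailCount_succ (β t : ℝ) (n : ℕ) :
    tailCount β t (n + 1) = tailOp β t (tailCount β t n) :=
  Function.iterate_succ_apply' _ _ _

theorem tailOp_of_lt (f : ℝ → ℝ) (h : u < 1 / β) :
    tailOp β t f u = f (clampMap β t u) + f t - f (clampMap β t 1) := by
  rw [tailOp, if_pos h]

theorem tailOp_of_le (f : ℝ → ℝ) (h : 1 / β ≤ u) :
    tailOp β t f u = f (clampMap β t u) - f (clampMap β t 1) := by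
  rw [tailOp, if_neg (not_lt.2 h), add_zero]

theorem SameBranch.tailOp_sub (h : SameBranch β u v) (huv : u ≤ v) (f : ℝ → ℝ) :
    tailOp β t f u - tailOp β t f v = f (clampMap β t u) - f (clampMap β t v) := by
  rcases h with h | h
  · rw [tailOp_of_lt f h, tailOp_of_lt f (huv.trans_lt h)]; ring
  · rw [tailOp_of_le f h, tailOp_of_le f (h.trans huv)]; ring

theorem tailOp_sub_of_lt_of_le (hu : u < 1 / β) (hv : 1 / β ≤ v) (f : ℝ → ℝ) :
    tailOp β t f u - tailOp β t f v = f (clampMap β t u) + (f t - f (clampMap β t v)) := by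
  rw [tailOp_of_lt f hu, tailOp_of_le f hv]; ring

/-- The functions `u ↦ ν [u, 1)` on `[t, 1]` with a positive measure `ν`, as far as they are
needed here. -/
structure IsTail (t : ℝ) (f : ℝ → ℝ) : Prop where
  anti : AntitoneOn f (Icc t 1)
  one : f 1 = 0

theorem IsTail.nonneg {f : ℝ → ℝ} (hf : IsTail t f) (hu : u ∈ Icc t 1) : 0 ≤ f u := by
  have := hf.anti hu ⟨hu.1.trans hu.2, le_rfl⟩ hu.2
  rwa [hf.one] at this

theorem IsTail.le {f : ℝ → ℝ} (hf : IsTail t f) (hu : u ∈ Icc t 1) : f u ≤ f t :=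
  hf.anti ⟨le_rfl, hu.1.trans hu.2⟩ hu hu.1

theorem IsTail.tailOp {f : ℝ → ℝ} (hf : IsTail t f) (hβ : β ∈ Ioo (1 : ℝ) 2)
    (ht : t ∈ Ico (0 : ℝ) 1) : IsTail t (tailOp β t f) where
  one := by rw [tailOp_of_le _ (one_div_lt_one_of_one_lt hβ.1).le, sub_self]
  anti := by
    intro u hu v hv huv
    have hcu := clampMap_mem_Icc (β := β) ht.2 u
    have hcv := clampMap_mem_Icc (β := β) ht.2 v
    rw [← sub_nonneg]
    rcases sameBranch_or β u v with h | ⟨hu', hv'⟩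
    · rw [h.tailOp_sub huv, sub_nonneg]
      exact hf.anti hcu hcv (h.clampMap_le hβ (ht.1.trans hu.1) huv hv.2)
    · rw [tailOp_sub_of_lt_of_le hu' hv']
      exact add_nonneg (hf.nonneg hcu) (sub_nonneg.2 (hf.le hcv))

theorem isTail_tailCount (hβ : β ∈ Ioo (1 : ℝ) 2) (ht : t ∈ Ico (0 : ℝ) 1) (n : ℕ) :
    IsTail t (tailCount β t n) := by
  induction n with
  | zero =>
    refine ⟨fun u _ v _ huv => ?_, if_neg (lt_irrefl 1)⟩
    simp only [tailCount_zero]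
    split_ifs with hv hu
    exacts [le_rfl, absurd (huv.trans_lt hv) hu, zero_le_one, le_rfl]
  | succ n ih => rw [tailCount_succ]; exact ih.tailOp hβ ht

theorem clampMap_eq_of_lt_of_le (hβ : β ∈ Ioo (1 : ℝ) 2) (hu : u < 1 / β) (hv : 1 / β ≤ v)
    (hv1 : v ≤ 1) (h : β * (v - u) ≤ t) : clampMap β t v = t := by
  rw [lt_div_iff₀' (zero_lt_one.trans hβ.1)] at hu
  rw [clampMap, betaMap_of_le hβ hv hv1]
  exact max_eq_right (by linarith)

theorem one_sub_clampMap_le (hβ : 0 < β) (hu0 : 0 ≤ u) (hu : u < 1 / β) (hv : 1 / β ≤ v) :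
    1 - clampMap β t u ≤ β * (v - u) := by
  rw [div_le_iff₀' hβ] at hv
  have : β * u ≤ clampMap β t u := by rw [← betaMap_of_lt hβ hu0 hu]; exact le_max_left _ _
  linarith

/-- Short intervals carry few pre-images: each of the first `n` steps either expands the interval
or cuts off a part that falls into the hole. -/
theorem tailCount_sub_le (hβ : β ∈ Ioo (1 : ℝ) 2) (ht : t ∈ Ico (0 : ℝ) 1) (m : ℕ) {n : ℕ}
    (hu : t ≤ u) (huv : u ≤ v) (hv : v ≤ 1) (hd : v - u ≤ t * (1 / β) ^ n) :
    tailCount β t (n + m) u - tailCount β t (n + m) v ≤ tailCount β t m t := by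
  have hβ0 : 0 < β := zero_lt_one.trans hβ.1
  induction n generalizing u v with
  | zero =>
    rw [zero_add]
    have htail := isTail_tailCount hβ ht m
    linarith [htail.nonneg ⟨hu.trans huv, hv⟩, htail.le ⟨hu, huv.trans hv⟩]
  | succ n ih =>
    have hcu := clampMap_mem_Icc (β := β) ht.2 u
    have hd' : β * (v - u) ≤ t * (1 / β) ^ n := by
      calc β * (v - u) ≤ β * (t * (1 / β) ^ (n + 1)) := by gcongr
        _ = t * (1 / β) ^ n := by rw [pow_succ]; field_simp
    rw [show n + 1 + m = n + m + 1 by ring, tailCount_succ]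
    rcases sameBranch_or β u v with h | ⟨hu', hv'⟩
    · rw [h.tailOp_sub huv]
      exact ih hcu.1 (h.clampMap_le hβ (ht.1.trans hu) huv hv) (clampMap_mem_Icc ht.2 v).2
        ((h.clampMap_sub_le hβ (ht.1.trans hu) huv hv).trans hd')
    · have hle : β * (v - u) ≤ t := hd'.trans
        (mul_le_of_le_one_right ht.1 (pow_le_one₀ (by positivity)
          (one_div_lt_one_of_one_lt hβ.1).le))
      rw [tailOp_sub_of_lt_of_le hu' hv', clampMap_eq_of_lt_of_le hβ hu' hv' hv hle, sub_self,
        add_zero]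
      have := ih hcu.1 hcu.2 le_rfl ((one_sub_clampMap_le hβ0 (ht.1.trans hu) hu' hv').trans hd')
      rwa [(isTail_tailCount hβ ht _).one, sub_zero] at this

/-! ### Covering the survivors -/

/-- The set `A` is covered by at most `N` closed intervals of length `r`. The bound `N` is a real
number so that it can be compared with the counts. -/
def CoveredBy (A : Set ℝ) (N r : ℝ) : Prop :=
  ∃ S : Finset ℝ, (S.card : ℝ) ≤ N ∧ A ⊆ ⋃ s ∈ S, Icc s (s + r)

theorem CoveredBy.mono {A B : Set ℝ} {N r : ℝ} (h : CoveredBy B N r) (hAB : A ⊆ B) :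
    CoveredBy A N r :=
  let ⟨S, hS, hB⟩ := h
  ⟨S, hS, hAB.trans hB⟩

theorem CoveredBy.union {A B : Set ℝ} {M N r : ℝ} (hA : CoveredBy A M r) (hB : CoveredBy B N r) :
    CoveredBy (A ∪ B) (M + N) r := by
  classical
  obtain ⟨S, hS, hAS⟩ := hA
  obtain ⟨S', hS', hBS'⟩ := hB
  refine ⟨S ∪ S', ?_, ?_⟩
  · exact (Nat.cast_le.2 (Finset.card_union_le S S')).trans (by push_cast; linarith)
  · rw [Finset.set_biUnion_union]
    exact union_subset_union hAS hBS'

theorem CoveredBy.of_affine {A B : Set ℝ} {N r b d : ℝ} (h : CoveredBy B N r) (hb : 0 < b)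
    (hAB : ∀ x ∈ A, b * x - d ∈ B) : CoveredBy A N (r / b) := by
  classical
  obtain ⟨S, hS, hBS⟩ := h
  refine ⟨S.image fun s => (s + d) / b, (Nat.cast_le.2 Finset.card_image_le).trans hS, ?_⟩
  intro x hx
  obtain ⟨s, hs, h1, h2⟩ := by simpa only [mem_iUnion, mem_Icc, exists_prop] using hBS (hAB x hx)
  refine mem_iUnion₂.2 ⟨(s + d) / b, Finset.mem_image_of_mem _ hs, ?_, ?_⟩
  · rw [div_le_iff₀' hb]; linarith
  · rw [← add_div, le_div_iff₀' hb]; linarith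

theorem SameBranch.sum_tailCount_sub (h : SameBranch β u v) (huv : u ≤ v) (ht : t < 1) (n : ℕ) :
    ∑ i ∈ Finset.range (n + 1), (tailCount β t (i + 1) u - tailCount β t (i + 1) v) =
      ∑ i ∈ Finset.range n,
        (tailCount β t (i + 1) (clampMap β t u) - tailCount β t (i + 1) (clampMap β t v)) := by
  rw [Finset.sum_range_succ']
  simp only [tailCount_succ β t (_ + 1), tailCount_succ β t 0, h.tailOp_sub huv]
  simp [tailCount_zero, (clampMap_mem_Ico ht _).2]

theorem sum_tailCount_sub_of_lt_of_le (hu : u < 1 / β) (hv : 1 / β ≤ v) (ht : t < 1) (n : ℕ) :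
    ∑ i ∈ Finset.range (n + 1), (tailCount β t (i + 1) u - tailCount β t (i + 1) v) =
      ∑ i ∈ Finset.range n, tailCount β t (i + 1) (clampMap β t u) +
      ∑ i ∈ Finset.range n, (tailCount β t (i + 1) t - tailCount β t (i + 1) (clampMap β t v)) +
      1 := by
  rw [Finset.sum_range_succ']
  simp only [tailCount_succ β t (_ + 1), tailCount_succ β t 0, tailOp_sub_of_lt_of_le hu hv,
    ← Finset.sum_add_distrib]
  simp [tailCount_zero, (clampMap_mem_Ico ht _).2, ht]

theorem SameBranch.betaMap_mem (h : SameBranch β u v) (hβ : β ∈ Ioo (1 : ℝ) 2) (hu : 0 ≤ u)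
    (hv : v ≤ 1) {x : ℝ} (hx : x ∈ forwardSet β t ∩ Ico u v) :
    betaMap β x ∈ forwardSet β t ∩ Ico (clampMap β t u) (clampMap β t v) := by
  obtain ⟨hxt, hux, hxv⟩ := hx
  have hβ0 : 0 < β := zero_lt_one.trans hβ.1
  have hl := SameBranch.betaMap_sub (h.imp hxv.trans id) hβ hu hux (hxv.le.trans hv)
  have hr := SameBranch.betaMap_sub (h.imp id hux.trans') hβ (hu.trans hux) hxv.le hv
  have hl' : 0 ≤ β * (x - u) := mul_nonneg hβ0.le (sub_nonneg.2 hux)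
  have hr' : 0 < β * (v - x) := mul_pos hβ0 (sub_pos.2 hxv)
  have hTx := betaMap_mem_forwardSet hxt
  exact ⟨hTx, max_le (by linarith) (hTx 0).1, lt_max_of_lt_left (by linarith)⟩

theorem betaMap_mem_of_lt_one_div (hβ : β ∈ Ioo (1 : ℝ) 2) (hu : 0 ≤ u) {x : ℝ}
    (hx : x ∈ forwardSet β t ∩ Ico u (1 / β)) :
    betaMap β x ∈ forwardSet β t ∩ Ico (clampMap β t u) 1 := by
  obtain ⟨hxt, hux, hlt⟩ := hx
  have hTx := betaMap_mem_forwardSet hxt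
  have hle := SameBranch.clampMap_le (t := t) (Or.inl hlt) hβ hu hux (hxt 0).2.le
  exact ⟨hTx, hle.trans_eq (max_eq_left (hTx 0).1), (hTx 0).2⟩

theorem coveredBy_forwardSet_inter_Ico (hβ : β ∈ Ioo (1 : ℝ) 2) (ht : t ∈ Ico (0 : ℝ) 1) (n : ℕ)
    (hu : t ≤ u) (huv : u ≤ v) (hv : v ≤ 1) :
    CoveredBy (forwardSet β t ∩ Ico u v)
      (1 + ∑ i ∈ Finset.range n, (tailCount β t (i + 1) u - tailCount β t (i + 1) v))
      ((1 / β) ^ n) := by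
  have hβ0 : 0 < β := zero_lt_one.trans hβ.1
  have hu0 := ht.1.trans hu
  induction n generalizing u v with
  | zero =>
    refine ⟨{u}, by simp, fun x hx => ?_⟩
    simp only [Finset.mem_singleton, iUnion_iUnion_eq_left, pow_zero, mem_Icc]
    exact ⟨hx.2.1, by linarith [hx.2.2]⟩
  | succ n ih =>
    have hcu := clampMap_mem_Icc (β := β) ht.2 u
    have hcv := clampMap_mem_Icc (β := β) ht.2 v
    rw [pow_succ, mul_one_div]
    rcases sameBranch_or β u v with h | ⟨hu', hv'⟩
    · rw [h.sum_tailCount_sub huv ht.2]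
      refine (ih hcu.1 (h.clampMap_le hβ hu0 huv hv) hcv.2 (ht.1.trans hcu.1)).of_affine
        (d := β * u - betaMap β u) hβ0 fun x hx => ?_
      have hbranch := SameBranch.betaMap_sub (h.imp hx.2.2.trans id) hβ hu0 hx.2.1
        (hx.2.2.le.trans hv)
      rw [show β * x - (β * u - betaMap β u) = betaMap β x by linarith]
      exact h.betaMap_mem hβ hu0 hv hx
    · have hleft := (ih hcu.1 hcu.2 le_rfl (ht.1.trans hcu.1)).of_affine
        (A := forwardSet β t ∩ Ico u (1 / β)) (d := 0) hβ0 fun x hx => by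
          rw [sub_zero, ← betaMap_of_lt hβ0 (hu0.trans hx.2.1) hx.2.2]
          exact betaMap_mem_of_lt_one_div hβ hu0 hx
      have hright := (ih le_rfl hcv.1 hcv.2 ht.1).of_affine
        (A := forwardSet β t ∩ Ico (1 / β) v) (d := 1) hβ0 fun x hx => by
          rw [← betaMap_of_le hβ hx.2.1 (hx.1 0).2.le]
          obtain ⟨hTx, -, hlt⟩ := SameBranch.betaMap_mem (Or.inr le_rfl) hβ (by positivity) hv hx
          exact ⟨hTx, (hTx 0).1, hlt⟩
      simp only [(isTail_tailCount hβ ht _).one, sub_zero] at hleft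
      rw [sum_tailCount_sub_of_lt_of_le hu' hv' ht.2]
      convert (hleft.union hright).mono _ using 1
      · ring
      · rw [← inter_union_distrib_left, Ico_union_Ico_eq_Ico hu'.le hv']

/-! ### The dimension of the survivor set vanishes when the counts grow subexponentially -/

/-- The number of pre-images of `1` along orbits that avoid the hole `(0, t)` grows
subexponentially: its generating function converges in the open unit disc. -/
def HasSubexponentialCounts (β t : ℝ) : Prop :=
  ∀ z ∈ Ioo (0 : ℝ) 1, Summable fun n => z ^ n * tailCount β t n t

theorem hausdorffMeasure_le_of_coveredBy {A : Set ℝ} {b C d : ℝ} (hb : b ∈ Ioo (0 : ℝ) 1)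
    (h : ∀ n : ℕ, ∃ N, CoveredBy A N (b ^ n) ∧ N * (b ^ n) ^ d ≤ C) :
    Measure.hausdorffMeasure d A ≤ ENNReal.ofReal C := by
  choose N hN hC using h
  choose S hS hcov using hN
  have hdiam (n : ℕ) (s : S n) :
      Metric.ediam (Icc (s : ℝ) (s + b ^ n)) = ENNReal.ofReal (b ^ n) := by
    rw [Real.ediam_Icc, add_sub_cancel_left]
  have hlim : Tendsto (fun n : ℕ => ENNReal.ofReal (b ^ n)) atTop (𝓝 0) := by
    rw [← ENNReal.ofReal_zero]
    exact ENNReal.tendsto_ofReal (tendsto_pow_atTop_nhds_zero_of_lt_one hb.1.le hb.2)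
  refine (Measure.hausdorffMeasure_le_liminf_sum d A (fun n => ENNReal.ofReal (b ^ n)) hlim
    (fun n (s : S n) => Icc (s : ℝ) (s + b ^ n)) (Eventually.of_forall fun n s => (hdiam n s).le)
    (Eventually.of_forall fun n => ?_)).trans ?_
  · rw [iUnion_subtype]; exact hcov n
  · refine liminf_le_of_frequently_le' (Frequently.of_forall fun n => ?_)
    simp only [hdiam, Finset.sum_const, Finset.card_univ, Fintype.card_coe, nsmul_eq_mul]
    rw [ENNReal.ofReal_rpow_of_pos (pow_pos hb.1 n), ← ENNReal.ofReal_natCast,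
      ← ENNReal.ofReal_mul (Nat.cast_nonneg _)]
    have hpos : 0 ≤ (b ^ n) ^ d := Real.rpow_nonneg (pow_nonneg hb.1.le n) d
    exact ENNReal.ofReal_le_ofReal ((mul_le_mul_of_nonneg_right (hS n) hpos).trans (hC n))

theorem dimH_eq_zero_of_coveredBy {A : Set ℝ} {b : ℝ} (hb : b ∈ Ioo (0 : ℝ) 1)
    (h : ∀ z ∈ Ioo (0 : ℝ) 1, ∃ C, ∀ n : ℕ, ∃ N, CoveredBy A N (b ^ n) ∧ N * z ^ n ≤ C) :
    dimH A = 0 := by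
  refine le_antisymm (ENNReal.le_of_forall_pos_le_add fun d hd _ => ?_) zero_le
  rw [zero_add]
  obtain ⟨C, hC⟩ := h (b ^ (d : ℝ)) ⟨Real.rpow_pos_of_pos hb.1 _, Real.rpow_lt_one hb.1.le hb.2 hd⟩
  refine dimH_le_of_hausdorffMeasure_ne_top (ne_top_of_le_ne_top (ENNReal.ofReal_ne_top (r := C))
    (hausdorffMeasure_le_of_coveredBy hb fun n => ?_))
  obtain ⟨N, hN, hNC⟩ := hC n
  exact ⟨N, hN, by rwa [← Real.rpow_pow_comm hb.1.le]⟩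

theorem sum_tailCount_mul_pow_le (hβ : β ∈ Ioo (1 : ℝ) 2) (ht : t ∈ Ico (0 : ℝ) 1) {z : ℝ}
    (hz : z ∈ Ioo (0 : ℝ) 1) (h : Summable fun n => z ^ n * tailCount β t n t) (n : ℕ) :
    (∑ i ∈ Finset.range n, tailCount β t (i + 1) t) * z ^ n ≤
      (∑' n, z ^ n * tailCount β t n t) / z := by
  have hnonneg (i : ℕ) : 0 ≤ tailCount β t i t :=
    (isTail_tailCount hβ ht i).nonneg ⟨le_rfl, ht.2.le⟩
  rw [le_div_iff₀ hz.1]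
  calc (∑ i ∈ Finset.range n, tailCount β t (i + 1) t) * z ^ n * z
      = ∑ i ∈ Finset.range n, z ^ (n + 1) * tailCount β t (i + 1) t := by
        rw [mul_assoc, ← pow_succ, mul_comm, Finset.mul_sum]
    _ ≤ ∑ i ∈ Finset.range n, z ^ (i + 1) * tailCount β t (i + 1) t := by
        refine Finset.sum_le_sum fun i hi => mul_le_mul_of_nonneg_right ?_ (hnonneg _)
        exact pow_le_pow_of_le_one hz.1.le hz.2.le (Nat.succ_le_succ (Finset.mem_range.1 hi).le)
    _ ≤ ∑ i ∈ Finset.range (n + 1), z ^ i * tailCount β t i t := by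
        rw [Finset.sum_range_succ']
        exact le_add_of_nonneg_right (mul_nonneg (pow_nonneg hz.1.le 0) (hnonneg 0))
    _ ≤ _ := h.sum_le_tsum _ fun i _ => mul_nonneg (pow_nonneg hz.1.le _) (hnonneg i)

theorem dimH_forwardSet_eq_zero (hβ : β ∈ Ioo (1 : ℝ) 2) (ht : t ∈ Ico (0 : ℝ) 1)
    (h : HasSubexponentialCounts β t) : dimH (forwardSet β t) = 0 := by
  have hβ0 : 0 < β := zero_lt_one.trans hβ.1
  refine dimH_eq_zero_of_coveredBy (b := 1 / β)
    ⟨by positivity, one_div_lt_one_of_one_lt hβ.1⟩ fun z hz => ?_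
  refine ⟨1 + (∑' n, z ^ n * tailCount β t n t) / z, fun n =>
    ⟨_, (coveredBy_forwardSet_inter_Ico hβ ht n le_rfl ht.2.le le_rfl).mono
      fun x hx => ⟨hx, hx 0⟩, ?_⟩⟩
  simp only [(isTail_tailCount hβ ht _).one, sub_zero]
  rw [add_mul, one_mul]
  exact add_le_add (pow_le_one₀ hz.1.le hz.2.le) (sum_tailCount_mul_pow_le hβ ht hz (h z hz) n)

end

section

variable {β t u v z : ℝ}

/-! ### The dimension of the survivor set is positive when the counts grow exponentially -/

theorem le_rpow_logb_of_geometric {a b d e : ℝ} (ha : 0 < a) (hb : b ∈ Ioo (0 : ℝ) 1)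
    (hz : z ∈ Ioo (0 : ℝ) 1) (hd : 0 ≤ d) (he : e ≤ 1) (h : ∀ n : ℕ, d ≤ a * b ^ n → e ≤ z ^ n) :
    e ≤ z⁻¹ * (d / a) ^ Real.logb b z := by
  have hr : 0 < Real.logb b z := Real.logb_pos_of_base_lt_one hb.1 hb.2 hz.1 hz.2
  rcases hd.eq_or_lt with rfl | hd
  · have hlim := tendsto_pow_atTop_nhds_zero_of_lt_one hz.1.le hz.2
    rw [zero_div, Real.zero_rpow hr.ne', mul_zero]
    exact ge_of_tendsto' hlim fun n => h n (by have := hb.1; positivity)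
  rcases le_or_gt (d / a) 1 with hle | hgt
  · obtain ⟨n, hn, hn'⟩ := exists_nat_pow_near_of_lt_one (div_pos hd ha) hle hb.1 hb.2
    calc e ≤ z ^ n := h n ((div_le_iff₀' ha).1 hn')
      _ = z⁻¹ * z ^ (n + 1) := by rw [pow_succ']; field_simp [hz.1.ne']
      _ = z⁻¹ * (b ^ (n + 1)) ^ Real.logb b z := by
        rw [← Real.rpow_pow_comm hb.1.le, Real.rpow_logb hb.1 hb.2.ne hz.1]
      _ ≤ z⁻¹ * (d / a) ^ Real.logb b z := by
        have := hz.1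
        have := hb.1
        gcongr
  · have hone := Real.one_le_rpow hgt.le hr.le
    exact he.trans (one_le_mul_of_one_le_of_one_le ((one_le_inv₀ hz.1).2 hz.2.le) hone)

theorem exists_holderOnWith_of_geometric {X Y : Type*} [PseudoMetricSpace X] [PseudoMetricSpace Y]
    {A : Set X} {F : X → Y} {a b : ℝ} (ha : 0 < a) (hb : b ∈ Ioo (0 : ℝ) 1)
    (hz : z ∈ Ioo (0 : ℝ) 1) (hF : ∀ x ∈ A, ∀ y ∈ A, dist (F x) (F y) ≤ 1)
    (h : ∀ n : ℕ, ∀ x ∈ A, ∀ y ∈ A, dist x y ≤ a * b ^ n → dist (F x) (F y) ≤ z ^ n) :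
    ∃ C r : ℝ≥0, 0 < r ∧ HolderOnWith C r F A := by
  set r := Real.logb b z
  have hr : 0 < r := Real.logb_pos_of_base_lt_one hb.1 hb.2 hz.1 hz.2
  have hC : 0 ≤ z⁻¹ / a ^ r := div_nonneg (inv_nonneg.2 hz.1.le) (Real.rpow_nonneg ha.le r)
  refine ⟨Real.toNNReal (z⁻¹ / a ^ r), Real.toNNReal r, Real.toNNReal_pos.2 hr,
    fun x hx y hy => ?_⟩
  have hle := le_rpow_logb_of_geometric ha hb hz dist_nonneg (hF x hx y hy) fun n => h n x hx y hy
  rw [Real.div_rpow dist_nonneg ha.le, mul_div_assoc', mul_div_right_comm] at hle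
  rw [edist_dist, edist_dist, Real.coe_toNNReal r hr.le,
    ENNReal.ofReal_rpow_of_nonneg dist_nonneg hr.le, ENNReal.ofNNReal_toNNReal,
    ← ENNReal.ofReal_mul hC]
  exact ENNReal.ofReal_le_ofReal hle

/-- The image of the complement of `K` is countable: it is taken at rational points. -/
theorem dimH_pos_of_holderOnWith {a b : ℝ} (hab : a ≤ b) {K : Set ℝ} {F : ℝ → ℝ} {C r : ℝ≥0}
    (hr : 0 < r) (hF : HolderOnWith C r F (Icc a b)) (hne : F a ≠ F b)
    (hloc : ∀ u ∈ Ico a b, u ∉ K → ∀ᶠ v in 𝓝[≥] u, F v = F u) : 0 < dimH K := by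
  have hsub : uIcc (F a) (F b) ⊆ F '' (K ∩ Icc a b) ∪ F '' insert b (range ((↑) : ℚ → ℝ)) := by
    intro y hy
    rw [← uIcc_of_le hab] at hF
    obtain ⟨u, hu, rfl⟩ := intermediate_value_uIcc (hF.continuousOn hr) hy
    rw [uIcc_of_le hab] at hu
    by_cases huK : u ∈ K
    · exact Or.inl ⟨u, ⟨huK, hu⟩, rfl⟩
    · right
      rcases hu.2.lt_or_eq with hlt | rfl
      · obtain ⟨w, hw, hsub⟩ := mem_nhdsGE_iff_exists_Ico_subset.1 (hloc u ⟨hu.1, hlt⟩ huK)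
        obtain ⟨x, hx1, hx2⟩ := exists_rat_btwn (show u < w from hw)
        exact ⟨x, mem_insert_of_mem _ ⟨x, rfl⟩, hsub ⟨hx1.le, hx2⟩⟩
      · exact ⟨u, mem_insert u _, rfl⟩
  have hone : 1 ≤ dimH (F '' (K ∩ Icc a b)) := by
    have hinterior : (interior (uIcc (F a) (F b))).Nonempty := by
      rw [uIcc, interior_Icc]
      exact nonempty_Ioo.2 (inf_lt_sup.2 hne)
    have hle := dimH_mono hsub
    rw [dimH_union, (((countable_range _).insert b).image F).dimH_zero, max_eq_left zero_le] at hle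
    simpa [Real.dimH_of_nonempty_interior hinterior] using hle
  have himage := (hF.mono (inter_subset_right (s := K))).dimH_image_le hr
  refine pos_iff_ne_zero.2 fun hK => ?_
  have hzero : dimH (K ∩ Icc a b) = 0 := le_antisymm (hK ▸ dimH_mono inter_subset_left) zero_le
  rw [hzero, ENNReal.zero_div] at himage
  exact absurd (hone.trans himage) (by simp)

theorem eventually_nhdsGE_lt_iff {α : Type*} [LinearOrder α] [TopologicalSpace α]
    [OrderTopology α] (a u : α) : ∀ᶠ v in 𝓝[≥] u, (v < a ↔ u < a) := by
  rcases lt_or_ge u a with h | h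
  · filter_upwards [Ico_mem_nhdsGE h] with v hv
    exact iff_of_true hv.2 h
  · filter_upwards [self_mem_nhdsWithin] with v hv
    exact iff_of_false (not_lt.2 (h.trans hv)) (not_lt.2 h)

theorem eventually_tailCount_eq (hβ : 0 ≤ β) {n : ℕ} (hu : u ∈ Ico t 1)
    (h : (betaMap β)^[n] u < t) :
    ∀ᶠ v in 𝓝[≥] u, ∀ m ≥ n, tailCount β t m v = tailCount β t m u := by
  induction n generalizing u with
  | zero => exact absurd h (not_lt.2 hu.1)
  | succ n ih =>
    have hstep : ∀ᶠ v in 𝓝[≥] u, ∀ m ≥ n,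
        tailCount β t m (clampMap β t v) = tailCount β t m (clampMap β t u) := by
      have htend := tendsto_betaMap hβ u
      simp only [clampMap]
      rcases lt_or_ge (betaMap β u) t with hlt | hge
      · filter_upwards [(htend.mono_right nhdsWithin_le_nhds).eventually (gt_mem_nhds hlt)]
          with v hv m _
        rw [max_eq_right hlt.le, max_eq_right (le_of_lt hv)]
      · filter_upwards [htend.eventually (ih ⟨hge, (betaMap_mem_Ico β u).2⟩ h),
          htend.eventually self_mem_nhdsWithin] with v hv hle
        rwa [max_eq_left hge, max_eq_left (hge.trans hle)]
    filter_upwards [hstep, eventually_nhdsGE_lt_iff (1 / β) u] with v hv hbranch m hm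
    obtain ⟨k, rfl⟩ := Nat.exists_eq_add_of_le' (n.succ_pos.trans_le hm)
    simp only [tailCount_succ, tailOp, hbranch, hv k (Nat.le_of_succ_le_succ hm)]

/-- The partial sums of the generating function of the counts. -/
noncomputable def tailSum (β t z : ℝ) (M : ℕ) (u : ℝ) : ℝ :=
  ∑ m ∈ Finset.range M, z ^ m * tailCount β t m u

/-- A normalised limit of the partial sums, the tail function of a measure carried by the
survivors. Limits are taken along an ultrafilter because the ratios need not converge. -/
noncomputable def staircase (β t z u : ℝ) : ℝ :=
  limUnder (hyperfilter ℕ : Filter ℕ) fun M => tailSum β t z M u / tailSum β t z M t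

theorem isTail_tailSum (hβ : β ∈ Ioo (1 : ℝ) 2) (ht : t ∈ Ico (0 : ℝ) 1) (hz : 0 ≤ z) (M : ℕ) :
    IsTail t (tailSum β t z M) where
  anti _ hu _ hv huv := Finset.sum_le_sum fun m _ =>
    mul_le_mul_of_nonneg_left ((isTail_tailCount hβ ht m).anti hu hv huv) (pow_nonneg hz m)
  one := Finset.sum_eq_zero fun m _ => by rw [(isTail_tailCount hβ ht m).one, mul_zero]

theorem tendsto_tailSum_atTop (hβ : β ∈ Ioo (1 : ℝ) 2) (ht : t ∈ Ico (0 : ℝ) 1) (hz : 0 ≤ z)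
    (h : ¬ Summable fun n => z ^ n * tailCount β t n t) :
    Tendsto (fun M => tailSum β t z M t) atTop atTop := by
  have hterm (m : ℕ) : 0 ≤ z ^ m * tailCount β t m t :=
    mul_nonneg (pow_nonneg hz m) ((isTail_tailCount hβ ht m).nonneg ⟨le_rfl, ht.2.le⟩)
  exact (not_summable_iff_tendsto_nat_atTop_of_nonneg hterm).1 h

theorem tendsto_staircase (hβ : β ∈ Ioo (1 : ℝ) 2) (ht : t ∈ Ico (0 : ℝ) 1) (hz : 0 ≤ z)
    (hu : u ∈ Icc t 1) :
    Tendsto (fun M => tailSum β t z M u / tailSum β t z M t) (hyperfilter ℕ)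
      (𝓝 (staircase β t z u)) := by
  have hmem (M : ℕ) : tailSum β t z M u / tailSum β t z M t ∈ Icc (0 : ℝ) 1 := by
    have htail := isTail_tailSum hβ ht hz M
    have ht0 := htail.nonneg ⟨le_rfl, ht.2.le⟩
    exact ⟨div_nonneg (htail.nonneg hu) ht0, div_le_one_of_le₀ (htail.le hu) ht0⟩
  obtain ⟨y, -, hy⟩ := isCompact_Icc.ultrafilter_le_nhds
    ((hyperfilter ℕ).map fun M => tailSum β t z M u / tailSum β t z M t)
    (tendsto_principal.2 (Eventually.of_forall hmem))
  exact tendsto_nhds_limUnder ⟨y, hy⟩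

theorem isTail_staircase (hβ : β ∈ Ioo (1 : ℝ) 2) (ht : t ∈ Ico (0 : ℝ) 1) (hz : 0 ≤ z) :
    IsTail t (staircase β t z) where
  anti u hu v hv huv := le_of_tendsto_of_tendsto' (tendsto_staircase hβ ht hz hv)
    (tendsto_staircase hβ ht hz hu) fun M => by
      have htail := isTail_tailSum hβ ht hz M
      exact div_le_div_of_nonneg_right (htail.anti hu hv huv) (htail.nonneg ⟨le_rfl, ht.2.le⟩)
  one := tendsto_nhds_unique (tendsto_staircase hβ ht hz ⟨ht.2.le, le_rfl⟩) <| by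
    simp only [(isTail_tailSum hβ ht hz _).one, zero_div]
    exact tendsto_const_nhds

theorem staircase_self (hβ : β ∈ Ioo (1 : ℝ) 2) (ht : t ∈ Ico (0 : ℝ) 1) (hz : 0 ≤ z)
    (h : ¬ Summable fun n => z ^ n * tailCount β t n t) : staircase β t z t = 1 := by
  refine tendsto_nhds_unique (tendsto_staircase hβ ht hz ⟨le_rfl, ht.2.le⟩)
    (tendsto_const_nhds.congr' (Nat.hyperfilter_le_atTop ?_))
  filter_upwards [(tendsto_tailSum_atTop hβ ht hz h).eventually_gt_atTop 0] with M hM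
  rw [div_self hM.ne']

theorem tailSum_sub_le (hβ : β ∈ Ioo (1 : ℝ) 2) (ht : t ∈ Ico (0 : ℝ) 1) (hz : 0 ≤ z) {n : ℕ}
    (hu : t ≤ u) (huv : u ≤ v) (hv : v ≤ 1) (hd : v - u ≤ t * (1 / β) ^ n) (k : ℕ) :
    tailSum β t z (n + k) u - tailSum β t z (n + k) v ≤
      tailSum β t z n t + z ^ n * tailSum β t z k t := by
  have hstart : tailSum β t z n u - tailSum β t z n v ≤ tailSum β t z n t := by
    have htail := isTail_tailSum hβ ht hz n
    linarith [htail.nonneg ⟨hu.trans huv, hv⟩, htail.le ⟨hu, huv.trans hv⟩]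
  have hrest : ∑ m ∈ Finset.range k,
      z ^ (n + m) * (tailCount β t (n + m) u - tailCount β t (n + m) v) ≤
        z ^ n * tailSum β t z k t := by
    rw [tailSum, Finset.mul_sum]
    refine Finset.sum_le_sum fun m _ => ?_
    rw [← mul_assoc, ← pow_add]
    exact mul_le_mul_of_nonneg_left (tailCount_sub_le hβ ht m hu huv hv hd) (pow_nonneg hz _)
  simp only [mul_sub, Finset.sum_sub_distrib] at hrest
  simp only [tailSum, Finset.sum_range_add] at hstart hrest ⊢
  linarith

theorem staircase_sub_le (hβ : β ∈ Ioo (1 : ℝ) 2) (ht : t ∈ Ico (0 : ℝ) 1) (hz : 0 ≤ z)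
    (h : ¬ Summable fun n => z ^ n * tailCount β t n t) {n : ℕ} (hu : t ≤ u) (huv : u ≤ v)
    (hv : v ≤ 1) (hd : v - u ≤ t * (1 / β) ^ n) :
    staircase β t z u - staircase β t z v ≤ z ^ n := by
  have htop := tendsto_tailSum_atTop hβ ht hz h
  have hlim : Tendsto (fun M => tailSum β t z n t / tailSum β t z M t + z ^ n)
      (hyperfilter ℕ) (𝓝 (0 + z ^ n)) :=
    ((tendsto_const_nhds.div_atTop htop).add_const _).mono_left Nat.hyperfilter_le_atTop
  rw [zero_add] at hlim
  refine le_of_tendsto_of_tendsto ((tendsto_staircase hβ ht hz ⟨hu, huv.trans hv⟩).sub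
    (tendsto_staircase hβ ht hz ⟨hu.trans huv, hv⟩)) hlim (Nat.hyperfilter_le_atTop ?_)
  filter_upwards [htop.eventually_gt_atTop 0, eventually_ge_atTop n] with M hM hnM
  obtain ⟨k, rfl⟩ := Nat.exists_eq_add_of_le hnM
  have hmono : tailSum β t z k t ≤ tailSum β t z (n + k) t :=
    Finset.sum_le_sum_of_subset_of_nonneg (Finset.range_mono (Nat.le_add_left k n)) fun m _ _ =>
      mul_nonneg (pow_nonneg hz m) ((isTail_tailCount hβ ht m).nonneg ⟨le_rfl, ht.2.le⟩)
  rw [← sub_div, div_add' _ _ _ hM.ne']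
  exact div_le_div_of_nonneg_right ((tailSum_sub_le hβ ht hz hu huv hv hd k).trans
    (add_le_add_right (mul_le_mul_of_nonneg_left hmono (pow_nonneg hz n)) _)) hM.le

theorem eventually_staircase_eq (hβ : β ∈ Ioo (1 : ℝ) 2) (ht : t ∈ Ico (0 : ℝ) 1) (hz : 0 ≤ z)
    (h : ¬ Summable fun n => z ^ n * tailCount β t n t) (hu : u ∈ Ico t 1) {n : ℕ}
    (hn : (betaMap β)^[n] u < t) : ∀ᶠ v in 𝓝[≥] u, staircase β t z v = staircase β t z u := by
  have htop := tendsto_tailSum_atTop hβ ht hz h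
  filter_upwards [eventually_tailCount_eq (zero_le_one.trans hβ.1.le) hu hn, Ico_mem_nhdsGE hu.2]
    with v hv hv1
  have hlim : Tendsto (fun M => tailSum β t z M v / tailSum β t z M t -
      tailSum β t z M u / tailSum β t z M t) (hyperfilter ℕ) (𝓝 0) := by
    refine Tendsto.mono_left ?_ Nat.hyperfilter_le_atTop
    refine ((tendsto_const_nhds (x := tailSum β t z n v - tailSum β t z n u)).div_atTop
      htop).congr' ?_
    filter_upwards [eventually_ge_atTop n] with M hnM
    obtain ⟨k, rfl⟩ := Nat.exists_eq_add_of_le hnM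
    rw [← sub_div]
    congr 1
    simp only [tailSum, Finset.sum_range_add, hv _ (Nat.le_add_right n _)]
    ring
  have hsub := (tendsto_staircase hβ ht hz ⟨hu.1.trans hv1.1, hv1.2.le⟩).sub
    (tendsto_staircase hβ ht hz ⟨hu.1, hu.2.le⟩)
  exact sub_eq_zero.1 (tendsto_nhds_unique hsub hlim)

theorem dist_staircase_le (hβ : β ∈ Ioo (1 : ℝ) 2) (ht : t ∈ Ico (0 : ℝ) 1) (hz : 0 ≤ z)
    (h : ¬ Summable fun n => z ^ n * tailCount β t n t) (n : ℕ) (hu : u ∈ Icc t 1)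
    (hv : v ∈ Icc t 1) (hd : dist u v ≤ t * (1 / β) ^ n) :
    dist (staircase β t z u) (staircase β t z v) ≤ z ^ n := by
  wlog huv : u ≤ v generalizing u v
  · rw [dist_comm] at hd ⊢
    exact this hv hu hd (le_of_not_ge huv)
  rw [dist_comm, Real.dist_eq, abs_of_nonneg (sub_nonneg.2 huv)] at hd
  have hanti := (isTail_staircase hβ ht hz).anti hu hv huv
  rw [Real.dist_eq, abs_of_nonneg (sub_nonneg.2 hanti)]
  exact staircase_sub_le hβ ht hz h hu.1 huv hv.2 hd

theorem dimH_survivorSet_pos (hβ : β ∈ Ioo (1 : ℝ) 2) (ht : t ∈ Ioo (0 : ℝ) 1)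
    (hz : z ∈ Ioo (0 : ℝ) 1) (h : ¬ Summable fun n => z ^ n * tailCount β t n t) :
    0 < dimH (survivorSet β t) := by
  have hβ0 : 0 < β := zero_lt_one.trans hβ.1
  have ht' : t ∈ Ico (0 : ℝ) 1 := ⟨ht.1.le, ht.2⟩
  have htail := isTail_staircase hβ ht' hz.1.le
  have hself := staircase_self hβ ht' hz.1.le h
  have hmem (u : ℝ) (hu : u ∈ Icc t 1) : staircase β t z u ∈ Icc (0 : ℝ) 1 :=
    ⟨htail.nonneg hu, hself ▸ htail.le hu⟩
  obtain ⟨C, r, hr, hH⟩ := exists_holderOnWith_of_geometric ht.1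
    ⟨by positivity, one_div_lt_one_of_one_lt hβ.1⟩ hz
    (fun u hu v hv => by simpa using Real.dist_le_of_mem_Icc (hmem u hu) (hmem v hv))
    (fun n u hu v hv => dist_staircase_le hβ ht' hz.1.le h n hu hv)
  refine dimH_pos_of_holderOnWith ht.2.le hr hH ?_ fun u hu huK => ?_
  · rw [hself, htail.one]
    exact one_ne_zero
  · obtain ⟨n, hn⟩ : ∃ n, (betaMap β)^[n] u ∈ Ioo 0 t := by
      by_contra hcon
      exact huK ⟨⟨ht.1.le.trans hu.1, hu.2⟩, not_exists.1 hcon⟩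
    exact eventually_staircase_eq hβ ht' hz.1.le h hu hn.2

end

section

variable {a β t u z σ τ : ℝ} {f : ℝ → ℝ}

/-! ### The kneading function -/

/-- The power series that marks the visits to `[0, 1/β)` of the orbit of `u` under `clampMap`. -/
noncomputable def visitSeries (β t u z : ℝ) : ℝ :=
  ∑' i : ℕ, (if (clampMap β t)^[i] u < 1 / β then 1 else 0) * z ^ i

/-- The kneading function of the map with the hole `(0, t)`, the reciprocal of the generating
function of the counts. -/
noncomputable def kneading (β t z : ℝ) : ℝ :=
  1 - z * visitSeries β t t z + z ^ 2 * visitSeries β t (clampMap β t 1) z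

/-- The generating function of the counts. -/
noncomputable def tailSeries (β t z u : ℝ) : ℝ := ∑' n, z ^ n * tailCount β t n u

theorem summable_indicator_mul_pow (p : ℕ → Prop) [DecidablePred p] (hz : z ∈ Ico (0 : ℝ) 1) :
    Summable fun i : ℕ => (if p i then 1 else 0) * z ^ i := by
  have hpow (i : ℕ) : 0 ≤ z ^ i := pow_nonneg hz.1 i
  refine (summable_geometric_of_lt_one hz.1 hz.2).of_nonneg_of_le (fun i => ?_) fun i => ?_
  · exact mul_nonneg (by split_ifs <;> norm_num) (hpow i)
  · exact mul_le_of_le_one_left (hpow i) (by split_ifs <;> norm_num)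

theorem visitSeries_eq (hz : z ∈ Ico (0 : ℝ) 1) :
    visitSeries β t u z =
      (if u < 1 / β then 1 else 0) + z * visitSeries β t (clampMap β t u) z := by
  rw [visitSeries, (summable_indicator_mul_pow _ hz).tsum_eq_zero_add, visitSeries, ← tsum_mul_left,
    Function.iterate_zero_apply, pow_zero, mul_one]
  simp only [Function.iterate_succ_apply, pow_succ', mul_left_comm]
  congr

theorem visitSeries_mem_Icc (hz : z ∈ Ico (0 : ℝ) 1) : visitSeries β t u z ∈ Icc 0 (1 - z)⁻¹ := by
  have hpow (i : ℕ) : 0 ≤ z ^ i := pow_nonneg hz.1 i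
  constructor
  · exact tsum_nonneg fun i => mul_nonneg (by split_ifs <;> norm_num) (hpow i)
  · rw [← tsum_geometric_of_lt_one hz.1 hz.2]
    refine (summable_indicator_mul_pow _ hz).tsum_le_tsum (fun i => ?_)
      (summable_geometric_of_lt_one hz.1 hz.2)
    exact mul_le_of_le_one_left (hpow i) (by split_ifs <;> norm_num)

theorem summable_tailCount_of_mem (hβ : β ∈ Ioo (1 : ℝ) 2) (ht : t ∈ Ico (0 : ℝ) 1) (hz : 0 ≤ z)
    (h : Summable fun n => z ^ n * tailCount β t n t) (hu : u ∈ Icc t 1) :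
    Summable fun n => z ^ n * tailCount β t n u :=
  h.of_nonneg_of_le (fun n => mul_nonneg (pow_nonneg hz n) ((isTail_tailCount hβ ht n).nonneg hu))
    fun n => mul_le_mul_of_nonneg_left ((isTail_tailCount hβ ht n).le hu) (pow_nonneg hz n)

theorem isTail_tailSeries (hβ : β ∈ Ioo (1 : ℝ) 2) (ht : t ∈ Ico (0 : ℝ) 1) (hz : 0 ≤ z)
    (h : Summable fun n => z ^ n * tailCount β t n t) : IsTail t (tailSeries β t z) where
  anti _ hu _ hv huv := (summable_tailCount_of_mem hβ ht hz h hv).tsum_le_tsum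
    (fun n => mul_le_mul_of_nonneg_left ((isTail_tailCount hβ ht n).anti hu hv huv)
      (pow_nonneg hz n)) (summable_tailCount_of_mem hβ ht hz h hu)
  one := by simp only [tailSeries, (isTail_tailCount hβ ht _).one, mul_zero, tsum_zero]

theorem tailSeries_eq (hβ : β ∈ Ioo (1 : ℝ) 2) (ht : t ∈ Ico (0 : ℝ) 1) (hz : 0 ≤ z)
    (h : Summable fun n => z ^ n * tailCount β t n t) (hu : u ∈ Ico t 1) :
    tailSeries β t z u = 1 + z * tailOp β t (tailSeries β t z) u := by
  have hsum {v : ℝ} (hv : v ∈ Icc t 1) := summable_tailCount_of_mem hβ ht hz h hv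
  have hclamp (v : ℝ) := clampMap_mem_Icc (β := β) ht.2 v
  have hterm (n : ℕ) : z ^ (n + 1) * tailCount β t (n + 1) u =
      z * (z ^ n * tailCount β t n (clampMap β t u) +
        (if u < 1 / β then 1 else 0) * (z ^ n * tailCount β t n t) -
        z ^ n * tailCount β t n (clampMap β t 1)) := by
    rw [tailCount_succ, tailOp, pow_succ]
    split_ifs <;> ring
  rw [tailSeries, (hsum ⟨hu.1, hu.2.le⟩).tsum_eq_zero_add, tsum_congr hterm, tsum_mul_left,
    ((hsum (hclamp u)).add (h.mul_left _)).tsum_sub (hsum (hclamp 1)),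
    (hsum (hclamp u)).tsum_add (h.mul_left _), tsum_mul_left]
  simp [tailCount_zero, hu.2, tailOp, tailSeries]

theorem eq_zero_of_eq_mul_comp {α : Type*} {A : Set α} {g : α → α} (hg : MapsTo g A A)
    {f : α → ℝ} {B : ℝ} (hB : ∀ a ∈ A, |f a| ≤ B) (hz : z ∈ Ico (0 : ℝ) 1)
    (h : ∀ a ∈ A, f a = z * f (g a)) {a : α} (ha : a ∈ A) : f a = 0 := by
  have hiter (n : ℕ) : f a = z ^ n * f (g^[n] a) := by
    induction n with
    | zero => simp
    | succ n ih =>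
      rw [ih, h _ (hg.iterate n ha), Function.iterate_succ_apply', pow_succ, mul_assoc]
  have hlim : Tendsto (fun n : ℕ => z ^ n * B) atTop (𝓝 0) := by
    simpa using (tendsto_pow_atTop_nhds_zero_of_lt_one hz.1 hz.2).mul_const B
  refine abs_nonpos_iff.1 (ge_of_tendsto' hlim fun n => ?_)
  rw [hiter n, abs_mul, abs_of_nonneg (pow_nonneg hz.1 n)]
  exact mul_le_mul_of_nonneg_left (hB _ (hg.iterate n ha)) (pow_nonneg hz.1 n)

/-- Both sides solve `f u = 1 - z R + z (f (clampMap u) + 1_{u < 1/β} Q)`, which has only one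
bounded solution. -/
theorem tailSeries_eq_visitSeries (hβ : β ∈ Ioo (1 : ℝ) 2) (ht : t ∈ Ico (0 : ℝ) 1)
    (hz : z ∈ Ico (0 : ℝ) 1) (h : Summable fun n => z ^ n * tailCount β t n t)
    (hu : u ∈ Ico t 1) :
    tailSeries β t z u = z * tailSeries β t z t * visitSeries β t u z +
      (1 - z * tailSeries β t z (clampMap β t 1)) / (1 - z) := by
  have htail := isTail_tailSeries hβ ht hz.1 h
  set Q := tailSeries β t z t
  set R := tailSeries β t z (clampMap β t 1)
  set K := (1 - z * R) / (1 - z)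
  have hK : K = 1 - z * R + z * K := by
    have : 1 - z ≠ 0 := by linarith [hz.2]
    simp only [K]
    field_simp
    ring
  have hQ : 0 ≤ z * Q := mul_nonneg hz.1 (htail.nonneg ⟨le_rfl, ht.2.le⟩)
  have hzero := eq_zero_of_eq_mul_comp (A := Ico t 1) (g := clampMap β t)
    (f := fun v => tailSeries β t z v - z * Q * visitSeries β t v z - K)
    (B := Q + z * Q * (1 - z)⁻¹ + |K|) (fun v _ => clampMap_mem_Ico ht.2 v) (fun v hv => ?_) hz
    (fun v hv => ?_) hu
  · linarith
  · have hvisit := visitSeries_mem_Icc (β := β) (t := t) (u := v) hz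
    have hlow := mul_nonneg hQ hvisit.1
    have hhigh := mul_le_mul_of_nonneg_left hvisit.2 hQ
    have hv' := Ico_subset_Icc_self hv
    rw [abs_le]
    constructor <;> linarith [neg_abs_le K, le_abs_self K, htail.nonneg hv', htail.le hv']
  · have hser : tailSeries β t z v = 1 + z * (tailSeries β t z (clampMap β t v) +
        (if v < 1 / β then 1 else 0) * Q - R) := by
      rw [tailSeries_eq hβ ht hz.1 h hv, tailOp, ite_mul, one_mul, zero_mul]
    rw [hser, visitSeries_eq hz]
    linear_combination -hK

theorem tailSeries_mul_kneading (hβ : β ∈ Ioo (1 : ℝ) 2) (ht : t ∈ Ico (0 : ℝ) 1)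
    (hz : z ∈ Ico (0 : ℝ) 1) (h : Summable fun n => z ^ n * tailCount β t n t) :
    tailSeries β t z t * kneading β t z = 1 := by
  have htop := tailSeries_eq_visitSeries hβ ht hz h ⟨le_rfl, ht.2⟩
  have hone := tailSeries_eq_visitSeries
    hβ ht hz h (clampMap_mem_Ico (β := β) ht.2 1)
  have : 1 - z ≠ 0 := by linarith [hz.2]
  rw [kneading]
  field_simp at htop hone
  refine mul_left_cancel₀ this ?_
  linear_combination htop - z * hone

theorem tendsto_clampMap (hβ : 0 ≤ β) (hf : Tendsto f (𝓝[≥] t) (𝓝[≥] a)) :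
    Tendsto (fun s => clampMap β s (f s)) (𝓝[≥] t) (𝓝[≥] (clampMap β t a)) := by
  have hT := (tendsto_betaMap hβ a).comp hf
  refine tendsto_nhdsWithin_iff.2 ⟨?_, ?_⟩
  · exact (hT.mono_right nhdsWithin_le_nhds).max (tendsto_id.mono_left nhdsWithin_le_nhds)
  · filter_upwards [hT.eventually self_mem_nhdsWithin, self_mem_nhdsWithin] with s h1 h2
    exact max_le_max h1 h2

theorem tendsto_iterate_clampMap (hβ : 0 ≤ β) (hf : Tendsto f (𝓝[≥] t) (𝓝[≥] a)) (n : ℕ) :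
    Tendsto (fun s => (clampMap β s)^[n] (f s)) (𝓝[≥] t) (𝓝[≥] ((clampMap β t)^[n] a)) := by
  induction n with
  | zero => exact hf
  | succ n ih => simp only [Function.iterate_succ_apply']; exact tendsto_clampMap hβ ih

theorem tendsto_clampMap_one (hβ : 0 ≤ β) :
    Tendsto (fun s => clampMap β s 1) (𝓝[≥] t) (𝓝[≥] (clampMap β t 1)) :=
  tendsto_clampMap hβ (tendsto_nhdsWithin_iff.2 ⟨tendsto_const_nhds, by simp⟩)

theorem eventually_tailCount_eq_of_tendsto (hβ : 0 ≤ β) (n : ℕ)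
    (hf : Tendsto f (𝓝[≥] t) (𝓝[≥] a)) :
    ∀ᶠ s in 𝓝[≥] t, tailCount β s n (f s) = tailCount β t n a := by
  induction n generalizing a f with
  | zero =>
    filter_upwards [hf.eventually (eventually_nhdsGE_lt_iff 1 a)] with s hs
    simp only [tailCount_zero, hs]
  | succ n ih =>
    filter_upwards [hf.eventually (eventually_nhdsGE_lt_iff (1 / β) a),
      ih (tendsto_clampMap hβ hf), ih tendsto_id, ih (tendsto_clampMap_one hβ)] with s h1 h2 h3 h4
    rw [id] at h3
    simp only [tailCount_succ, tailOp, h1, h2, h3, h4]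

theorem tendsto_visitSeries (hβ : 0 ≤ β) (hz : z ∈ Ico (0 : ℝ) 1)
    (hf : Tendsto f (𝓝[≥] t) (𝓝[≥] a)) :
    Tendsto (fun s => visitSeries β s (f s) z) (𝓝[≥] t) (𝓝 (visitSeries β t a z)) := by
  refine tendsto_tsum_of_dominated_convergence (summable_geometric_of_lt_one hz.1 hz.2)
    (fun i => ?_) (Eventually.of_forall fun s i => ?_)
  · refine tendsto_const_nhds.congr' ?_
    filter_upwards [(tendsto_iterate_clampMap hβ hf i).eventually
      (eventually_nhdsGE_lt_iff (1 / β) _)] with s hs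
    simp only [hs]
  · have := pow_nonneg hz.1 i
    split_ifs <;> simp [abs_of_nonneg, this, hz.1]

theorem tendsto_kneading (hβ : 0 ≤ β) (hz : z ∈ Ico (0 : ℝ) 1) :
    Tendsto (fun s => kneading β s z) (𝓝[>] t) (𝓝 (kneading β t z)) :=
  ((tendsto_const_nhds.sub ((tendsto_visitSeries hβ hz tendsto_id).const_mul z)).add
    ((tendsto_visitSeries hβ hz (tendsto_clampMap_one hβ)).const_mul (z ^ 2))).mono_left
      (nhdsWithin_mono _ Ioi_subset_Ici_self)

theorem analyticOnNhd_tsum_mul_pow {c : ℕ → ℝ} (hc : ∀ n, |c n| ≤ 1) :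
    AnalyticOnNhd ℝ (fun z => ∑' n, c n * z ^ n) (Metric.ball 0 1) := by
  set p := FormalMultilinearSeries.ofScalars ℝ c
  have hr : 1 ≤ p.radius := by
    refine p.le_radius_of_bound (r := 1) 1 fun n => ?_
    simpa [p, FormalMultilinearSeries.ofScalars_norm] using hc n
  have hsum : AnalyticOnNhd ℝ p.sum (Metric.ball 0 1) :=
    (p.hasFPowerSeriesOnBall (zero_lt_one.trans_le hr)).analyticOnNhd.mono fun z hz => by
      rw [← Metric.eball_ofReal, ENNReal.ofReal_one] at hz
      exact Metric.eball_subset_eball hr hz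
  refine hsum.congr Metric.isOpen_ball fun z _ => ?_
  simp [p, FormalMultilinearSeries.sum, mul_comm]

theorem exists_kneading_ne_zero (hz : z ∈ Ico (0 : ℝ) 1) : ∃ y ∈ Ioo z 1, kneading β t y ≠ 0 := by
  by_contra! hcon
  have hvisit (u : ℝ) : AnalyticOnNhd ℝ (visitSeries β t u) (Metric.ball 0 1) :=
    analyticOnNhd_tsum_mul_pow fun n => by split_ifs <;> simp
  have hkneading : AnalyticOnNhd ℝ (kneading β t) (Metric.ball 0 1) :=
    (analyticOnNhd_const.sub (analyticOnNhd_id.mul (hvisit _))).add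
      ((analyticOnNhd_id.pow 2).mul (hvisit _))
  obtain ⟨m, hm⟩ := exists_between hz.2
  have hm' : m ∈ Metric.ball (0 : ℝ) 1 := by
    rw [mem_ball_zero_iff, Real.norm_eq_abs, abs_lt]
    exact ⟨by linarith [hz.1, hm.1], hm.2⟩
  have hzero := hkneading.eqOn_zero_of_preconnected_of_eventuallyEq_zero
    (convex_ball (0 : ℝ) 1).isPreconnected hm'
    (by filter_upwards [Ioo_mem_nhds hm.1 hm.2] with y hy using hcon y hy)
  simpa [kneading] using hzero (Metric.mem_ball_self zero_lt_one)

theorem kneading_pos (hβ : β ∈ Ioo (1 : ℝ) 2) (ht : t ∈ Ico (0 : ℝ) 1) (hz : z ∈ Ico (0 : ℝ) 1)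
    (h : Summable fun n => z ^ n * tailCount β t n t) : 0 < kneading β t z :=
  pos_of_mul_pos_right (by rw [tailSeries_mul_kneading hβ ht hz h]; exact zero_lt_one)
    ((isTail_tailSeries hβ ht hz.1 h).nonneg ⟨le_rfl, ht.2.le⟩)

theorem antitoneOn_kneading (hβ : β ∈ Ioo (1 : ℝ) 2) (ht : t ∈ Ico (0 : ℝ) 1)
    (h : HasSubexponentialCounts β t) : AntitoneOn (kneading β t) (Ioo 0 1) := by
  intro z hz w hw hzw
  have hseries : tailSeries β t z t ≤ tailSeries β t w t :=
    (h z hz).tsum_le_tsum (fun n => mul_le_mul_of_nonneg_right (pow_le_pow_left₀ hz.1.le hzw n)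
      ((isTail_tailCount hβ ht n).nonneg ⟨le_rfl, ht.2.le⟩)) (h w hw)
  rw [eq_inv_of_mul_eq_one_left (tailSeries_mul_kneading hβ ht (Ioo_subset_Ico_self hz) (h z hz)),
    eq_inv_of_mul_eq_one_left (tailSeries_mul_kneading hβ ht (Ioo_subset_Ico_self hw) (h w hw))]
    at hseries
  exact (inv_le_inv₀ (kneading_pos hβ ht (Ioo_subset_Ico_self hz) (h z hz))
    (kneading_pos hβ ht (Ioo_subset_Ico_self hw) (h w hw))).1 hseries

/-- The limit `kneading β t` is nonnegative and antitone, and being analytic it does not vanish on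
an interval. -/
theorem kneading_pos_of_eventually (hβ : β ∈ Ioo (1 : ℝ) 2) (ht : t ∈ Ico (0 : ℝ) 1)
    (h : ∀ᶠ s in 𝓝[>] t, HasSubexponentialCounts β s) (hz : z ∈ Ioo (0 : ℝ) 1) :
    0 < kneading β t z := by
  have hβ0 : 0 ≤ β := zero_le_one.trans hβ.1.le
  have hgood : ∀ᶠ s in 𝓝[>] t, s ∈ Ico (0 : ℝ) 1 ∧ HasSubexponentialCounts β s := by
    filter_upwards [h, Ioo_mem_nhdsGT ht.2] with s hs hs'
    exact ⟨⟨ht.1.trans hs'.1.le, hs'.2⟩, hs⟩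
  obtain ⟨y, hy, hne⟩ := exists_kneading_ne_zero (β := β) (t := t) (Ioo_subset_Ico_self hz)
  have hy01 : y ∈ Ioo (0 : ℝ) 1 := ⟨hz.1.trans hy.1, hy.2⟩
  have hlimy := tendsto_kneading (t := t) hβ0 (Ioo_subset_Ico_self hy01)
  have hnonneg : 0 ≤ kneading β t y := ge_of_tendsto hlimy <| hgood.mono fun s hs =>
    (kneading_pos hβ hs.1 (Ioo_subset_Ico_self hy01) (hs.2 y hy01)).le
  refine (hnonneg.lt_of_ne' hne).trans_le ?_
  exact le_of_tendsto_of_tendsto hlimy (tendsto_kneading hβ0 (Ioo_subset_Ico_self hz)) <|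
    hgood.mono fun s hs => antitoneOn_kneading hβ hs.1 hs.2 hz hy01 hy.1.le

theorem hasSubexponentialCounts_of_eventually (hβ : β ∈ Ioo (1 : ℝ) 2) (ht : t ∈ Ico (0 : ℝ) 1)
    (h : ∀ᶠ s in 𝓝[>] t, HasSubexponentialCounts β s) : HasSubexponentialCounts β t := by
  have hβ0 : 0 ≤ β := zero_le_one.trans hβ.1.le
  have hnonneg {s : ℝ} (hs : s ∈ Ico (0 : ℝ) 1) {z : ℝ} (hz : z ∈ Ioo (0 : ℝ) 1) (n : ℕ) :
      0 ≤ z ^ n * tailCount β s n s :=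
    mul_nonneg (pow_nonneg hz.1.le n) ((isTail_tailCount hβ hs n).nonneg ⟨le_rfl, hs.2.le⟩)
  intro z hz
  refine summable_of_sum_range_le (c := (kneading β t z)⁻¹) (hnonneg ht hz) fun N => ?_
  have hcounts : ∀ᶠ s in 𝓝[>] t, ∀ n ∈ Finset.range N, tailCount β s n s = tailCount β t n t := by
    rw [Finset.eventually_all]
    exact fun n _ => (eventually_tailCount_eq_of_tendsto hβ0 n tendsto_id).filter_mono
      (nhdsWithin_mono _ Ioi_subset_Ici_self)
  refine ge_of_tendsto ((tendsto_kneading hβ0 (Ioo_subset_Ico_self hz)).inv₀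
    (kneading_pos_of_eventually hβ ht h hz).ne') ?_
  filter_upwards [h, hcounts, Ioo_mem_nhdsGT ht.2] with s hs heq hst
  have hs01 : s ∈ Ico (0 : ℝ) 1 := ⟨ht.1.trans hst.1.le, hst.2⟩
  calc ∑ n ∈ Finset.range N, z ^ n * tailCount β t n t
      = ∑ n ∈ Finset.range N, z ^ n * tailCount β s n s :=
        Finset.sum_congr rfl fun n hn => by rw [heq n hn]
    _ ≤ tailSeries β s z s := (hs z hz).sum_le_tsum _ fun n _ => hnonneg hs01 hz n
    _ = (kneading β s z)⁻¹ :=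
        eq_inv_of_mul_eq_one_left
          (tailSeries_mul_kneading hβ hs01 (Ioo_subset_Ico_self hz) (hs z hz))

/-! ### The critical value -/

theorem exists_dimH_pos_right (hβ : β ∈ Ioo (1 : ℝ) 2) (ht : t ∈ Ico (0 : ℝ) 1)
    (h : 0 < dimH (survivorSet β t)) : ∃ s ∈ Ioo t 1, 0 < dimH (survivorSet β s) := by
  by_contra! hcon
  have hsub : HasSubexponentialCounts β t := hasSubexponentialCounts_of_eventually hβ ht <| by
    filter_upwards [Ioo_mem_nhdsGT ht.2] with s hs z hz
    by_contra hsum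
    exact (dimH_survivorSet_pos hβ ⟨ht.1.trans_lt hs.1, hs.2⟩ hz hsum).not_ge (hcon s hs)
  rw [dimH_survivorSet (zero_lt_one.trans hβ.1).ne' ht.1, dimH_forwardSet_eq_zero hβ ht hsub] at h
  exact lt_irrefl _ h

theorem clampMap_one_sub_one_div (hβ : β ∈ Ioo (1 : ℝ) 2) :
    clampMap β t (1 - 1 / β) = clampMap β t 1 := by
  have hβ0 : 0 < β := zero_lt_one.trans hβ.1
  rw [clampMap, clampMap, betaMap_of_lt hβ0 (one_sub_one_div_pos hβ.1).le
    (one_sub_one_div_lt_one_div hβ), mul_one_sub_one_div hβ0.ne',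
    betaMap_one (Ioo_subset_Ico_self hβ)]

theorem one_sub_one_div_lt_one (hβ : 0 < β) : 1 - 1 / β < 1 := sub_lt_self 1 (one_div_pos.2 hβ)

theorem tailCount_one_sub_one_div (hβ : β ∈ Ioo (1 : ℝ) 2) (n : ℕ) :
    tailCount β (1 - 1 / β) n (1 - 1 / β) = 1 := by
  induction n with
  | zero => exact if_pos (one_sub_one_div_lt_one (zero_lt_one.trans hβ.1))
  | succ n ih =>
    rw [tailCount_succ, tailOp_of_lt _ (one_sub_one_div_lt_one_div hβ),
      clampMap_one_sub_one_div hβ, ih]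
    ring

theorem dimH_survivorSet_one_sub_one_div (hβ : β ∈ Ioo (1 : ℝ) 2) :
    dimH (survivorSet β (1 - 1 / β)) = 0 := by
  have hβ0 : 0 < β := zero_lt_one.trans hβ.1
  have hmem : 1 - 1 / β ∈ Ico (0 : ℝ) 1 :=
    ⟨(one_sub_one_div_pos hβ.1).le, one_sub_one_div_lt_one hβ0⟩
  rw [dimH_survivorSet hβ0.ne' hmem.1]
  refine dimH_forwardSet_eq_zero hβ hmem fun z hz => ?_
  simp only [tailCount_one_sub_one_div hβ, mul_one]
  exact summable_geometric_of_lt_one hz.1.le hz.2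

theorem dimH_survivorSet_zero (β : ℝ) : dimH (survivorSet β 0) = 1 := by
  have hset : survivorSet β 0 = Ico 0 1 := by ext; simp [survivorSet]
  rw [hset, Real.dimH_of_nonempty_interior]
  · simp
  · simp

theorem exists_isCriticalValue (hβ : β ∈ Ioo (1 : ℝ) 2) :
    ∃ τ, τ ≤ 1 - 1 / β ∧ IsCriticalValue β τ := by
  set S := {t | t ∈ Ico (0 : ℝ) 1 ∧ 0 < dimH (survivorSet β t)}
  have hS : (0 : ℝ) ∈ S :=
    ⟨⟨le_rfl, zero_lt_one⟩, by rw [dimH_survivorSet_zero]; exact zero_lt_one⟩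
  have hub : ∀ t ∈ S, t ≤ 1 - 1 / β := by
    intro t ht
    by_contra! hlt
    have hdim := dimH_mono (survivorSet_anti (β := β) hlt.le)
    rw [dimH_survivorSet_one_sub_one_div hβ] at hdim
    exact ht.2.not_ge hdim
  refine ⟨sSup S, csSup_le ⟨0, hS⟩ hub, fun t ht => ⟨fun h => ?_, fun h => ?_⟩⟩
  · obtain ⟨s, hs, hpos⟩ := exists_dimH_pos_right hβ ht h
    exact hs.1.trans_le (le_csSup ⟨_, hub⟩ ⟨⟨ht.1.trans hs.1.le, hs.2⟩, hpos⟩)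
  · obtain ⟨s, hs, hts⟩ := exists_lt_of_lt_csSup ⟨0, hS⟩ h
    exact hs.2.trans_le (dimH_mono (survivorSet_anti hts.le))

theorem IsCriticalValue.pos (h : IsCriticalValue β τ) : 0 < τ :=
  (h 0 ⟨le_rfl, zero_lt_one⟩).1 (by rw [dimH_survivorSet_zero]; exact zero_lt_one)

theorem IsCriticalValue.le_of_lt_one (hτ : IsCriticalValue β τ) (hσ : IsCriticalValue β σ)
    (hσ1 : σ < 1) : τ ≤ σ := by
  by_contra! h
  have hmem : σ ∈ Ico (0 : ℝ) 1 := ⟨hσ.pos.le, hσ1⟩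
  exact lt_irrefl σ ((hσ σ hmem).1 ((hτ σ hmem).2 h))

theorem IsCriticalValue.unique (hτ1 : τ < 1) (hτ : IsCriticalValue β τ)
    (hσ : IsCriticalValue β σ) : σ = τ :=
  have hle : σ ≤ τ := hσ.le_of_lt_one hτ hτ1
  hle.antisymm (hτ.le_of_lt_one hσ (hle.trans_lt hτ1))

end

section

variable {β ε t x y z δ a b : ℝ} {f : ℝ → ℝ} {u w : ℕ → ℝ} {m : ℕ}

/-! ### Finding periodic orbits -/

theorem exists_lt_dist_lt (hδ : 0 < δ) (hu : ∀ n, u n ∈ Icc a b) :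
    ∃ i j, i < j ∧ dist (u i) (u j) < δ := by
  obtain ⟨q, -, ψ, hψ, hlim⟩ := isCompact_Icc.tendsto_subseq hu
  obtain ⟨K, hK⟩ := Metric.cauchySeq_iff.1 hlim.cauchySeq δ hδ
  exact ⟨ψ K, ψ (K + 1), hψ K.lt_succ_self, hK K le_rfl (K + 1) K.le_succ⟩

theorem exists_tendsto_nhdsGE_subseq (hδ : 0 < δ) (hu : ∀ n, u n ∈ Icc a b)
    (hdec : ∀ i j, i < j → dist (u i) (u j) < δ → u j < u i) :
    ∃ p, ∃ φ : ℕ → ℕ, StrictMono φ ∧ Tendsto (u ∘ φ) atTop (𝓝[≥] p) := by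
  obtain ⟨p, -, φ, hφ, hlim⟩ := isCompact_Icc.tendsto_subseq hu
  obtain ⟨N, hN⟩ := Metric.cauchySeq_iff.1 hlim.cauchySeq δ hδ
  have hanti {k l : ℕ} (hk : N ≤ k) (hkl : k < l) : u (φ l) < u (φ k) :=
    hdec _ _ (hφ hkl) (hN k hk l (hk.trans hkl.le))
  have hge {k : ℕ} (hk : N ≤ k) : p ≤ u (φ k) :=
    le_of_tendsto hlim ((eventually_gt_atTop k).mono fun _ hl => (hanti hk hl).le)
  exact ⟨p, φ, hφ, tendsto_nhdsWithin_of_tendsto_nhds_of_eventually_within _ hlim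
    ((eventually_ge_atTop N).mono fun _ hk => hge hk)⟩

/-- The orbit of a limit point inherits the hypothesis in the weak form `≤` without any order
restriction on the times, so that two of its points that are close have to coincide. -/
theorem exists_mem_periodicPts_of_decreasing (hf : ∀ x, Tendsto f (𝓝[≥] x) (𝓝[≥] (f x)))
    (hδ : 0 < δ) (hz : ∀ n, f^[n] z ∈ Icc a b)
    (hdec : ∀ i j, i < j → dist (f^[i] z) (f^[j] z) < δ → f^[j] z < f^[i] z) :
    ∃ p ∈ Function.periodicPts f, ∀ n, f^[n] p ∈ Icc a b := by
  obtain ⟨p, φ, hφ, hlim⟩ := exists_tendsto_nhdsGE_subseq hδ hz hdec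
  have hshift (l : ℕ) : Tendsto (fun k => f^[l + φ k] z) atTop (𝓝 (f^[l] p)) := by
    simp only [Function.iterate_add_apply]
    exact ((tendsto_iterate_nhdsGE hf l p).comp hlim).mono_right nhdsWithin_le_nhds
  have hp (l : ℕ) : f^[l] p ∈ Icc a b :=
    isClosed_Icc.mem_of_tendsto (hshift l) (Eventually.of_forall fun _ => hz _)
  have hle {l l' : ℕ} (hd : dist (f^[l] p) (f^[l'] p) < δ) : f^[l'] p ≤ f^[l] p := by
    by_contra! hlt
    have hlate : Tendsto (fun k => f^[l' + φ (k + (l + 1))] z) atTop (𝓝 (f^[l'] p)) :=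
      (hshift l').comp (tendsto_add_atTop_nat (l + 1))
    obtain ⟨k, hkd, hklt⟩ := ((((hshift l).dist hlate).eventually_lt_const hd).and
      ((hshift l).eventually_lt hlate hlt)).exists
    have : k + (l + 1) ≤ φ (k + (l + 1)) := hφ.le_apply
    have htime : l + 1 + φ k ≤ φ (k + (l + 1)) := by
      have := hφ.add_le_nat (l + 1) k
      rwa [add_comm k]
    exact (hdec _ _ (by omega) hkd).not_gt hklt
  obtain ⟨i, j, hij, hd⟩ := exists_lt_dist_lt hδ hp
  have heq : f^[i] p = f^[j] p := le_antisymm (hle (by rwa [dist_comm])) (hle hd)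
  refine ⟨f^[i] p, ⟨j - i, Nat.sub_pos_of_lt hij, ?_⟩, fun n => ?_⟩
  · rw [Function.IsPeriodicPt, Function.IsFixedPt, ← Function.iterate_add_apply,
      Nat.sub_add_cancel hij.le, heq]
  · rw [← Function.iterate_add_apply]
    exact hp _

theorem hasPeriodicAbove_of_backward (hm : 0 < m) (hstep : ∀ l < m, betaMap β (w (l + 1)) = w l)
    (hmem : ∀ l ≤ m, w l ∈ Ico (1 - 1 / β) 1) (hw : w m = w 0) : HasPeriodicAbove β := by
  have hit {n : ℕ} (hn : n ≤ m) : (betaMap β)^[n] (w m) = w (m - n) := by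
    induction n with
    | zero => rfl
    | succ n ih =>
      rw [Function.iterate_succ_apply', ih (by omega), show m - n = m - (n + 1) + 1 by omega,
        hstep _ (by omega)]
  have hper : Function.IsPeriodicPt (betaMap β) m (w m) := by
    rw [Function.IsPeriodicPt, Function.IsFixedPt, hit le_rfl, Nat.sub_self, hw]
  refine ⟨w m, fun n => ?_, m, hm, hper⟩
  rw [← hper.iterate_mod_apply, hit (Nat.mod_lt _ hm).le]
  exact hmem _ (Nat.sub_le m _)

/-- Adding `η * (1 / β) ^ l` to the `l`-th point of a backward orbit gives again a backward orbit,
and `η` can be chosen such that it closes up. -/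
theorem hasPeriodicAbove_of_close_return (hβ : β ∈ Ioo (1 : ℝ) 2) (hm : 0 < m)
    (hstep : ∀ l < m, ∃ d : ℤ, β * w (l + 1) = d + w l)
    (hw : ∀ l ≤ m, w l ∈ Ico (1 - 1 / β) 1) (hwε : ∀ l ≤ m, w l + ε ∈ Ico (1 - 1 / β) 1)
    (hreturn : w m - w 0 ∈ uIcc 0 (ε * (1 - 1 / β))) : HasPeriodicAbove β := by
  have hβ0 : 0 < β := zero_lt_one.trans hβ.1
  have hcut := one_sub_one_div_pos hβ.1
  have hpow_nonneg (l : ℕ) : 0 ≤ (1 / β) ^ l := by positivity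
  have hpow_le (l : ℕ) : (1 / β) ^ l ≤ 1 := pow_le_one₀ (by positivity) (by linarith)
  have hden : 1 - 1 / β ≤ 1 - (1 / β) ^ m :=
    sub_le_sub_left (pow_le_of_le_one (by positivity) (by linarith) hm.ne') 1
  have hden0 : 0 < 1 - (1 / β) ^ m := hcut.trans_le hden
  set η := (w m - w 0) / (1 - (1 / β) ^ m)
  have hη : η * (1 - (1 / β) ^ m) = w m - w 0 := div_mul_cancel₀ _ hden0.ne'
  have hshift (l : ℕ) : η * (1 / β) ^ l ∈ uIcc 0 ε := by
    rw [← hη, mem_uIcc] at hreturn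
    rw [mem_uIcc]
    rcases hreturn with ⟨h0, hle⟩ | ⟨hle, h0⟩
    · have hη0 : 0 ≤ η := nonneg_of_mul_nonneg_left h0 hden0
      have hηε : η ≤ ε := by nlinarith
      exact .inl ⟨mul_nonneg hη0 (hpow_nonneg l),
        (mul_le_of_le_one_right hη0 (hpow_le l)).trans hηε⟩
    · have hη0 : η ≤ 0 := nonpos_of_mul_nonpos_left h0 hden0
      have hηε : ε ≤ η := by nlinarith
      exact .inr ⟨hηε.trans (le_mul_of_le_one_right hη0 (hpow_le l)),
        mul_nonpos_of_nonpos_of_nonneg hη0 (hpow_nonneg l)⟩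
  have hmem {l : ℕ} (hl : l ≤ m) : w l + η * (1 / β) ^ l ∈ Ico (1 - 1 / β) 1 := by
    have hsub := ordConnected_Ico.uIcc_subset (hw l hl) (hwε l hl)
    refine hsub ?_
    have := hshift l
    rw [mem_uIcc] at this ⊢
    simpa using this
  refine hasPeriodicAbove_of_backward (w := fun l => w l + η * (1 / β) ^ l) hm (fun l hl => ?_)
    (fun l hl => hmem hl) (by linear_combination -hη)
  obtain ⟨d, hd⟩ := hstep l hl
  refine betaMap_eq_of_eq_add d ⟨hcut.le.trans (hmem hl.le).1, (hmem hl.le).2⟩ ?_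
  have hscale : β * (1 / β) ^ (l + 1) = (1 / β) ^ l := by
    rw [pow_succ']
    field_simp
  linear_combination hd + η * hscale

/-- The inverse of `betaMap` with values in `[1 - 1/β, 1)`. -/
noncomputable def backMap (β y : ℝ) : ℝ := if y < β - 1 then (y + 1) / β else y / β

theorem mul_backMap (hβ : β ≠ 0) (y : ℝ) :
    β * backMap β y = (if y < β - 1 then 1 else 0 : ℤ) + y := by
  rw [backMap]
  split_ifs
  · rw [mul_div_cancel₀ _ hβ, Int.cast_one, add_comm]
  · rw [mul_div_cancel₀ _ hβ, Int.cast_zero, zero_add]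

theorem betaMap_backMap (hβ : β ≠ 0) (hy : y ∈ Ico (0 : ℝ) 1) : betaMap β (backMap β y) = y :=
  betaMap_eq_of_eq_add _ hy (mul_backMap hβ y)

theorem backMap_mem_Ico (hβ : β ∈ Ioo (1 : ℝ) 2) (hy : y ∈ Ico (0 : ℝ) 1) :
    backMap β y ∈ Ico (1 - 1 / β) 1 := by
  have hβ0 : 0 < β := zero_lt_one.trans hβ.1
  rw [backMap]
  split_ifs with h
  · refine ⟨(one_sub_one_div_lt_one_div hβ).le.trans ?_, by rw [div_lt_one hβ0]; linarith⟩
    gcongr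
    linarith [hy.1]
  · refine ⟨?_, (div_lt_one hβ0).2 (hy.2.trans hβ.1)⟩
    rw [le_div_iff₀' hβ0, mul_one_sub_one_div hβ0.ne']
    exact not_lt.1 h

theorem tendsto_backMap (hβ : 0 < β) (x : ℝ) :
    Tendsto (backMap β) (𝓝[≥] x) (𝓝[≥] (backMap β x)) := by
  have heq (y : ℝ) : backMap β y = (y + if y < β - 1 then 1 else 0) / β := by
    rw [backMap]
    split_ifs
    · rfl
    · rw [add_zero]
  have hlin (d : ℝ) : Tendsto (fun y => (y + d) / β) (𝓝[≥] x) (𝓝[≥] ((x + d) / β)) :=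
    tendsto_nhdsWithin_of_tendsto_nhds_of_eventually_within _
      ((Continuous.tendsto (by fun_prop) x).mono_left nhdsWithin_le_nhds)
      (eventually_mem_nhdsWithin.mono fun y (hy : x ≤ y) => by
        simp only [mem_Ici]
        gcongr)
  rw [heq x]
  refine (hlin _).congr' ((eventually_nhdsGE_lt_iff (β - 1) x).mono fun y hy => ?_)
  simp only [heq y, hy]

theorem hasPeriodicAbove_of_backMap (hβ : β ∈ Ioo (1 : ℝ) 2) (hε : 0 < ε)
    (hz : ∀ n, (backMap β)^[n] z ∈ Icc (1 - 1 / β) (1 - ε)) : HasPeriodicAbove β := by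
  have hβ0 : 0 < β := zero_lt_one.trans hβ.1
  have hcut := one_sub_one_div_pos hβ.1
  by_cases hreturn : ∃ i j, i < j ∧ dist ((backMap β)^[i] z) ((backMap β)^[j] z) <
      ε / 2 * (1 - 1 / β) ∧ (backMap β)^[i] z ≤ (backMap β)^[j] z
  · obtain ⟨i, j, hij, hd, hle⟩ := hreturn
    obtain ⟨m, hm, rfl⟩ := exists_pos_add_of_lt' hij
    refine hasPeriodicAbove_of_close_return (w := fun l => (backMap β)^[i + l] z) (ε := ε / 2) hβ
      hm (fun l _ => ⟨if (backMap β)^[i + l] z < β - 1 then 1 else 0, ?_⟩) (fun l _ => ?_)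
      (fun l _ => ?_) ?_
    · rw [← add_assoc, Function.iterate_succ_apply']
      exact mul_backMap hβ0.ne' _
    · exact ⟨(hz _).1, by linarith [(hz (i + l)).2]⟩
    · exact ⟨by linarith [(hz (i + l)).1], by linarith [(hz (i + l)).2]⟩
    · rw [dist_comm, Real.dist_eq] at hd
      exact Icc_subset_uIcc ⟨sub_nonneg.2 hle, (lt_of_abs_lt hd).le⟩
  · push Not at hreturn
    obtain ⟨p, ⟨m, hm, hp⟩, hmem⟩ := exists_mem_periodicPts_of_decreasing (tendsto_backMap hβ0)
      (mul_pos (half_pos hε) hcut) hz hreturn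
    refine hasPeriodicAbove_of_backward (w := fun l => (backMap β)^[l] p) hm (fun l _ => ?_)
      (fun l _ => ⟨(hmem l).1, by linarith [(hmem l).2]⟩) hp
    rw [Function.iterate_succ_apply']
    exact betaMap_backMap hβ0.ne' ⟨hcut.le.trans (hmem l).1, by linarith [(hmem l).2]⟩

theorem hasPeriodicAbove_of_mem_forwardSet (hβ : β ∈ Ioo (1 : ℝ) 2) (ht : 1 - 1 / β < t)
    (hx : x ∈ forwardSet β t) : HasPeriodicAbove β := by
  have hβ0 : 0 < β := zero_lt_one.trans hβ.1
  have hcut := one_sub_one_div_pos hβ.1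
  by_cases hreturn : ∃ i j, i < j ∧ dist ((betaMap β)^[i] x) ((betaMap β)^[j] x) <
      (t - (1 - 1 / β)) * (1 - 1 / β) ∧ (betaMap β)^[i] x ≤ (betaMap β)^[j] x
  · obtain ⟨i, j, hij, hd, hle⟩ := hreturn
    obtain ⟨m, hm, rfl⟩ := exists_pos_add_of_lt' hij
    refine hasPeriodicAbove_of_close_return (w := fun l => (betaMap β)^[i + (m - l)] x)
      (ε := -(t - (1 - 1 / β))) hβ hm (fun l hl => ?_) (fun l _ => ?_) (fun l _ => ?_) ?_
    · refine ⟨⌊β * (betaMap β)^[i + (m - (l + 1))] x⌋, ?_⟩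
      rw [show i + (m - l) = i + (m - (l + 1)) + 1 by omega, Function.iterate_succ_apply']
      exact mul_eq_floor_add_betaMap _ _
    · exact ⟨ht.le.trans (hx _).1, (hx _).2⟩
    · exact ⟨by linarith [(hx (i + (m - l))).1], by linarith [(hx (i + (m - l))).2]⟩
    · rw [dist_comm, Real.dist_eq] at hd
      simp only [Nat.sub_self, Nat.sub_zero, add_zero, neg_mul]
      exact mem_uIcc.2 (.inr ⟨by linarith [lt_of_abs_lt hd], by linarith⟩)
  · push Not at hreturn
    obtain ⟨p, hp, hmem⟩ := exists_mem_periodicPts_of_decreasing (tendsto_betaMap hβ0.le)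
      (mul_pos (sub_pos.2 ht) hcut) (fun n => Ico_subset_Icc_self (hx n)) hreturn
    have hp01 : p ∈ Ico (0 : ℝ) 1 := by
      obtain ⟨m, hm, hper⟩ := hp
      rw [← hper, ← Nat.succ_pred_eq_of_pos hm, Function.iterate_succ_apply']
      exact betaMap_mem_Ico _ _
    exact ⟨p, fun l => ⟨ht.le.trans (hmem l).1, (iterate_betaMap_mem_Ico hp01 l).2⟩, hp⟩

end

section

variable {β t u y δ η C : ℝ} {f g : ℝ → ℝ} {k n N : ℕ}

/-! ### Exponential growth in the absence of periodic orbits -/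

/-- The number of preimages of order `n` of `y` in `[t, 1)`, where `y` stands for points slightly
to the left of `y`: this is why `y ≤ β - 1` is not strict and `β * t < y` is. -/
noncomputable def leftCount (β t : ℝ) : ℕ → ℝ → ℝ
  | 0, _ => 1
  | n + 1, y => (if β * t < y then leftCount β t n (y / β) else 0) +
      (if y ≤ β - 1 then leftCount β t n ((y + 1) / β) else 0)

theorem tailOp_indicator (hβ : β ∈ Ioo (1 : ℝ) 2) (ht : 0 ≤ t) (hy : y ∈ Ioc t 1)
    (hu : u ∈ Icc t 1) :
    tailOp β t (fun v => if v < y then 1 else 0) u =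
      (if β * t < y then 1 else 0) * (if u < y / β then 1 else 0) +
      (if y ≤ β - 1 then 1 else 0) * (if u < (y + 1) / β then 1 else 0) := by
  have hβ0 : 0 < β := zero_lt_one.trans hβ.1
  have hclamp (v : ℝ) : clampMap β t v < y ↔ betaMap β v < y := by
    rw [clampMap, max_lt_iff, and_iff_left hy.1]
  have htu : β * t ≤ β * u := mul_le_mul_of_nonneg_left hu.1 hβ0.le
  have hu1 : β * u ≤ β := mul_le_of_le_one_right hβ0.le hu.2
  have hy0 : 0 < y := ht.trans_lt hy.1
  rcases lt_or_ge u (1 / β) with h | h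
  · rw [tailOp_of_lt _ h]
    simp only [hclamp, betaMap_of_lt hβ0 (ht.trans hu.1) h, betaMap_one ⟨hβ.1.le, hβ.2⟩, hy.1,
      if_true]
    rw [lt_div_iff₀' hβ0] at h
    simp only [lt_div_iff₀' hβ0]
    split_ifs <;> linarith
  · rw [tailOp_of_le _ h]
    simp only [hclamp, betaMap_of_le hβ h hu.2, betaMap_one ⟨hβ.1.le, hβ.2⟩]
    rw [div_le_iff₀' hβ0] at h
    simp only [lt_div_iff₀' hβ0]
    split_ifs <;> linarith [hy.2]

theorem tailOp_congr (ht : t < 1) (h : EqOn f g (Icc t 1)) :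
    EqOn (tailOp β t f) (tailOp β t g) (Icc t 1) := fun u _ => by
  rw [tailOp, tailOp, h (clampMap_mem_Icc ht u), h (clampMap_mem_Icc ht 1), h ⟨le_rfl, ht.le⟩]

theorem tailOp_iterate_congr (ht : t < 1) (n : ℕ) (h : EqOn f g (Icc t 1)) :
    EqOn ((tailOp β t)^[n] f) ((tailOp β t)^[n] g) (Icc t 1) := by
  induction n generalizing f g with
  | zero => exact h
  | succ _ ih => exact ih (tailOp_congr ht h)

theorem tailOp_iterate_linear (n : ℕ) (a b : ℝ) (f g : ℝ → ℝ) :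
    (tailOp β t)^[n] (fun u => a * f u + b * g u) =
      fun u => a * (tailOp β t)^[n] f u + b * (tailOp β t)^[n] g u := by
  induction n generalizing f g with
  | zero => rfl
  | succ n ih =>
    have hlin : tailOp β t (fun u => a * f u + b * g u) =
        fun u => a * tailOp β t f u + b * tailOp β t g u := by
      funext u
      simp only [tailOp]
      split_ifs <;> ring
    rw [Function.iterate_succ_apply, hlin, ih]
    rfl

theorem tailOp_iterate_indicator (hβ : β ∈ Ioo (1 : ℝ) 2) (ht : t ∈ Ico 0 (1 - 1 / β)) (n : ℕ)
    (hy : y ∈ Ioc t 1) :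
    (tailOp β t)^[n] (fun u => if u < y then 1 else 0) t = leftCount β t n y := by
  have hβ0 : 0 < β := zero_lt_one.trans hβ.1
  have ht1 : t < 1 := ht.2.trans (one_sub_one_div_lt_one hβ0)
  induction n generalizing y with
  | zero => exact if_pos hy.1
  | succ n ih =>
    rw [Function.iterate_succ_apply, tailOp_iterate_congr ht1 n
      (fun u hu => tailOp_indicator hβ ht.1 hy hu) ⟨le_rfl, ht1.le⟩, tailOp_iterate_linear,
      leftCount]
    refine congrArg₂ (· + ·) ?_ ?_
    · split_ifs with h
      · rw [one_mul, ih ⟨by rwa [lt_div_iff₀' hβ0], (div_le_one hβ0).2 (hy.2.trans hβ.1.le)⟩]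
      · rw [zero_mul]
    · split_ifs with h
      · have ht_lt : t < (y + 1) / β :=
          (ht.2.trans (one_sub_one_div_lt_one_div hβ)).trans
            (div_lt_div_of_pos_right (by linarith [ht.1, hy.1]) hβ0)
        rw [one_mul, ih ⟨ht_lt, by rw [div_le_one hβ0]; linarith⟩]
      · rw [zero_mul]

theorem tailCount_eq_leftCount (hβ : β ∈ Ioo (1 : ℝ) 2) (ht : t ∈ Ico 0 (1 - 1 / β)) (n : ℕ) :
    tailCount β t n t = leftCount β t n 1 :=
  tailOp_iterate_indicator hβ ht n
    ⟨ht.2.trans (one_sub_one_div_lt_one (zero_lt_one.trans hβ.1)), le_rfl⟩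

theorem div_mem_Ioc (hβ : 1 ≤ β) (hy : y ∈ Ioc (0 : ℝ) 1) : y / β ∈ Ioc (0 : ℝ) 1 :=
  ⟨div_pos hy.1 (zero_lt_one.trans_le hβ), div_le_one_of_le₀ (hy.2.trans hβ) (zero_le_one.trans hβ)⟩

theorem add_one_div_mem_Ioc (hy : 0 < y) (h : y ≤ β - 1) : (y + 1) / β ∈ Ioc (0 : ℝ) 1 := by
  have hβ0 : 0 < β := by linarith
  exact ⟨div_pos (by linarith) hβ0, by rw [div_le_one hβ0]; linarith⟩

theorem mul_leftCount_le_leftCount_add (hβ : 1 ≤ β)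
    (hC : ∀ y ∈ Ioc (0 : ℝ) 1, C ≤ leftCount β t n y) (k : ℕ) (hy : y ∈ Ioc (0 : ℝ) 1) :
    C * leftCount β t k y ≤ leftCount β t (n + k) y := by
  induction k generalizing y with
  | zero => simpa only [leftCount, mul_one, add_zero] using hC y hy
  | succ k ih =>
    rw [← add_assoc, leftCount, leftCount, mul_add]
    refine add_le_add ?_ ?_
    · split_ifs
      · exact ih (div_mem_Ioc hβ hy)
      · rw [mul_zero]
    · split_ifs with h
      · exact ih (add_one_div_mem_Ioc hy.1 h)
      · rw [mul_zero]

theorem one_le_leftCount (hβ : 1 ≤ β) (ht : β * t ≤ β - 1) (n : ℕ) (hy : y ∈ Ioc (0 : ℝ) 1) :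
    1 ≤ leftCount β t n y := by
  induction n generalizing y with
  | zero => exact le_rfl
  | succ n ih =>
    have hdiv := ih (div_mem_Ioc hβ hy)
    rw [leftCount]
    by_cases h : y ≤ β - 1
    · have hadd := ih (add_one_div_mem_Ioc hy.1 h)
      rw [if_pos h]
      split_ifs <;> linarith
    · rwa [if_neg h, if_pos (by linarith), add_zero]

/-- A single preimage is the one given by `backMap`, and `y` has a distance to the discontinuity
of `backMap` on its right. -/
theorem exists_backMap_eq_of_leftCount_lt (hβ : β ∈ Ioo (1 : ℝ) 2) (ht : 0 ≤ t) (hδ : 0 < δ)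
    (htδ : t + 2 * δ ≤ 1 - 1 / β) (hy : y ∈ Ioc (0 : ℝ) 1) (h : leftCount β t (k + 1) y < 2) :
    ∃ z ∈ Icc (1 - 1 / β) (t + 1 / β), leftCount β t k z < 2 ∧
      ∀ η ∈ Icc 0 δ, backMap β (y + η) = z + η / β := by
  have hβ0 : 0 < β := zero_lt_one.trans hβ.1
  have hβt : β * t + 2 * (β * δ) ≤ β - 1 := by
    calc β * t + 2 * (β * δ) = β * (t + 2 * δ) := by ring
      _ ≤ β * (1 - 1 / β) := mul_le_mul_of_nonneg_left htδ hβ0.le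
      _ = β - 1 := mul_one_sub_one_div hβ0.ne'
  have hβδ : δ < β * δ := lt_mul_of_one_lt_left hδ hβ.1
  have hdiv := one_le_leftCount (t := t) hβ.1.le (by linarith) k (div_mem_Ioc hβ.1.le hy)
  rw [leftCount] at h
  rcases le_or_gt y (β - 1) with hyβ | hyβ
  · have hadd := one_le_leftCount (t := t) hβ.1.le (by linarith) k (add_one_div_mem_Ioc hy.1 hyβ)
    rw [if_pos hyβ] at h
    have hyt : y ≤ β * t := by
      by_contra! hlt
      rw [if_pos hlt] at h
      linarith
    rw [if_neg hyt.not_gt, zero_add] at h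
    refine ⟨(y + 1) / β, ⟨?_, ?_⟩, h, fun η hη => ?_⟩
    · exact (one_sub_one_div_lt_one_div hβ).le.trans
        (div_le_div_of_nonneg_right (by linarith [hy.1]) hβ0.le)
    · rw [← mul_div_cancel_left₀ t hβ0.ne', ← add_div]
      gcongr
    · rw [backMap, if_pos (by linarith [hη.2])]
      ring
  · rw [if_neg hyβ.not_ge, add_zero, if_pos (by linarith)] at h
    refine ⟨y / β, ⟨?_, ?_⟩, h, fun η hη => ?_⟩
    · rw [le_div_iff₀' hβ0, mul_one_sub_one_div hβ0.ne']
      exact hyβ.le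
    · exact (div_le_div_of_nonneg_right hy.2 hβ0.le).trans (le_add_of_nonneg_left ht)
    · rw [backMap, if_neg (by linarith [hη.1]), add_div]

theorem iterate_backMap_mem_of_leftCount_lt (hβ : β ∈ Ioo (1 : ℝ) 2) (ht : 0 ≤ t) (hδ : 0 < δ)
    (htδ : t + 2 * δ ≤ 1 - 1 / β) (hy : y ∈ Ioc (0 : ℝ) 1) (h : leftCount β t n y < 2)
    (hη : η ∈ Icc 0 δ) (hk : k < n) :
    (backMap β)^[k] (backMap β (y + η)) ∈ Icc (1 - 1 / β) (1 - δ) := by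
  obtain ⟨n, rfl⟩ := Nat.exists_eq_succ_of_ne_zero (Nat.ne_zero_of_lt hk)
  obtain ⟨z, hz, hzcount, hback⟩ := exists_backMap_eq_of_leftCount_lt hβ ht hδ htδ hy h
  have hη' : η / β ∈ Icc 0 δ :=
    ⟨div_nonneg hη.1 (zero_le_one.trans hβ.1.le), (div_le_self hη.1 hβ.1.le).trans hη.2⟩
  rw [hback η hη]
  induction k generalizing n y z η with
  | zero => exact ⟨by simpa using add_le_add hz.1 hη'.1, by
      simp only [Function.iterate_zero, id]
      linarith [hz.2, hη'.2]⟩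
  | succ k ih =>
    have hz01 : z ∈ Ioc (0 : ℝ) 1 := ⟨(one_sub_one_div_pos hβ.1).trans_le hz.1, by linarith [hz.2]⟩
    obtain ⟨n, rfl⟩ := Nat.exists_eq_succ_of_ne_zero (show n ≠ 0 by omega)
    obtain ⟨z', hz', hzcount', hback'⟩ :=
      exists_backMap_eq_of_leftCount_lt hβ ht hδ htδ hz01 hzcount
    rw [Function.iterate_succ_apply, hback' _ hη']
    exact ih hz01 hη' n hzcount (by omega) z' hz' hzcount' hback'
      ⟨div_nonneg hη'.1 (zero_le_one.trans hβ.1.le), (div_le_self hη'.1 hβ.1.le).trans hη'.2⟩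

/-- Otherwise there are points with a unique backward orbit of any given length. They can be moved
to a finite grid, and one point of the grid works for all lengths. -/
theorem exists_two_le_leftCount (hβ : β ∈ Ioo (1 : ℝ) 2) (hP : ¬ HasPeriodicAbove β)
    (ht : t ∈ Ico 0 (1 - 1 / β)) :
    ∃ N, 0 < N ∧ ∀ y ∈ Ioc (0 : ℝ) 1, 2 ≤ leftCount β t N y := by
  by_contra! hcon
  obtain ⟨δ, hδ, htδ⟩ : ∃ δ, 0 < δ ∧ t + 2 * δ = 1 - 1 / β :=
    ⟨(1 - 1 / β - t) / 2, half_pos (sub_pos.2 ht.2), by ring⟩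
  have hgrid (n : ℕ) : ∃ i ≤ ⌈1 / δ⌉₊, ∀ k < n + 1,
      (backMap β)^[k] (backMap β (i * δ)) ∈ Icc (1 - 1 / β) (1 - δ) := by
    obtain ⟨y, hy, hlt⟩ := hcon (n + 1) n.succ_pos
    refine ⟨⌈y / δ⌉₊, Nat.ceil_mono (div_le_div_of_nonneg_right hy.2 hδ.le), fun k hk => ?_⟩
    have hle := Nat.le_ceil (y / δ)
    have hgt := Nat.ceil_lt_add_one (div_nonneg hy.1.le hδ.le)
    rw [div_le_iff₀ hδ] at hle
    rw [div_add_one hδ.ne', lt_div_iff₀ hδ] at hgt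
    have := iterate_backMap_mem_of_leftCount_lt hβ ht.1 hδ htδ.le hy hlt
      (η := ⌈y / δ⌉₊ * δ - y) ⟨by linarith, by linarith⟩ hk
    rwa [add_sub_cancel] at this
  obtain ⟨i, hi⟩ : ∃ i : ℕ, ∀ k,
      (backMap β)^[k] (backMap β (i * δ)) ∈ Icc (1 - 1 / β) (1 - δ) := by
    by_contra! hno
    choose J hJ using hno
    obtain ⟨i, hi, hmem⟩ := hgrid ((Finset.range (⌈1 / δ⌉₊ + 1)).sup J)
    exact hJ i (hmem _ (Nat.lt_succ_of_le
      (Finset.le_sup (Finset.mem_range.2 (Nat.lt_succ_of_le hi)))))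
  exact hP (hasPeriodicAbove_of_backMap hβ hδ hi)

theorem two_pow_le_leftCount (hβ : 1 ≤ β) (hN : ∀ y ∈ Ioc (0 : ℝ) 1, 2 ≤ leftCount β t N y) (k : ℕ)
    (hy : y ∈ Ioc (0 : ℝ) 1) : (2 : ℝ) ^ k ≤ leftCount β t (N * k) y := by
  induction k generalizing y with
  | zero => rw [pow_zero, mul_zero, leftCount]
  | succ k ih =>
    rw [pow_succ, Nat.mul_succ]
    exact (mul_le_mul_of_nonneg_left (hN y hy) (by positivity)).trans
      (mul_leftCount_le_leftCount_add hβ (fun _ => ih) N hy)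

theorem exists_not_summable_of_two_pow_le {c : ℕ → ℝ} (hN : 0 < N)
    (hc : ∀ k, (2 : ℝ) ^ k ≤ c (N * k)) :
    ∃ z ∈ Ioo (0 : ℝ) 1, ¬ Summable fun n => z ^ n * c n := by
  obtain ⟨z, hzlim, hz0, hz1⟩ : ∃ z : ℝ, 1 / 2 < z ^ N ∧ 0 < z ∧ z < 1 := by
    have hcont : Tendsto (fun z : ℝ => z ^ N) (𝓝[<] 1) (𝓝 1) :=
      ((continuous_pow N).tendsto' 1 1 (one_pow N)).mono_left nhdsWithin_le_nhds
    exact ((hcont.eventually_const_lt one_half_lt_one).and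
      (Ioo_mem_nhdsLT zero_lt_one)).exists
  refine ⟨z, ⟨hz0, hz1⟩, fun hs => ?_⟩
  obtain ⟨k, hk⟩ := ((hs.tendsto_atTop_zero.comp
    (tendsto_id.const_mul_atTop' hN)).eventually_lt_const zero_lt_one).exists
  refine hk.not_ge ?_
  calc (1 : ℝ) ≤ (z ^ N * 2) ^ k := one_le_pow₀ (by linarith)
    _ = z ^ (N * k) * 2 ^ k := by rw [mul_pow, pow_mul]
    _ ≤ z ^ (N * k) * c (N * k) := mul_le_mul_of_nonneg_left (hc k) (by positivity)

theorem dimH_survivorSet_pos_of_not_hasPeriodicAbove (hβ : β ∈ Ioo (1 : ℝ) 2)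
    (hP : ¬ HasPeriodicAbove β) (ht : t ∈ Ioo 0 (1 - 1 / β)) : 0 < dimH (survivorSet β t) := by
  have ht' := Ioo_subset_Ico_self ht
  obtain ⟨N, hN0, hN⟩ := exists_two_le_leftCount hβ hP ht'
  obtain ⟨z, hz, hns⟩ := exists_not_summable_of_two_pow_le
    (c := fun n => tailCount β t n t) hN0 fun k => by
    rw [tailCount_eq_leftCount hβ ht']
    exact two_pow_le_leftCount hβ.1.le hN k ⟨zero_lt_one, le_rfl⟩
  exact dimH_survivorSet_pos hβ
    ⟨ht.1, ht.2.trans (one_sub_one_div_lt_one (zero_lt_one.trans hβ.1))⟩ hz hns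

theorem IsCriticalValue.eq_of_not_hasPeriodicAbove {τ : ℝ} (hτ : IsCriticalValue β τ)
    (hβ : β ∈ Ioo (1 : ℝ) 2) (hP : ¬ HasPeriodicAbove β) (hτ_le : τ ≤ 1 - 1 / β) :
    τ = 1 - 1 / β := by
  refine hτ_le.eq_of_not_lt fun hlt => ?_
  have hτ1 : τ < 1 := hlt.trans (one_sub_one_div_lt_one (zero_lt_one.trans hβ.1))
  exact lt_irrefl τ ((hτ τ ⟨hτ.pos.le, hτ1⟩).1
    (dimH_survivorSet_pos_of_not_hasPeriodicAbove hβ hP ⟨hτ.pos, hlt⟩))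

end

section

variable {β t x δ a b s : ℝ} {n : ℕ}

/-! ### The closure of the set of orbit-minimal points -/

theorem zero_mem_orbitMinimalSet (β : ℝ) : (0 : ℝ) ∈ orbitMinimalSet β :=
  ⟨⟨le_rfl, zero_lt_one⟩, fun n => (iterate_betaMap_zero β n).ge⟩

theorem mem_forwardSet_of_mem_orbitMinimalSet (ht : t ∈ orbitMinimalSet β) : t ∈ forwardSet β t :=
  fun n => ⟨ht.2 n, (iterate_betaMap_mem_Ico ht.1 n).2⟩

theorem closure_orbitMinimalSet_subset (β : ℝ) : closure (orbitMinimalSet β) ⊆ Icc 0 1 :=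
  closure_minimal (fun _ ht => Ico_subset_Icc_self ht.1) isClosed_Icc

theorem exists_iterate_betaMap_eq_zero (hβ : 1 < β) (ha : 0 ≤ a) (hab : a < b) (hb : b ≤ 1) :
    ∃ s ∈ Ioo a b, ∃ n, (betaMap β)^[n] s = 0 := by
  have ha01 : a ∈ Ico (0 : ℝ) 1 := ⟨ha, hab.trans_le hb⟩
  obtain ⟨n, η, hη, hηle, hend, hlt⟩ := exists_branch_end (δ := (b - a) / 2) hβ ha01
    (by linarith) (by linarith)
  refine ⟨a + η, ⟨by linarith, by linarith⟩, n + 1, ?_⟩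
  have hnonneg (j : ℕ) : 0 ≤ (betaMap β)^[j] a + β ^ j * η :=
    add_nonneg (iterate_betaMap_mem_Ico ha01 j).1 (by positivity)
  rw [Function.iterate_succ_apply',
    iterate_betaMap_add (fun j hj => ⟨hnonneg j, hlt j hj⟩) n le_rfl]
  refine betaMap_eq_of_eq_add (⌊β * (betaMap β)^[n] a⌋ + 1) ⟨le_rfl, zero_lt_one⟩ ?_
  rw [Function.iterate_succ_apply'] at hend
  push_cast
  linear_combination hend + mul_eq_floor_add_betaMap β ((betaMap β)^[n] a)

/-- The iterates are continuous from the right, so the points to the right of `s` are sent close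
to `0`. -/
theorem exists_Ioo_disjoint_orbitMinimalSet (hβ : 0 ≤ β) (hs : 0 < s)
    (hn : (betaMap β)^[n] s = 0) : ∃ u > s, Disjoint (Ioo s u) (orbitMinimalSet β) := by
  have hev := ((tendsto_iterate_nhdsGE (tendsto_betaMap hβ) n s).mono_right
    nhdsWithin_le_nhds).eventually_lt_const (hn.trans_lt hs)
  obtain ⟨u, hu, hsub⟩ := mem_nhdsGE_iff_exists_Ico_subset.1 hev
  exact ⟨u, hu, disjoint_left.2 fun w hw hwE =>
    (hwE.2 n).not_gt ((hsub ⟨hw.1.le, hw.2⟩ : (betaMap β)^[n] w < s).trans hw.1)⟩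

theorem isTotallyDisconnected_closure_orbitMinimalSet (hβ : 1 < β) :
    IsTotallyDisconnected (closure (orbitMinimalSet β)) := by
  intro S hS hpre a ha b hb
  by_contra hne
  wlog hab : a < b generalizing a b with H
  · exact H hb ha (Ne.symm hne) (lt_of_le_of_ne (not_lt.1 hab) (Ne.symm hne))
  have ha0 := (closure_orbitMinimalSet_subset β (hS ha)).1
  obtain ⟨s, hs, n, hn⟩ := exists_iterate_betaMap_eq_zero hβ ha0 hab
    (closure_orbitMinimalSet_subset β (hS hb)).2
  obtain ⟨u, hu, hdisj⟩ := exists_Ioo_disjoint_orbitMinimalSet (by linarith)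
    (ha0.trans_lt hs.1) hn
  obtain ⟨y, hsy, hy⟩ := exists_between (lt_min hu hs.2)
  have hy_mem : y ∈ closure (orbitMinimalSet β) :=
    hS (hpre.Icc_subset ha hb ⟨(hs.1.trans hsy).le, (hy.trans_le (min_le_right _ _)).le⟩)
  exact disjoint_left.1 (hdisj.closure_right isOpen_Ioo) ⟨hsy, hy.trans_le (min_le_left _ _)⟩ hy_mem

theorem iterate_backMap_mem_forwardSet (hβ : β ∈ Ioo (1 : ℝ) 2) (ht0 : 0 ≤ t)
    (ht : t ≤ 1 - 1 / β) (hx : x ∈ forwardSet β t) (n : ℕ) :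
    (backMap β)^[n] x ∈ forwardSet β t := by
  induction n with
  | zero => exact hx
  | succ n ih =>
    rw [Function.iterate_succ_apply']
    have hn : (backMap β)^[n] x ∈ Ico (0 : ℝ) 1 := ⟨ht0.trans (ih 0).1, (ih 0).2⟩
    have hback := backMap_mem_Ico hβ hn
    refine mem_forwardSet_of_betaMap ⟨ht.trans hback.1, hback.2⟩ ?_
    rwa [betaMap_backMap (zero_lt_one.trans hβ.1).ne' hn]

theorem exists_mem_forwardSet_gt (hβ : β ∈ Ioo (1 : ℝ) 2) (hP : ¬ HasPeriodicAbove β)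
    (ht0 : 0 ≤ t) (ht : t ≤ 1 - 1 / β) (hx : x ∈ forwardSet β t) (ha : a < 1) :
    ∃ y ∈ forwardSet β t, a < y := by
  by_contra! hcon
  refine hP (hasPeriodicAbove_of_backMap (z := backMap β x) (ε := 1 - a) hβ (by linarith)
    fun n => ?_)
  have hle := hcon _ (iterate_backMap_mem_forwardSet hβ ht0 ht hx (n + 1))
  have hmem := iterate_backMap_mem_forwardSet hβ ht0 ht hx n 0
  rw [← Function.iterate_succ_apply]
  refine ⟨?_, by rwa [sub_sub_cancel]⟩
  rw [Function.iterate_succ_apply']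
  exact (backMap_mem_Ico hβ ⟨ht0.trans hmem.1, hmem.2⟩).1

theorem nonempty_forwardSet (hβ : β ≠ 0) (ht : 0 ≤ t) (h : 0 < dimH (survivorSet β t)) :
    (forwardSet β t).Nonempty := by
  rw [dimH_survivorSet hβ ht] at h
  exact nonempty_iff_ne_empty.2 fun hempty => by simp [hempty] at h

theorem exists_shadowing (hβ : 1 < β) (hx : x ∈ Ico (0 : ℝ) 1) (hδ : 0 < δ) (hxδ : x + δ < 1) :
    ∃ n, ∀ y ∈ Ioo ((betaMap β)^[n] x) 1, ∃ η ∈ Ioo 0 δ, (betaMap β)^[n] (x + η) = y ∧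
      ∀ j ≤ n, (betaMap β)^[j] (x + η) = (betaMap β)^[j] x + β ^ j * η := by
  obtain ⟨n, η₀, -, hη₀δ, hend, hlt⟩ := exists_branch_end hβ hx hδ hxδ
  have hpow (j : ℕ) : 0 < β ^ j := pow_pos (zero_lt_one.trans hβ) j
  refine ⟨n + 1, fun y hy => ?_⟩
  set η := (y - (betaMap β)^[n + 1] x) / β ^ (n + 1)
  have hη : β ^ (n + 1) * η = y - (betaMap β)^[n + 1] x := mul_div_cancel₀ _ (hpow _).ne'
  have hη0 : 0 < η := div_pos (sub_pos.2 hy.1) (hpow _)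
  have hηη₀ : η < η₀ := lt_of_mul_lt_mul_left (by linarith [hy.2]) (hpow (n + 1)).le
  have hadd := iterate_betaMap_add (β := β) (x := x) (η := η) (n := n + 1) fun j hj => by
    refine ⟨add_nonneg (iterate_betaMap_mem_Ico hx j).1 (mul_nonneg (hpow j).le hη0.le), ?_⟩
    rcases hj.lt_or_eq with h | rfl
    · exact (add_le_add_right (mul_le_mul_of_nonneg_left hηη₀.le (hpow j).le) _).trans_lt
        (hlt j (Nat.le_of_lt_succ h))
    · linarith [hy.2]
  exact ⟨η, ⟨hη0, hηη₀.trans_le hη₀δ⟩, by rw [hadd _ le_rfl, hη, add_sub_cancel], hadd⟩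

/-- Follow the orbit of `t` for a long time and then the orbit of a survivor of a larger hole. -/
theorem exists_mem_orbitMinimalSet_right (hβ : β ∈ Ioo (1 : ℝ) 2) (hP : ¬ HasPeriodicAbove β)
    (ht : t ∈ orbitMinimalSet β) (hδ : 0 < δ) (htδ : t + δ < 1 - 1 / β) :
    ∃ x ∈ orbitMinimalSet β, x ∈ Ioo t (t + δ) := by
  have hβ0 : 0 < β := zero_lt_one.trans hβ.1
  have htδ0 : 0 < t + δ := add_pos_of_nonneg_of_pos ht.1.1 hδ
  obtain ⟨n, hn⟩ := exists_shadowing hβ.1 ht.1 hδ (htδ.trans (one_sub_one_div_lt_one hβ0))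
  obtain ⟨y₀, hy₀⟩ := nonempty_forwardSet hβ0.ne' htδ0.le
    (dimH_survivorSet_pos_of_not_hasPeriodicAbove hβ hP ⟨htδ0, htδ⟩)
  obtain ⟨y, hy, hyt⟩ := exists_mem_forwardSet_gt hβ hP htδ0.le htδ.le hy₀
    (iterate_betaMap_mem_Ico (β := β) ht.1 n).2
  obtain ⟨η, hη, hηy, hshadow⟩ := hn y ⟨hyt, (hy 0).2⟩
  refine ⟨t + η, ⟨⟨by linarith [ht.1.1, hη.1], ?_⟩, fun j => ?_⟩, by linarith [hη.1],
    by linarith [hη.2]⟩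
  · linarith [hη.2, one_sub_one_div_lt_one hβ0]
  rcases le_total j n with h | h
  · rw [hshadow j h]
    exact add_le_add (ht.2 j) (le_mul_of_one_le_left hη.1.le (one_le_pow₀ hβ.1.le))
  · obtain ⟨k, rfl⟩ := Nat.exists_eq_add_of_le' h
    rw [Function.iterate_add_apply, hηy]
    linarith [(hy k).1, hη.2]

/-- The second preimage of the image of a survivor close to `1` is close to `1 - 1/β`. -/
theorem exists_mem_orbitMinimalSet_left (hβ : β ∈ Ioo (1 : ℝ) 2) (hP : ¬ HasPeriodicAbove β)
    (hcut : 1 - 1 / β ∈ orbitMinimalSet β) (hs : s ∈ Ioo 0 (1 - 1 / β)) :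
    ∃ x ∈ orbitMinimalSet β, x ∈ Ico s (1 - 1 / β) := by
  have hβ0 : 0 < β := zero_lt_one.trans hβ.1
  obtain ⟨y, hy, hys⟩ := exists_mem_forwardSet_gt (a := s + 1 / β) hβ hP
    (one_sub_one_div_pos hβ.1).le le_rfl (mem_forwardSet_of_mem_orbitMinimalSet hcut)
    (by linarith [hs.2])
  have hy1 : y < 1 := (hy 0).2
  have hinv : 0 < 1 / β := one_div_pos.2 hβ0
  have hmap : betaMap β (y - 1 / β) = betaMap β y := by
    rw [betaMap_of_le hβ (by linarith [hs.1]) hy1.le, betaMap_of_lt hβ0 (by linarith [hs.1])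
      (by linarith [one_sub_one_div_lt_one_div hβ]), mul_sub, mul_one_div_cancel hβ0.ne']
  have hx : y - 1 / β ∈ forwardSet β s := by
    refine mem_forwardSet_of_betaMap ⟨by linarith, by linarith⟩ ?_
    rw [hmap]
    exact forwardSet_anti hs.2.le (betaMap_mem_forwardSet hy)
  have hs_le : s ∈ lowerBounds (range fun n => (betaMap β)^[n] (y - 1 / β)) := by
    rintro _ ⟨n, rfl⟩
    exact (hx n).1
  refine ⟨_, sInf_orbit_mem_orbitMinimalSet hβ0.le ⟨hs.1.le.trans (hx 0).1, (hx 0).2⟩,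
    le_csInf (range_nonempty _) hs_le, ?_⟩
  calc sInf (range fun n => (betaMap β)^[n] (y - 1 / β)) ≤ y - 1 / β := csInf_le ⟨s, hs_le⟩ ⟨0, rfl⟩
    _ < 1 - 1 / β := sub_lt_sub_right hy1 _

theorem preperfect_orbitMinimalSet (hβ : β ∈ Ioo (1 : ℝ) 2) (hP : ¬ HasPeriodicAbove β) :
    Preperfect (orbitMinimalSet β) := by
  intro t ht
  rw [accPt_iff_frequently_nhdsNE]
  rcases lt_trichotomy t (1 - 1 / β) with h | rfl | h
  · refine Frequently.filter_mono ?_ (nhdsGT_le_nhdsNE t)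
    refine (nhdsGT_basis t).frequently_iff.2 fun s hs => ?_
    obtain ⟨r, htr, hr⟩ := exists_between (lt_min h hs)
    obtain ⟨x, hxE, hx⟩ := exists_mem_orbitMinimalSet_right (δ := r - t) hβ hP ht
      (sub_pos.2 htr) (by linarith [min_le_left (1 - 1 / β) s])
    exact ⟨x, ⟨hx.1, by linarith [hx.2, min_le_right (1 - 1 / β) s]⟩, hxE⟩
  · have hcut := one_sub_one_div_pos hβ.1
    refine Frequently.filter_mono ?_ (nhdsLT_le_nhdsNE _)
    refine (nhdsLT_basis _).frequently_iff.2 fun s hs => ?_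
    obtain ⟨r, hsr, hr⟩ := exists_between (max_lt hs hcut)
    obtain ⟨x, hxE, hx⟩ := exists_mem_orbitMinimalSet_left hβ hP ht
      ⟨(le_max_right s 0).trans_lt hsr, hr⟩
    exact ⟨x, ⟨((le_max_left s 0).trans_lt hsr).trans_le hx.1, hx.2⟩, hxE⟩
  · exact absurd (hasPeriodicAbove_of_mem_forwardSet hβ h
      (mem_forwardSet_of_mem_orbitMinimalSet ht)) hP

theorem isCantorSet_closure_orbitMinimalSet (hβ : β ∈ Ioo (1 : ℝ) 2) (hP : ¬ HasPeriodicAbove β) :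
    IsCantorSet (closure (orbitMinimalSet β)) where
  nonempty := ⟨0, subset_closure (zero_mem_orbitMinimalSet β)⟩
  isCompact := isCompact_Icc.of_isClosed_subset isClosed_closure (closure_orbitMinimalSet_subset β)
  perfect := (preperfect_orbitMinimalSet hβ hP).perfect_closure
  isTotallyDisconnected := isTotallyDisconnected_closure_orbitMinimalSet hβ.1

end

section

variable {β x y : ℝ} {s s' : ℕ → Bool}

/-! ### Series with binary digits -/

/-- The number `∑ s n x ^ (n + 1)` with binary digits `s n`; a `β`-expansion is evaluated at
`x = 1 / β`. -/
noncomputable def digitSeries (s : ℕ → Bool) (x : ℝ) : ℝ := ∑' n, ((s n).toNat : ℝ) * x ^ (n + 1)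

/-- The number of digits `1` among the first `n` digits. -/
def prefixCount (s : ℕ → Bool) (n : ℕ) : ℕ := ∑ i ∈ Finset.range n, (s i).toNat

theorem prefixCount_succ (s : ℕ → Bool) (n : ℕ) :
    prefixCount s (n + 1) = prefixCount s n + (s n).toNat := Finset.sum_range_succ _ _

theorem prefixCount_add (s : ℕ → Bool) (m n : ℕ) :
    prefixCount s (m + n) = prefixCount s m + prefixCount (fun i => s (m + i)) n :=
  Finset.sum_range_add _ _ _

theorem eq_of_prefixCount_eq (h : ∀ n, prefixCount s n = prefixCount s' n) : s = s' := by
  funext n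
  have h1 := h (n + 1)
  rw [prefixCount_succ, prefixCount_succ, h n] at h1
  cases hs : s n <;> cases hs' : s' n <;> simp [hs, hs'] at h1 ⊢

theorem toNat_cast_mem_Icc (b : Bool) : ((b.toNat : ℕ) : ℝ) ∈ Icc (0 : ℝ) 1 := by
  cases b <;> simp

theorem summable_digitSeries (s : ℕ → Bool) (hx : x ∈ Ico (0 : ℝ) 1) :
    Summable fun n => ((s n).toNat : ℝ) * x ^ (n + 1) := by
  refine Summable.of_nonneg_of_le (fun n => ?_) (fun n => ?_)
    ((summable_geometric_of_lt_one hx.1 hx.2).comp_injective (add_left_injective 1))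
  · exact mul_nonneg (toNat_cast_mem_Icc _).1 (pow_nonneg hx.1 _)
  · exact mul_le_of_le_one_left (pow_nonneg hx.1 _) (toNat_cast_mem_Icc _).2

theorem digitSeries_eq (s : ℕ → Bool) (hx : x ∈ Ico (0 : ℝ) 1) :
    digitSeries s x = x * ((s 0).toNat + digitSeries (fun n => s (n + 1)) x) := by
  rw [digitSeries, (summable_digitSeries s hx).tsum_eq_zero_add, digitSeries, mul_add,
    ← tsum_mul_left]
  congr 1
  · ring
  · exact tsum_congr fun n => by ring

theorem digitSeries_nonneg (s : ℕ → Bool) (hx : 0 ≤ x) : 0 ≤ digitSeries s x :=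
  tsum_nonneg fun _ => mul_nonneg (toNat_cast_mem_Icc _).1 (pow_nonneg hx _)

theorem digitSeries_le (s : ℕ → Bool) (hx : x ∈ Ico (0 : ℝ) 1) :
    digitSeries s x ≤ x / (1 - x) := by
  have hgeo : ∑' n : ℕ, x ^ (n + 1) = x / (1 - x) := by
    simp_rw [pow_succ]
    rw [tsum_mul_right, tsum_geometric_of_lt_one hx.1 hx.2]
    ring
  rw [← hgeo]
  refine (summable_digitSeries s hx).tsum_le_tsum (fun n => ?_)
    ((summable_geometric_of_lt_one hx.1 hx.2).comp_injective (add_left_injective 1))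
  exact mul_le_of_le_one_left (pow_nonneg hx.1 _) (toNat_cast_mem_Icc _).2

theorem eq_digitSeries (hx : x ∈ Ico (0 : ℝ) 1) {y : ℕ → ℝ} (hy : ∀ n, y n ∈ Icc (0 : ℝ) 1)
    (h : ∀ n, y n = x * ((s n).toNat + y (n + 1))) : y 0 = digitSeries s x := by
  have hiter (n : ℕ) :
      y 0 - digitSeries s x = x ^ n * (y n - digitSeries (fun i => s (n + i)) x) := by
    induction n with
    | zero => simp
    | succ n ih =>
      rw [ih, h n, digitSeries_eq _ hx, add_zero]
      simp only [← add_assoc, add_right_comm n _ 1]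
      ring
  have hlim : Tendsto (fun n : ℕ => x ^ n * (1 + x / (1 - x))) atTop (𝓝 0) := by
    simpa using (tendsto_pow_atTop_nhds_zero_of_lt_one hx.1 hx.2).mul_const (1 + x / (1 - x))
  rw [← sub_eq_zero]
  refine abs_nonpos_iff.1 (ge_of_tendsto' hlim fun n => ?_)
  rw [hiter n, abs_mul, abs_of_nonneg (pow_nonneg hx.1 n)]
  refine mul_le_mul_of_nonneg_left ?_ (pow_nonneg hx.1 n)
  have h1 := digitSeries_nonneg (fun i => s (n + i)) hx.1
  have h2 := digitSeries_le (fun i => s (n + i)) hx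
  rw [abs_le]
  constructor <;> linarith [(hy n).1, (hy n).2]

/-- Summation by parts, with the decreasing weights `x ^ (n + 1)`. -/
theorem pow_mul_prefixCount_sub_le (hx : x ∈ Icc (0 : ℝ) 1)
    (h : ∀ n, prefixCount s n ≤ prefixCount s' n) (n : ℕ) :
    x ^ n * ((prefixCount s' n : ℝ) - prefixCount s n) ≤
      ∑ i ∈ Finset.range n, ((s' i).toNat : ℝ) * x ^ (i + 1) -
        ∑ i ∈ Finset.range n, ((s i).toNat : ℝ) * x ^ (i + 1) := by
  induction n with
  | zero => simp [prefixCount]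
  | succ n ih =>
    rw [Finset.sum_range_succ, Finset.sum_range_succ, prefixCount_succ, prefixCount_succ]
    push_cast
    have hle : x ^ (n + 1) * ((prefixCount s' n : ℝ) - prefixCount s n) ≤
        x ^ n * ((prefixCount s' n : ℝ) - prefixCount s n) :=
      mul_le_mul_of_nonneg_right (pow_le_pow_of_le_one hx.1 hx.2 n.le_succ)
        (sub_nonneg.2 (by exact_mod_cast h n))
    linear_combination hle + ih

theorem digitSeries_le_of_prefixCount_le (hx : x ∈ Ico (0 : ℝ) 1)
    (h : ∀ n, prefixCount s n ≤ prefixCount s' n) : digitSeries s x ≤ digitSeries s' x := by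
  refine le_of_tendsto_of_tendsto' (summable_digitSeries s hx).hasSum.tendsto_sum_nat
    (summable_digitSeries s' hx).hasSum.tendsto_sum_nat fun n => sub_nonneg.1 ?_
  refine le_trans ?_ (pow_mul_prefixCount_sub_le (Ico_subset_Icc_self hx) h n)
  exact mul_nonneg (pow_nonneg hx.1 n) (sub_nonneg.2 (by exact_mod_cast h n))

theorem digitSeries_mono (s : ℕ → Bool) (hx : 0 ≤ x) (hxy : x ≤ y) (hy : y < 1) :
    digitSeries s x ≤ digitSeries s y :=
  (summable_digitSeries s ⟨hx, hxy.trans_lt hy⟩).tsum_le_tsum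
    (fun _ => mul_le_mul_of_nonneg_left (pow_le_pow_left₀ hx hxy _) (toNat_cast_mem_Icc _).1)
    (summable_digitSeries s ⟨hx.trans hxy, hy⟩)

theorem digitSeries_strictMono {m : ℕ} (hs : s m = true) (hx : 0 ≤ x) (hxy : x < y) (hy : y < 1) :
    digitSeries s x < digitSeries s y := by
  refine Summable.tsum_lt_tsum (i := m) (fun n => ?_) ?_
    (summable_digitSeries s ⟨hx, hxy.trans hy⟩) (summable_digitSeries s ⟨hx.trans hxy.le, hy⟩)
  · exact mul_le_mul_of_nonneg_left (pow_le_pow_left₀ hx hxy.le _) (toNat_cast_mem_Icc _).1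
  · rw [hs]
    simpa using pow_lt_pow_left₀ hxy hx (Nat.succ_ne_zero m)

theorem one_div_mem_Ico (hβ : 1 < β) : 1 / β ∈ Ico (0 : ℝ) 1 :=
  ⟨by positivity, one_div_lt_one_of_one_lt hβ⟩

theorem mul_digitSeries_one_div (hβ : 1 < β) (s : ℕ → Bool) :
    β * digitSeries s (1 / β) = (s 0).toNat + digitSeries (fun n => s (n + 1)) (1 / β) := by
  rw [digitSeries_eq s (one_div_mem_Ico hβ), ← mul_assoc,
    mul_one_div_cancel (zero_lt_one.trans hβ).ne', one_mul]

/-! ### Itineraries -/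

/-- The digits of `x` under the map `x ↦ β x (mod 1)`, for `β ≤ 2`. -/
noncomputable def itinerary (β x : ℝ) : ℕ → Bool := fun n => decide (1 / β ≤ (betaMap β)^[n] x)

theorem itinerary_add (β x : ℝ) (m : ℕ) :
    (fun i => itinerary β x (m + i)) = itinerary β ((betaMap β)^[m] x) := by
  funext i
  rw [itinerary, itinerary, ← Function.iterate_add_apply, add_comm]

theorem betaMap_eq_sub_toNat (hβ : β ∈ Ioo (1 : ℝ) 2) (hx : x ∈ Ico (0 : ℝ) 1) :
    betaMap β x = β * x - (decide (1 / β ≤ x)).toNat := by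
  rcases lt_or_ge x (1 / β) with h | h
  · rw [betaMap_of_lt (zero_lt_one.trans hβ.1) hx.1 h, decide_eq_false (not_le.2 h)]
    simp
  · rw [betaMap_of_le hβ h hx.2.le, decide_eq_true h]
    simp

theorem eq_digitSeries_itinerary (hβ : β ∈ Ioo (1 : ℝ) 2) (hx : x ∈ Ico (0 : ℝ) 1) :
    x = digitSeries (itinerary β x) (1 / β) := by
  refine eq_digitSeries (one_div_mem_Ico hβ.1) (y := fun n => (betaMap β)^[n] x)
    (fun n => Ico_subset_Icc_self (iterate_betaMap_mem_Ico hx n)) fun n => ?_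
  have hβ0 : β ≠ 0 := (zero_lt_one.trans hβ.1).ne'
  simp only [Function.iterate_succ_apply', itinerary,
    betaMap_eq_sub_toNat hβ (iterate_betaMap_mem_Ico hx n)]
  field_simp
  ring

/-- The two branches over `[1 - 1/β, 1)` have the disjoint images `[β - 1, 1)` and
`[0, β - 1)`, in this order, so that the map preserves the cyclic order of orbits which stay in
`[1 - 1/β, 1)`. -/
theorem betaMap_lt_or_lt (hβ : β ∈ Ioo (1 : ℝ) 2) (hx : x ∈ Ico (1 - 1 / β) 1)
    (hy : y ∈ Ico (1 - 1 / β) 1) (hxy : x < y) :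
    ((decide (1 / β ≤ y)).toNat = (decide (1 / β ≤ x)).toNat ∧ betaMap β x < betaMap β y) ∨
    ((decide (1 / β ≤ y)).toNat = (decide (1 / β ≤ x)).toNat + 1 ∧ betaMap β y < betaMap β x) := by
  have hβ0 : 0 < β := zero_lt_one.trans hβ.1
  have h0 := (one_sub_one_div_pos hβ.1).le
  have hlt : β * x < β * y := mul_lt_mul_of_pos_left hxy hβ0
  rw [betaMap_eq_sub_toNat hβ ⟨h0.trans hx.1, hx.2⟩, betaMap_eq_sub_toNat hβ ⟨h0.trans hy.1, hy.2⟩]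
  rcases lt_or_ge x (1 / β) with h1 | h1 <;> rcases lt_or_ge y (1 / β) with h2 | h2
  · simp only [decide_eq_false (not_le.2 h1), decide_eq_false (not_le.2 h2)]
    exact Or.inl ⟨trivial, by linarith⟩
  · simp only [decide_eq_false (not_le.2 h1), decide_eq_true h2]
    refine Or.inr ⟨rfl, ?_⟩
    have hx' : β - 1 ≤ β * x := by
      rw [← mul_one_sub_one_div hβ0.ne']
      exact mul_le_mul_of_nonneg_left hx.1 hβ0.le
    have hy' : β * y < β * 1 := mul_lt_mul_of_pos_left hy.2 hβ0
    simp only [Bool.toNat_true, Bool.toNat_false, Nat.cast_one, Nat.cast_zero]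
    linarith
  · linarith
  · simp only [decide_eq_true h1, decide_eq_true h2]
    exact Or.inl ⟨trivial, by linarith⟩

theorem prefixCount_itinerary_or (hβ : β ∈ Ioo (1 : ℝ) 2)
    (hx : x ∈ forwardSet β (1 - 1 / β)) (hy : y ∈ forwardSet β (1 - 1 / β)) (hxy : x ≤ y) (n : ℕ) :
    (prefixCount (itinerary β y) n = prefixCount (itinerary β x) n ∧
      (betaMap β)^[n] x ≤ (betaMap β)^[n] y) ∨
    (prefixCount (itinerary β y) n = prefixCount (itinerary β x) n + 1 ∧
      (betaMap β)^[n] y < (betaMap β)^[n] x) := by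
  induction n with
  | zero => exact Or.inl ⟨rfl, hxy⟩
  | succ n ih =>
    simp only [prefixCount_succ, Function.iterate_succ_apply']
    rcases ih with ⟨hcount, hle⟩ | ⟨hcount, hlt⟩
    · rcases hle.eq_or_lt with heq | hlt
      · simp [itinerary, hcount, heq]
      · rcases betaMap_lt_or_lt hβ (hx n) (hy n) hlt with ⟨hd, hT⟩ | ⟨hd, hT⟩
        · exact Or.inl ⟨by simp only [itinerary]; omega, hT.le⟩
        · exact Or.inr ⟨by simp only [itinerary]; omega, hT⟩
    · rcases betaMap_lt_or_lt hβ (hy n) (hx n) hlt with ⟨hd, hT⟩ | ⟨hd, hT⟩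
      · exact Or.inr ⟨by simp only [itinerary]; omega, hT⟩
      · exact Or.inl ⟨by simp only [itinerary]; omega, hT.le⟩

theorem prefixCount_itinerary_add (β x : ℝ) (m n : ℕ) :
    prefixCount (itinerary β x) (m + n) =
      prefixCount (itinerary β x) m + prefixCount (itinerary β ((betaMap β)^[m] x)) n := by
  rw [prefixCount_add, itinerary_add]

theorem mem_forwardSet_one_sub_one_div_of_le (hxE : x ∈ orbitMinimalSet β) (hx : 1 - 1 / β ≤ x) :
    x ∈ forwardSet β (1 - 1 / β) :=
  forwardSet_anti hx (mem_forwardSet_of_mem_orbitMinimalSet hxE)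

theorem prefixCount_add_bounds (hβ : β ∈ Ioo (1 : ℝ) 2) (hxE : x ∈ orbitMinimalSet β)
    (hx : 1 - 1 / β ≤ x) (m n : ℕ) :
    prefixCount (itinerary β x) m + prefixCount (itinerary β x) n ≤
      prefixCount (itinerary β x) (m + n) ∧
    prefixCount (itinerary β x) (m + n) ≤
      prefixCount (itinerary β x) m + prefixCount (itinerary β x) n + 1 := by
  have hf := mem_forwardSet_one_sub_one_div_of_le hxE hx
  have := prefixCount_itinerary_or hβ hf (iterate_mem_forwardSet hf m) (hxE.2 m) n
  rw [prefixCount_itinerary_add]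
  omega

theorem prefixCount_mul_bounds (hβ : β ∈ Ioo (1 : ℝ) 2) (hxE : x ∈ orbitMinimalSet β)
    (hx : 1 - 1 / β ≤ x) (j n : ℕ) :
    (n + 1) * prefixCount (itinerary β x) j ≤ prefixCount (itinerary β x) ((n + 1) * j) ∧
    prefixCount (itinerary β x) ((n + 1) * j) ≤ (n + 1) * prefixCount (itinerary β x) j + n := by
  induction n with
  | zero => simp
  | succ n ih =>
    have h := prefixCount_add_bounds hβ hxE hx ((n + 1) * j) j
    rw [add_one_mul (n + 1) j, add_one_mul (n + 1) (prefixCount (itinerary β x) j)]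
    omega

end

section

variable {β x y : ℝ} {k q r : ℕ}

/-! ### Rotations -/

/-- The digits of the rotation `r ↦ r + k (mod q)`: a digit is `1` when the rotation wraps. -/
def rankSeq (k q r : ℕ) : ℕ → Bool := fun j => decide (q ≤ (r + j * k) % q + k)

/-- The number in base `β` whose digits are those of the rotation by `k (mod q)` started at `r`.
It is the point of rank `r` in an orbit of `q` points that is ordered like the rotation. -/
noncomputable def rankValue (β : ℝ) (k q r : ℕ) : ℝ := digitSeries (rankSeq k q r) (1 / β)

theorem rankSeq_eq_rankSeq_zero (k q r n : ℕ) : rankSeq k q r n = rankSeq k q (r + n * k) 0 := by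
  simp only [rankSeq, zero_mul, add_zero]

theorem rankSeq_add (k q r n : ℕ) :
    (fun i => rankSeq k q r (n + i)) = rankSeq k q (r + n * k) := by
  funext i
  simp only [rankSeq, add_mul, add_assoc]

theorem rankSeq_mod (k q r : ℕ) : rankSeq k q (r % q) = rankSeq k q r := by
  funext i
  simp only [rankSeq, Nat.mod_add_mod]

theorem rankSeq_periodic (k q r : ℕ) : Function.Periodic (rankSeq k q r) q := fun n => by
  simp only [rankSeq, add_mul, ← add_assoc, Nat.add_mul_mod_self_left]

theorem rankValue_mod (β : ℝ) (k q r : ℕ) : rankValue β k q (r % q) = rankValue β k q r := by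
  rw [rankValue, rankSeq_mod, rankValue]

theorem prefixCount_rankSeq (hk : k < q) (r n : ℕ) :
    r / q + prefixCount (rankSeq k q r) n = (r + n * k) / q := by
  induction n with
  | zero => simp [prefixCount]
  | succ n ih =>
    rw [prefixCount_succ, ← add_assoc, ih, add_one_mul, ← add_assoc,
      Nat.add_div (a := r + n * k) (b := k) (by omega), Nat.div_eq_of_lt hk, Nat.mod_eq_of_lt hk,
      rankSeq, add_zero]
    by_cases h : q ≤ (r + n * k) % q + k <;> simp [h]

theorem prefixCount_rankSeq_zero (hk : k < q) (n : ℕ) :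
    prefixCount (rankSeq k q 0) n = n * k / q := by
  simpa using prefixCount_rankSeq hk 0 n

theorem rankValue_mono (hβ : 1 < β) (hk : k < q) {r' : ℕ} (hr : r ≤ r') (hr' : r' < q) :
    rankValue β k q r ≤ rankValue β k q r' := by
  refine digitSeries_le_of_prefixCount_le (one_div_mem_Ico hβ) fun n => ?_
  have h1 := prefixCount_rankSeq hk r n
  have h2 := prefixCount_rankSeq hk r' n
  rw [Nat.div_eq_of_lt (hr.trans_lt hr'), zero_add] at h1
  rw [Nat.div_eq_of_lt hr', zero_add] at h2
  rw [h1, h2]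
  gcongr

theorem rankValue_mem_Icc (hβ : 1 < β) (hk : k < q) (r : ℕ) :
    rankValue β k q r ∈ Icc (rankValue β k q 0) (rankValue β k q (q - 1)) := by
  have hr := Nat.mod_lt r (by omega : 0 < q)
  rw [← rankValue_mod β k q r]
  exact ⟨rankValue_mono hβ hk (Nat.zero_le _) hr, rankValue_mono hβ hk (by omega) (by omega)⟩

theorem mul_rankValue (hβ : 1 < β) (k q r : ℕ) :
    β * rankValue β k q r = (rankSeq k q r 0).toNat + rankValue β k q (r + k) := by
  have hshift := rankSeq_add k q r 1
  rw [one_mul] at hshift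
  rw [rankValue, mul_digitSeries_one_div hβ, rankValue, ← hshift]
  simp only [add_comm]

theorem mul_mod_pos {j : ℕ} (hcop : k.Coprime q) (hj : 0 < j) (hjq : j < q) : 0 < j * k % q :=
  Nat.pos_of_ne_zero fun h0 => absurd
    (Nat.le_of_dvd hj (hcop.symm.dvd_of_dvd_mul_right (Nat.dvd_of_mod_eq_zero h0))) (not_le.2 hjq)

theorem pred_add_mul_mod {j : ℕ} (hcop : k.Coprime q) (hj : 0 < j) (hjq : j < q) :
    (q - 1 + j * k) % q = j * k % q - 1 := by
  have hpos := mul_mod_pos hcop hj hjq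
  have hdiv := Nat.div_add_mod (j * k) q
  have hlt := Nat.mod_lt (j * k) (hj.trans hjq)
  have hsum : q - 1 + j * k = (j * k % q - 1) + q * (j * k / q + 1) := by
    rw [mul_add, mul_one]; omega
  rw [hsum, Nat.add_mul_mod_self_left, Nat.mod_eq_of_lt (by omega)]

theorem pred_mul_mod (hk0 : 0 < k) (hk : k < q) : (q - 1) * k % q = q - k := by
  have h : (q - 1) * k = (q - k) + q * (k - 1) := by
    zify [hk.pos, hk.le, Nat.one_le_of_lt hk0]
    ring
  rw [h, Nat.add_mul_mod_self_left, Nat.mod_eq_of_lt (by omega)]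

theorem rankSeq_zero_zero (hk : k < q) : rankSeq k q 0 0 = false := by
  rw [rankSeq, zero_mul, add_zero, Nat.zero_mod]
  exact decide_eq_false (by omega)

theorem rankSeq_zero_pred (hk0 : 0 < k) (hk : k < q) : rankSeq k q 0 (q - 1) = true := by
  rw [rankSeq, zero_add, pred_mul_mod hk0 hk]
  exact decide_eq_true (by omega)

theorem rankSeq_pred_zero (hk0 : 0 < k) (hk : k < q) : rankSeq k q (q - 1) 0 = true := by
  rw [rankSeq, zero_mul, add_zero, Nat.mod_eq_of_lt (by omega)]
  exact decide_eq_true (by omega)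

theorem rankSeq_pred_pred (hk0 : 0 < k) (hk : k < q) (hcop : k.Coprime q) :
    rankSeq k q (q - 1) (q - 1) = false := by
  rw [rankSeq, pred_add_mul_mod hcop (by omega) (by omega), pred_mul_mod hk0 hk]
  exact decide_eq_false (by omega)

theorem rankSeq_pred_eq {j : ℕ} (hk : k < q) (hcop : k.Coprime q) (hj : 0 < j)
    (hjq : j + 1 < q) : rankSeq k q (q - 1) j = rankSeq k q 0 j := by
  have hpos := mul_mod_pos hcop hj (by omega)
  have hne : j * k % q + k ≠ q := by
    intro h
    have hpos' := mul_mod_pos hcop (Nat.succ_pos j) hjq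
    rw [Nat.succ_mul, Nat.add_mod, Nat.mod_eq_of_lt hk, h, Nat.mod_self] at hpos'
    exact hpos'.false
  rw [rankSeq, rankSeq, pred_add_mul_mod hcop hj (by omega), zero_add]
  exact decide_eq_decide.2 (by omega)

theorem digitSeries_mul_one_sub_pow {s : ℕ → Bool} (hs : Function.Periodic s q)
    (hx : x ∈ Ico (0 : ℝ) 1) :
    digitSeries s x * (1 - x ^ q) = ∑ i ∈ Finset.range q, ((s i).toNat : ℝ) * x ^ (i + 1) := by
  have htail : ∑' i, ((s (i + q)).toNat : ℝ) * x ^ (i + q + 1) = x ^ q * digitSeries s x := by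
    rw [digitSeries, ← tsum_mul_left]
    exact tsum_congr fun i => by rw [hs i]; ring
  have hsplit := (summable_digitSeries s hx).sum_add_tsum_nat_add q
  rw [htail, ← digitSeries] at hsplit
  linear_combination -hsplit

/-- The digits of the largest and of the smallest point of the orbit differ only at the two ends
of the period. -/
theorem rankValue_pred_sub_rankValue_zero (hβ : 1 < β) (hk0 : 0 < k) (hk : k < q)
    (hcop : k.Coprime q) :
    (rankValue β k q (q - 1) - rankValue β k q 0) * (1 - (1 / β) ^ q) = 1 / β - (1 / β) ^ q := by
  have htop_last := rankSeq_pred_pred hk0 hk hcop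
  have hbot_last := rankSeq_zero_pred hk0 hk
  rw [sub_mul, rankValue, rankValue,
    digitSeries_mul_one_sub_pow (rankSeq_periodic k q (q - 1)) (one_div_mem_Ico hβ),
    digitSeries_mul_one_sub_pow (rankSeq_periodic k q 0) (one_div_mem_Ico hβ),
    ← Finset.sum_sub_distrib]
  obtain ⟨n, rfl⟩ : ∃ n, q = n + 2 := ⟨q - 2, by omega⟩
  have hmiddle : ∀ i ∈ Finset.range n,
      ((rankSeq k (n + 2) (n + 2 - 1) (i + 1)).toNat : ℝ) * (1 / β) ^ (i + 1 + 1) -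
        ((rankSeq k (n + 2) 0 (i + 1)).toNat : ℝ) * (1 / β) ^ (i + 1 + 1) = 0 := fun i hi => by
    rw [rankSeq_pred_eq hk hcop i.succ_pos (by have := Finset.mem_range.1 hi; omega), sub_self]
  rw [Finset.sum_range_succ, Finset.sum_range_succ', Finset.sum_eq_zero hmiddle,
    rankSeq_pred_zero hk0 hk, rankSeq_zero_zero hk, show n + 1 = n + 2 - 1 from rfl, htop_last,
    hbot_last]
  simp
  ring

/-- The rotation by `k (mod q)` is realized in base `β` inside `[1 - 1/β, 1)`: the numbers
`rankValue β k q r` lie there, and are therefore a periodic orbit of the map. -/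
structure RealizesRotation (β : ℝ) (k q : ℕ) : Prop where
  pos : 0 < k
  lt : k < q
  coprime : k.Coprime q
  one_sub_one_div_le : 1 - 1 / β ≤ rankValue β k q 0
  lt_one : rankValue β k q (q - 1) < 1

namespace RealizesRotation

theorem rankValue_mem_Ico (h : RealizesRotation β k q) (hβ : 1 < β) (r : ℕ) :
    rankValue β k q r ∈ Ico (1 - 1 / β) 1 :=
  ⟨h.one_sub_one_div_le.trans (rankValue_mem_Icc hβ h.lt r).1,
    (rankValue_mem_Icc hβ h.lt r).2.trans_lt h.lt_one⟩

theorem rankValue_mem_Ico_zero_one (h : RealizesRotation β k q) (hβ : 1 < β) (r : ℕ) :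
    rankValue β k q r ∈ Ico (0 : ℝ) 1 :=
  Ico_subset_Ico_left (one_sub_one_div_pos hβ).le (h.rankValue_mem_Ico hβ r)

theorem betaMap_rankValue (h : RealizesRotation β k q) (hβ : 1 < β) (r : ℕ) :
    betaMap β (rankValue β k q r) = rankValue β k q (r + k) := by
  refine betaMap_eq_of_eq_add (rankSeq k q r 0).toNat (h.rankValue_mem_Ico_zero_one hβ _) ?_
  rw [mul_rankValue hβ]
  simp

theorem iterate_rankValue (h : RealizesRotation β k q) (hβ : 1 < β) (r n : ℕ) :
    (betaMap β)^[n] (rankValue β k q r) = rankValue β k q (r + n * k) := by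
  induction n with
  | zero => simp
  | succ n ih =>
    rw [Function.iterate_succ_apply', ih, h.betaMap_rankValue hβ, add_one_mul, add_assoc]

theorem isPeriodicPt_rankValue (h : RealizesRotation β k q) (hβ : 1 < β) (r : ℕ) :
    Function.IsPeriodicPt (betaMap β) q (rankValue β k q r) := by
  rw [Function.IsPeriodicPt, Function.IsFixedPt, h.iterate_rankValue hβ, ← rankValue_mod,
    Nat.add_mul_mod_self_left, rankValue_mod]

theorem rankValue_mem_forwardSet (h : RealizesRotation β k q) (hβ : 1 < β) (r : ℕ) :
    rankValue β k q r ∈ forwardSet β (1 - 1 / β) := fun n => by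
  rw [h.iterate_rankValue hβ]
  exact h.rankValue_mem_Ico hβ _

theorem hasPeriodicAbove (h : RealizesRotation β k q) (hβ : 1 < β) : HasPeriodicAbove β :=
  ⟨_, h.rankValue_mem_forwardSet hβ 0, q, h.pos.trans h.lt, h.isPeriodicPt_rankValue hβ 0⟩

theorem rankValue_zero_mem_orbitMinimalSet (h : RealizesRotation β k q) (hβ : 1 < β) :
    rankValue β k q 0 ∈ orbitMinimalSet β :=
  ⟨h.rankValue_mem_Ico_zero_one hβ 0, fun n => by
    rw [h.iterate_rankValue hβ]
    exact (rankValue_mem_Icc hβ h.lt _).1⟩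

theorem itinerary_rankValue (h : RealizesRotation β k q) (hβ : 1 < β) (r : ℕ) :
    itinerary β (rankValue β k q r) = rankSeq k q r := by
  have hβ0 : 0 < β := zero_lt_one.trans hβ
  funext n
  have hmul := mul_rankValue hβ k q (r + n * k)
  have hmem := h.rankValue_mem_Ico_zero_one hβ (r + n * k + k)
  rw [itinerary, h.iterate_rankValue hβ, rankSeq_eq_rankSeq_zero]
  cases hd : rankSeq k q (r + n * k) 0
  · rw [hd, Bool.toNat_false, Nat.cast_zero, zero_add] at hmul
    rw [decide_eq_false_iff_not, not_le, lt_div_iff₀ hβ0, mul_comm, hmul]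
    exact hmem.2
  · rw [hd, Bool.toNat_true, Nat.cast_one] at hmul
    rw [decide_eq_true_iff, div_le_iff₀ hβ0, mul_comm, hmul]
    linarith [hmem.1]

/-- The left end point of the branch of the `q`-th iterate that contains the orbit minimum. -/
noncomputable def lowerEnd (β : ℝ) (k q : ℕ) : ℝ := rankValue β k q 0 * (1 - (1 / β) ^ q)

theorem one_div_pow_lt_one (h : RealizesRotation β k q) (hβ : 1 < β) : (1 / β) ^ q < 1 :=
  pow_lt_one₀ (one_div_mem_Ico hβ).1 (one_div_mem_Ico hβ).2 (h.pos.trans h.lt).ne'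

theorem lowerEnd_lt_one_sub_one_div (h : RealizesRotation β k q) (hβ : 1 < β) :
    lowerEnd β k q < 1 - 1 / β := by
  have hgap := rankValue_pred_sub_rankValue_zero hβ h.pos h.lt h.coprime
  have := mul_lt_mul_of_pos_right h.lt_one (sub_pos.2 (h.one_div_pow_lt_one hβ))
  rw [lowerEnd]
  linarith

theorem lowerEnd_pos (h : RealizesRotation β k q) (hβ : 1 < β) : 0 < lowerEnd β k q :=
  mul_pos ((one_sub_one_div_pos hβ).trans_le h.one_sub_one_div_le)
    (sub_pos.2 (h.one_div_pow_lt_one hβ))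

theorem iterate_eq_of_mem_Icc (h : RealizesRotation β k q) (hβ : 1 < β)
    (hy : y ∈ Icc (lowerEnd β k q) (rankValue β k q 0)) :
    (betaMap β)^[q] y = rankValue β k q 0 - β ^ q * (rankValue β k q 0 - y) := by
  have hβ0 : 0 < β := zero_lt_one.trans hβ
  set μ := rankValue β k q 0
  have hη : μ - y ≤ μ * (1 / β) ^ q := by linarith [hy.1, show lowerEnd β k q = μ * _ from rfl]
  have hη0 : 0 ≤ μ - y := sub_nonneg.2 hy.2
  have hpow (j : ℕ) (hj : j ≤ q) : β ^ j * (μ - y) ≤ μ := by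
    calc β ^ j * (μ - y) ≤ β ^ q * (μ * (1 / β) ^ q) := by
          have : β ^ j ≤ β ^ q := pow_le_pow_right₀ hβ.le hj
          gcongr
      _ = μ := by
          rw [mul_left_comm, ← mul_pow, mul_one_div_cancel hβ0.ne', one_pow, mul_one]
  have hbranch : ∀ j ≤ q, (betaMap β)^[j] μ + β ^ j * (y - μ) ∈ Ico (0 : ℝ) 1 := fun j hj => by
    have hmin := (h.rankValue_zero_mem_orbitMinimalSet hβ).2 j
    have hlt := (h.rankValue_mem_forwardSet hβ 0 j).2
    have hnonneg : 0 ≤ β ^ j * (μ - y) := by positivity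
    exact ⟨by linarith [hpow j hj], by linarith⟩
  have key := iterate_betaMap_add hbranch q le_rfl
  rw [add_sub_cancel, (h.isPeriodicPt_rankValue hβ 0).eq] at key
  linarith

/-- Below the orbit minimum, the `q`-th iterate moves points away from it until they fall below
`lowerEnd β k q`. -/
theorem rankValue_zero_le_of_mem_forwardSet (h : RealizesRotation β k q) (hβ : 1 < β)
    (hx : x ∈ forwardSet β (lowerEnd β k q)) : rankValue β k q 0 ≤ x := by
  by_contra! hlt
  set μ := rankValue β k q 0
  have hall (n : ℕ) : (betaMap β)^[q * n] x = μ - (β ^ q) ^ n * (μ - x) := by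
    induction n with
    | zero => simp
    | succ n ih =>
      have hle : (betaMap β)^[q * n] x ≤ μ := by
        have : 0 ≤ (β ^ q) ^ n * (μ - x) :=
          mul_nonneg (pow_nonneg (pow_nonneg (zero_le_one.trans hβ.le) q) n) (sub_nonneg.2 hlt.le)
        linarith
      rw [mul_add_one, add_comm, Function.iterate_add_apply,
        h.iterate_eq_of_mem_Icc hβ ⟨(hx (q * n)).1, hle⟩, ih]
      ring
  obtain ⟨n, hn⟩ := pow_unbounded_of_one_lt (1 / (μ - x))
    (one_lt_pow₀ hβ (h.pos.trans h.lt).ne')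
  rw [div_lt_iff₀ (by linarith)] at hn
  have hge := (hx (q * n)).1
  rw [hall n] at hge
  linarith [h.lowerEnd_pos hβ, (h.rankValue_mem_Ico hβ 0).2]

theorem dimH_survivorSet_lowerEnd (h : RealizesRotation β k q) (hβ : β ∈ Ioo (1 : ℝ) 2) :
    dimH (survivorSet β (lowerEnd β k q)) = 0 := by
  rw [dimH_survivorSet (zero_lt_one.trans hβ.1).ne' (h.lowerEnd_pos hβ.1).le]
  refine le_antisymm ?_ zero_le
  rw [← dimH_survivorSet_one_sub_one_div hβ]
  refine dimH_mono fun x hx =>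
    forwardSet_subset_survivorSet (one_sub_one_div_pos hβ.1).le fun n => ?_
  exact ⟨h.one_sub_one_div_le.trans
    (h.rankValue_zero_le_of_mem_forwardSet hβ.1 (iterate_mem_forwardSet hx n)), (hx n).2⟩

theorem criticalValue_lt (h : RealizesRotation β k q) (hβ : β ∈ Ioo (1 : ℝ) 2) {τ : ℝ}
    (hτ : IsCriticalValue β τ) : τ < 1 - 1 / β := by
  have hlt := h.lowerEnd_lt_one_sub_one_div hβ.1
  have hlt1 := one_sub_one_div_lt_one (zero_lt_one.trans hβ.1)
  refine lt_of_le_of_lt (not_lt.1 fun hlt' => ?_) hlt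
  have hpos := (hτ _ ⟨(h.lowerEnd_pos hβ.1).le, hlt.trans hlt1⟩).2 hlt'
  exact hpos.ne' (h.dimH_survivorSet_lowerEnd hβ)

end RealizesRotation

theorem itinerary_eq_rankSeq_of_prefixCount (hk : k < q)
    (h : ∀ n, prefixCount (itinerary β x) n = n * k / q) : itinerary β x = rankSeq k q 0 :=
  eq_of_prefixCount_eq fun n => by rw [h n, prefixCount_rankSeq_zero hk]

theorem eq_rankValue_of_itinerary_eq (hβ : β ∈ Ioo (1 : ℝ) 2) (hx : x ∈ Ico (0 : ℝ) 1)
    (h : itinerary β x = rankSeq k q r) : x = rankValue β k q r := by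
  rw [rankValue, ← h]
  exact eq_digitSeries_itinerary hβ hx

namespace RealizesRotation

theorem eq_of_mem_orbitMinimalSet (h : RealizesRotation β k q) (hβ : β ∈ Ioo (1 : ℝ) 2)
    (hx : x ∈ orbitMinimalSet β) (hlt : lowerEnd β k q ≤ x) : x = rankValue β k q 0 := by
  have hμx := h.rankValue_zero_le_of_mem_forwardSet hβ.1
    (forwardSet_anti hlt (mem_forwardSet_of_mem_orbitMinimalSet hx))
  have hcx := h.one_sub_one_div_le.trans hμx
  have hcmp := prefixCount_itinerary_or hβ (h.rankValue_mem_forwardSet hβ.1 0)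
    (mem_forwardSet_one_sub_one_div_of_le hx hcx) hμx
  rw [h.itinerary_rankValue hβ.1] at hcmp
  simp only [prefixCount_rankSeq_zero h.lt] at hcmp
  have hlow (j : ℕ) : j * k / q ≤ prefixCount (itinerary β x) j := by have := hcmp j; omega
  have hupp (j : ℕ) : prefixCount (itinerary β x) j ≤ j * k / q + 1 := by have := hcmp j; omega
  refine eq_rankValue_of_itinerary_eq hβ hx.1 (itinerary_eq_rankSeq_of_prefixCount h.lt fun j =>
    le_antisymm (not_lt.1 fun hgt => ?_) (hlow j))
  have hq : 0 < q := h.pos.trans h.lt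
  have hmul : (q + 1) * (j * k / q + 1) ≤ (q + 1) * j * k / q + 1 :=
    (Nat.mul_le_mul_left _ hgt).trans ((prefixCount_mul_bounds hβ hx hcx j q).1.trans (hupp _))
  have hdiv : (q + 1) * j * k / q * q ≤ (q + 1) * j * k := Nat.div_mul_le_self _ _
  have hlt_mul : j * k < (j * k / q + 1) * q := by
    rw [mul_comm _ q]
    exact Nat.lt_mul_div_succ _ hq
  nlinarith

theorem not_isCantorSet (h : RealizesRotation β k q) (hβ : β ∈ Ioo (1 : ℝ) 2) :
    ¬ IsCantorSet (closure (orbitMinimalSet β)) := by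
  intro hC
  set μ := rankValue β k q 0
  have hlt : lowerEnd β k q < μ :=
    (h.lowerEnd_lt_one_sub_one_div hβ.1).trans_le h.one_sub_one_div_le
  have hacc := hC.perfect.acc μ (subset_closure (h.rankValue_zero_mem_orbitMinimalSet hβ.1))
  obtain ⟨y, ⟨hy, hy_mem⟩, hne⟩ := accPt_iff_nhds.1 hacc _ (Ioi_mem_nhds hlt)
  obtain ⟨w, ⟨hw, hwμ⟩, hwE⟩ := mem_closure_iff.1 hy_mem (Ioi (lowerEnd β k q) ∩ {μ}ᶜ)
    (isOpen_Ioi.inter isOpen_compl_singleton) ⟨hy, hne⟩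
  exact hwμ (h.eq_of_mem_orbitMinimalSet hβ hwE (le_of_lt hw))

end RealizesRotation

/-! ### Periodic orbits in `[1 - 1/β, 1)` are rotations -/

theorem HasPeriodicAbove.exists_mem_orbitMinimalSet (hβ : 1 < β) (hP : HasPeriodicAbove β) :
    ∃ x ∈ orbitMinimalSet β, x ∈ forwardSet β (1 - 1 / β) ∧
      x ∈ Function.periodicPts (betaMap β) := by
  obtain ⟨x₀, hx₀, m, hm, hper⟩ := hP
  obtain ⟨i, -, hmin⟩ := Finset.exists_min_image (Finset.range m) (fun i => (betaMap β)^[i] x₀)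
    ⟨0, Finset.mem_range.2 hm⟩
  have hx := iterate_mem_forwardSet hx₀ i
  refine ⟨(betaMap β)^[i] x₀,
    ⟨⟨(one_sub_one_div_pos hβ).le.trans (hx 0).1, (hx 0).2⟩, fun n => ?_⟩, hx,
    m, hm, hper.apply_iterate i⟩
  rw [← Function.iterate_add_apply, ← hper.iterate_mod_apply (n + i)]
  exact hmin _ (Finset.mem_range.2 (Nat.mod_lt _ hm))

theorem prefixCount_itinerary_mul {m : ℕ} (hx : Function.IsPeriodicPt (betaMap β) m x) (n : ℕ) :
    prefixCount (itinerary β x) (n * m) = n * prefixCount (itinerary β x) m := by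
  induction n with
  | zero => simp [prefixCount]
  | succ n ih => rw [add_one_mul, prefixCount_itinerary_add, ih, (hx.const_mul n).eq, add_one_mul]

theorem prefixCount_itinerary_eq_div {m : ℕ} (hβ : β ∈ Ioo (1 : ℝ) 2) (hm : 0 < m)
    (hxE : x ∈ orbitMinimalSet β) (hx : 1 - 1 / β ≤ x)
    (hper : Function.IsPeriodicPt (betaMap β) m x) (n : ℕ) :
    prefixCount (itinerary β x) n = n * prefixCount (itinerary β x) m / m := by
  have hbounds := prefixCount_mul_bounds hβ hxE hx n (m - 1)
  rw [Nat.sub_add_cancel hm, mul_comm m n, prefixCount_itinerary_mul hper] at hbounds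
  refine (Nat.div_eq_of_lt_le ?_ ?_).symm
  · rw [mul_comm]; exact hbounds.1
  · rw [Nat.succ_mul, mul_comm (prefixCount (itinerary β x) n)]; omega

theorem pos_of_prefixCount_itinerary_eq {p m : ℕ} (hβ : β ∈ Ioo (1 : ℝ) 2)
    (hx : x ∈ Ioo (0 : ℝ) 1) (h : ∀ n, prefixCount (itinerary β x) n = n * p / m) : 0 < p := by
  by_contra! hp
  have hzero : itinerary β x = fun _ => false := eq_of_prefixCount_eq fun n => by
    rw [h n, Nat.le_zero.1 hp]
    simp [prefixCount]
  have hval := eq_digitSeries_itinerary hβ (Ioo_subset_Ico_self hx)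
  simp only [hzero, digitSeries, Bool.toNat_false, Nat.cast_zero, zero_mul, tsum_zero] at hval
  exact hx.1.ne' hval

theorem lt_of_prefixCount_itinerary_eq {p m : ℕ} (hβ : β ∈ Ioo (1 : ℝ) 2) (hm : 0 < m)
    (hx : x ∈ Ico (0 : ℝ) 1) (h : ∀ n, prefixCount (itinerary β x) n = n * p / m) : p < m := by
  by_contra! hp
  have hle (n : ℕ) : prefixCount (fun _ => true) n ≤ prefixCount (itinerary β x) n := by
    rw [h n, Nat.le_div_iff_mul_le hm]
    simpa [prefixCount] using Nat.mul_le_mul_left n hp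
  have hone : 1 = digitSeries (fun _ => true) (1 / 2) :=
    eq_digitSeries (y := fun _ => 1) (by norm_num) (by norm_num) (by norm_num)
  refine hx.2.not_ge ?_
  calc (1 : ℝ) = digitSeries (fun _ => true) (1 / 2) := hone
    _ ≤ digitSeries (fun _ => true) (1 / β) :=
      digitSeries_mono _ (by norm_num)
        (one_div_le_one_div_of_le (zero_lt_one.trans hβ.1) hβ.2.le) (one_div_mem_Ico hβ.1).2
    _ ≤ digitSeries (itinerary β x) (1 / β) :=
      digitSeries_le_of_prefixCount_le (one_div_mem_Ico hβ.1) hle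
    _ = x := (eq_digitSeries_itinerary hβ hx).symm

theorem exists_coprime_mul_div_eq {p m : ℕ} (hp : 0 < p) (hpm : p < m) :
    ∃ k q, 0 < k ∧ k < q ∧ k.Coprime q ∧ ∀ n, n * p / m = n * k / q := by
  have hg := Nat.gcd_pos_of_pos_left m hp
  obtain ⟨k, q, hcop, hk, hq⟩ := Nat.exists_coprime p m
  generalize p.gcd m = g at hg hk hq
  subst hk hq
  exact ⟨k, q, Nat.pos_of_mul_pos_right hp, Nat.lt_of_mul_lt_mul_right hpm, hcop, fun n => by
    rw [← mul_assoc, Nat.mul_div_mul_right _ _ hg]⟩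

theorem exists_iterate_eq_rankValue_pred (hβ : β ∈ Ioo (1 : ℝ) 2) (hx : x ∈ Ico (0 : ℝ) 1)
    (hq : 1 < q) (hcop : k.Coprime q) (h : itinerary β x = rankSeq k q 0) :
    ∃ n, (betaMap β)^[n] x = rankValue β k q (q - 1) := by
  obtain ⟨j, -, hj⟩ := Nat.exists_mul_mod_eq_one_of_coprime hcop hq
  refine ⟨(q - 1) * j, ?_⟩
  have hrank : (q - 1) * j * k % q = q - 1 := by
    rw [mul_assoc, mul_comm j k, Nat.mul_mod, hj, mul_one, Nat.mod_mod, Nat.mod_eq_of_lt (by omega)]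
  refine eq_rankValue_of_itinerary_eq hβ (iterate_betaMap_mem_Ico hx _) ?_
  rw [← itinerary_add, h, rankSeq_add, zero_add, ← rankSeq_mod, hrank]

theorem exists_realizesRotation (hβ : β ∈ Ioo (1 : ℝ) 2) (hP : HasPeriodicAbove β) :
    ∃ k q, RealizesRotation β k q := by
  obtain ⟨x, hxE, hx, m, hm, hper⟩ := hP.exists_mem_orbitMinimalSet hβ.1
  have hx0 := (one_sub_one_div_pos hβ.1).trans_le (hx 0).1
  have hcount := prefixCount_itinerary_eq_div hβ hm hxE (hx 0).1 hper
  obtain ⟨k, q, hk, hkq, hcop, hdiv⟩ := exists_coprime_mul_div_eq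
    (pos_of_prefixCount_itinerary_eq hβ ⟨hx0, hxE.1.2⟩ hcount)
    (lt_of_prefixCount_itinerary_eq hβ hm hxE.1 hcount)
  have hit := itinerary_eq_rankSeq_of_prefixCount hkq fun n => (hcount n).trans (hdiv n)
  refine ⟨k, q, hk, hkq, hcop, ?_, ?_⟩
  · rw [← eq_rankValue_of_itinerary_eq hβ hxE.1 hit]
    exact (hx 0).1
  · obtain ⟨n, hn⟩ := exists_iterate_eq_rankValue_pred hβ hxE.1 (by omega) hcop hit
    exact hn ▸ (hx n).2

end

section

variable {k q k₁ q₁ k₂ q₂ : ℕ}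

/-! ### Christoffel words -/

/-- The Christoffel word of slope `k / q`, the period of the rotation digits; a Farey word is the
Christoffel word of the fraction at its place in the Stern–Brocot list. -/
def christoffel (k q : ℕ) : List Bool := (List.range q).map (rankSeq k q 0)

theorem length_christoffel (k q : ℕ) : (christoffel k q).length = q := by
  rw [christoffel, List.length_map, List.length_range]

theorem rankSeq_zero_eq_true_iff (hq : 0 < q) (j : ℕ) :
    rankSeq k q 0 j = true ↔ j * k / q < (j + 1) * k / q := by
  rw [rankSeq, decide_eq_true_iff, zero_add, Nat.lt_iff_add_one_le, Nat.le_div_iff_mul_le hq,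
    add_mul, add_mul, one_mul, one_mul]
  have := Nat.div_add_mod' (j * k) q
  omega

theorem mediant_div_left {j : ℕ} (h₁ : 0 < q₁) (h₂ : 0 < q₂) (hdet : k₂ * q₁ = k₁ * q₂ + 1)
    (hj : j ≤ q₁) : j * (k₁ + k₂) / (q₁ + q₂) = j * k₁ / q₁ := by
  have hle := Nat.div_mul_le_self (j * k₁) q₁
  have hlt := Nat.lt_div_mul_add (a := j * k₁) h₁
  set a := j * k₁ / q₁
  refine Nat.div_eq_of_lt_le ?_ ?_
  · refine Nat.le_of_mul_le_mul_right ?_ h₁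
    nlinarith [Nat.mul_le_mul_right (q₁ + q₂) hle]
  · refine Nat.lt_of_mul_lt_mul_right (a := q₁) ?_
    have : (j * k₁ + 1) * (q₁ + q₂) ≤ (a * q₁ + q₁) * (q₁ + q₂) := Nat.mul_le_mul_right _ hlt
    nlinarith

theorem mediant_div_right {j : ℕ} (h₁ : 0 < q₁) (h₂ : 0 < q₂) (hdet : k₂ * q₁ = k₁ * q₂ + 1)
    (hj : j ≤ q₂) : (q₁ + j) * (k₁ + k₂) / (q₁ + q₂) = k₁ + j * k₂ / q₂ := by
  have hle := Nat.div_mul_le_self (j * k₂) q₂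
  have hlt := Nat.lt_div_mul_add (a := j * k₂) h₂
  set a := j * k₂ / q₂
  have hid : (q₁ + j) * (k₁ + k₂) * q₂ + j = k₁ * (q₁ + q₂) * q₂ + j * k₂ * (q₁ + q₂) + q₂ := by
    zify at hdet ⊢
    linear_combination ((q₂ : ℤ) - j) * hdet
  refine Nat.div_eq_of_lt_le ?_ ?_
  · refine Nat.le_of_mul_le_mul_right ?_ h₂
    nlinarith [Nat.mul_le_mul_right (q₁ + q₂) hle]
  · refine Nat.lt_of_mul_lt_mul_right (a := q₂) ?_
    have : (j * k₂ + 1) * (q₁ + q₂) ≤ (a * q₂ + q₂) * (q₁ + q₂) := Nat.mul_le_mul_right _ hlt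
    nlinarith

theorem christoffel_append (h₁ : 0 < q₁) (h₂ : 0 < q₂) (hdet : k₂ * q₁ = k₁ * q₂ + 1) :
    christoffel k₁ q₁ ++ christoffel k₂ q₂ = christoffel (k₁ + k₂) (q₁ + q₂) := by
  have hq : 0 < q₁ + q₂ := Nat.add_pos_left h₁ _
  rw [christoffel, christoffel, christoffel, List.range_add, List.map_append, List.map_map]
  congr 1
  · refine List.map_congr_left fun j hj => ?_
    rw [List.mem_range] at hj
    rw [Bool.eq_iff_iff, rankSeq_zero_eq_true_iff h₁, rankSeq_zero_eq_true_iff hq,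
      mediant_div_left h₁ h₂ hdet hj.le, mediant_div_left h₁ h₂ hdet hj]
  · refine List.map_congr_left fun j hj => ?_
    rw [List.mem_range] at hj
    rw [Function.comp_apply, Bool.eq_iff_iff, rankSeq_zero_eq_true_iff h₂,
      rankSeq_zero_eq_true_iff hq, mediant_div_right h₁ h₂ hdet hj.le, add_assoc,
      mediant_div_right h₁ h₂ hdet hj, Nat.add_lt_add_iff_left]

/-! ### Stern–Brocot lists -/

variable {p p' u v : ℕ × ℕ} {L : List (ℕ × ℕ)}

/-- Neighbours in a Stern–Brocot list: fractions, written as pairs of a numerator and a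
denominator, of determinant `1`. -/
structure FareyNeighbours (p p' : ℕ × ℕ) : Prop where
  left_pos : 0 < p.2
  right_pos : 0 < p'.2
  det : p'.1 * p.2 = p.1 * p'.2 + 1

theorem FareyNeighbours.left (h : FareyNeighbours p p') : FareyNeighbours p (p + p') where
  left_pos := h.left_pos
  right_pos := Nat.add_pos_left h.left_pos _
  det := by
    simp only [Prod.fst_add, Prod.snd_add]
    linarith [h.det]

theorem FareyNeighbours.right (h : FareyNeighbours p p') : FareyNeighbours (p + p') p' where
  left_pos := Nat.add_pos_left h.left_pos _
  right_pos := h.right_pos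
  det := by
    simp only [Prod.fst_add, Prod.snd_add]
    linarith [h.det]

theorem FareyNeighbours.coprime_add (h : FareyNeighbours p p') :
    (p + p').1.Coprime (p + p').2 := by
  rw [← Nat.isCoprime_iff_coprime]
  refine ⟨p.2, -p.1, ?_⟩
  have := h.left.det
  zify at this
  linarith

/-- Insert between any two neighbours of a list of fractions their mediant. -/
def mediantStep : List (ℕ × ℕ) → List (ℕ × ℕ)
  | p :: p' :: l => p :: (p + p') :: mediantStep (p' :: l)
  | l => l

/-- The `n`-th Stern–Brocot list of fractions in `[0, 1]`. -/
def mediantList : ℕ → List (ℕ × ℕ)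
  | 0 => [(0, 1), (1, 1)]
  | n + 1 => mediantStep (mediantList n)

theorem exists_mediantStep_cons_eq (p : ℕ × ℕ) (l : List (ℕ × ℕ)) :
    ∃ l', mediantStep (p :: l) = p :: l' := by
  cases l with
  | nil => exact ⟨[], rfl⟩
  | cons p' l => exact ⟨_, rfl⟩

theorem isChain_mediantStep (h : L.IsChain FareyNeighbours) :
    (mediantStep L).IsChain FareyNeighbours := by
  induction L using mediantStep.induct with
  | case1 p p' l ih =>
    rw [List.isChain_cons_cons] at h
    have htail := ih h.2
    obtain ⟨l', hl'⟩ := exists_mediantStep_cons_eq p' l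
    rw [mediantStep, hl', List.isChain_cons_cons, List.isChain_cons_cons, ← hl']
    exact ⟨h.1.left, h.1.right, htail⟩
  | case2 l hl => rwa [mediantStep.eq_2 l hl]

theorem isChain_mediantList (n : ℕ) : (mediantList n).IsChain FareyNeighbours := by
  induction n with
  | zero => exact .cons_cons ⟨by norm_num, by norm_num, by norm_num⟩ (.singleton _)
  | succ n ih => exact isChain_mediantStep ih

theorem FareyNeighbours.of_infix (hL : L.IsChain FareyNeighbours) (h : [u, v] <:+: L) :
    FareyNeighbours u v := by
  obtain ⟨s, t, rfl⟩ := h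
  exact (List.isChain_cons_cons.1 hL.left_of_append.right_of_append).1

theorem mem_or_of_mem_mediantStep (h : p ∈ mediantStep L) :
    p ∈ L ∨ ∃ u v, [u, v] <:+: L ∧ p = u + v := by
  induction L using mediantStep.induct with
  | case1 u v l ih =>
    rw [mediantStep, List.mem_cons, List.mem_cons] at h
    rcases h with rfl | rfl | h
    · exact Or.inl List.mem_cons_self
    · exact Or.inr ⟨u, v, ⟨[], l, rfl⟩, rfl⟩
    · rcases ih h with h | ⟨x, y, hxy, rfl⟩
      · exact Or.inl (List.mem_cons_of_mem _ h)
      · exact Or.inr ⟨x, y, hxy.trans (List.suffix_cons _ _).isInfix, rfl⟩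
  | case2 l hl => exact Or.inl (mediantStep.eq_2 l hl ▸ h)

theorem subset_mediantStep (L : List (ℕ × ℕ)) : L ⊆ mediantStep L := by
  induction L using mediantStep.induct with
  | case1 u v l ih => exact List.cons_subset_cons u (List.subset_cons_of_subset _ ih)
  | case2 l hl => rw [mediantStep.eq_2 l hl]; exact List.Subset.refl l

theorem infix_mediantStep (h : [u, v] <:+: L) :
    [u, u + v] <:+: mediantStep L ∧ [u + v, v] <:+: mediantStep L := by
  induction L using mediantStep.induct with
  | case1 x y l ih =>
    obtain ⟨l', hl'⟩ := exists_mediantStep_cons_eq y l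
    rw [mediantStep]
    rcases List.infix_cons_iff.1 h with h | h
    · rw [List.cons_prefix_cons, List.cons_prefix_cons] at h
      obtain ⟨rfl, rfl, -⟩ := h
      rw [hl']
      exact ⟨⟨[], v :: l', rfl⟩, ⟨[u], l', rfl⟩⟩
    · have hsuffix : mediantStep (y :: l) <:+: x :: (x + y) :: mediantStep (y :: l) :=
        ⟨[x, x + y], [], by simp⟩
      exact ⟨(ih h).1.trans hsuffix, (ih h).2.trans hsuffix⟩
  | case2 l hl =>
    match l, hl with
    | [], _ => simpa using h.length_le
    | [p], _ => simpa using h.length_le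
    | p :: p' :: l, hl => exact absurd rfl (hl p p' l)

theorem pos_and_le_and_coprime_of_mem_mediantList {n : ℕ} (h : p ∈ mediantList n) :
    0 < p.2 ∧ p.1 ≤ p.2 ∧ p.1.Coprime p.2 := by
  induction n generalizing p with
  | zero =>
    simp only [mediantList, List.mem_cons, List.not_mem_nil, or_false] at h
    rcases h with rfl | rfl <;> simp
  | succ n ih =>
    rcases mem_or_of_mem_mediantStep h with h | ⟨u, v, huv, rfl⟩
    · exact ih h
    · have hN := FareyNeighbours.of_infix (isChain_mediantList n) huv
      have hu := ih (huv.subset (List.mem_cons_self (a := u)))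
      have hv := ih (huv.subset (List.mem_cons_of_mem u (List.mem_singleton_self v)))
      exact ⟨Nat.add_pos_left hu.1 _, Nat.add_le_add hu.2.1 hv.2.1, hN.coprime_add⟩

theorem prod_eq_of_mul_eq_mul (hk : 0 < k) (hcop : k.Coprime q) (hp : p.1.Coprime p.2)
    (h : k * p.2 = p.1 * q) : (k, q) = p := by
  have hfst : k = p.1 := Nat.dvd_antisymm
    (hcop.dvd_of_dvd_mul_right (h ▸ Dvd.intro _ rfl))
    (hp.dvd_of_dvd_mul_right (h.symm ▸ Dvd.intro _ rfl))
  rw [← hfst] at h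
  exact Prod.ext hfst (Nat.eq_of_mul_eq_mul_left hk h).symm

/-- A fraction that is not yet in the list lies between two neighbours, and the denominators of
neighbours grow. -/
theorem mem_mediantList_or (hk0 : 0 < k) (hk : k < q) (hcop : k.Coprime q) (n : ℕ) :
    (k, q) ∈ mediantList n ∨ ∃ u v : ℕ × ℕ, [u, v] <:+: mediantList n ∧
      u.1 * q < k * u.2 ∧ k * v.2 < v.1 * q ∧ n + 2 ≤ u.2 + v.2 := by
  induction n with
  | zero =>
    refine Or.inr ⟨(0, 1), (1, 1), ⟨[], [], rfl⟩, ?_, ?_, ?_⟩ <;> simp [hk0, hk]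
  | succ n ih =>
    rcases ih with h | ⟨u, v, huv, hlt_u, hlt_v, hle⟩
    · exact Or.inl (subset_mediantStep _ h)
    · have hN := FareyNeighbours.of_infix (isChain_mediantList n) huv
      have hu := hN.left_pos
      have hv := hN.right_pos
      obtain ⟨hl, hr⟩ := infix_mediantStep huv
      rcases lt_trichotomy (k * (u + v).2) ((u + v).1 * q) with h | h | h
      · exact Or.inr ⟨u, u + v, hl, hlt_u, h, by rw [Prod.snd_add]; omega⟩
      · rw [prod_eq_of_mul_eq_mul hk0 hcop hN.coprime_add h]
        exact Or.inl (hl.subset (List.mem_cons_of_mem _ (List.mem_singleton_self _)))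
      · exact Or.inr ⟨u + v, v, hr, h, hlt_v, by rw [Prod.snd_add]; omega⟩

theorem mem_mediantList (hk0 : 0 < k) (hk : k < q) (hcop : k.Coprime q) :
    (k, q) ∈ mediantList q := by
  refine (mem_mediantList_or hk0 hk hcop q).resolve_right ?_
  rintro ⟨u, v, huv, hlt_u, hlt_v, hle⟩
  have hdet := (FareyNeighbours.of_infix (isChain_mediantList q) huv).det
  obtain ⟨d, hd⟩ := Nat.exists_eq_add_of_lt hlt_u
  obtain ⟨e, he⟩ := Nat.exists_eq_add_of_lt hlt_v
  have hq : q = u.2 * (e + 1) + v.2 * (d + 1) := by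
    zify at hdet hd he ⊢
    linear_combination (-(q : ℤ)) * hdet + (u.2 : ℤ) * he + (v.2 : ℤ) * hd
  nlinarith [Nat.zero_le (u.2 * e), Nat.zero_le (v.2 * d)]

/-! ### Farey words are Christoffel words -/

theorem fareyStep_map_christoffel (h : L.IsChain FareyNeighbours) :
    fareyStep (L.map fun p => christoffel p.1 p.2) =
      (mediantStep L).map fun p => christoffel p.1 p.2 := by
  induction L using mediantStep.induct with
  | case1 p p' l ih =>
    rw [List.isChain_cons_cons] at h
    have htail := ih h.2
    rw [List.map_cons] at htail
    rw [mediantStep, List.map_cons, List.map_cons, List.map_cons, List.map_cons, fareyStep, htail,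
      christoffel_append h.1.left_pos h.1.right_pos h.1.det]
    rfl
  | case2 l hl =>
    match l, hl with
    | [], _ => rfl
    | [p], _ => rfl
    | p :: p' :: l, hl => exact absurd rfl (hl p p' l)

theorem fareyList_eq_map_christoffel (n : ℕ) :
    fareyList n = (mediantList n).map fun p => christoffel p.1 p.2 := by
  induction n with
  | zero => rfl
  | succ n ih => rw [fareyList, mediantList, ih, fareyStep_map_christoffel (isChain_mediantList n)]

theorem isNondegenerateFareyWord_iff {w : List Bool} :
    IsNondegenerateFareyWord w ↔
      ∃ k q : ℕ, 0 < k ∧ k < q ∧ k.Coprime q ∧ w = christoffel k q := by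
  constructor
  · rintro ⟨⟨n, hn⟩, h0, h1⟩
    rw [fareyList_eq_map_christoffel, List.mem_map] at hn
    obtain ⟨⟨k, q⟩, hp, rfl⟩ := hn
    obtain ⟨hq, hkq, hcop⟩ := pos_and_le_and_coprime_of_mem_mediantList hp
    dsimp only at hq hkq hcop h0 h1
    refine ⟨k, q, Nat.pos_of_ne_zero fun hk => h0 ?_, lt_of_le_of_ne hkq fun hk => h1 ?_, hcop,
      rfl⟩
    · rw [hk, Nat.coprime_zero_left] at hcop
      rw [hk, hcop]
      rfl
    · rw [hk, Nat.coprime_self] at hcop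
      rw [hk, hcop]
      rfl
  · rintro ⟨k, q, hk0, hk, hcop, rfl⟩
    refine ⟨⟨q, ?_⟩, ?_, ?_⟩
    · rw [fareyList_eq_map_christoffel, List.mem_map]
      exact ⟨(k, q), mem_mediantList hk0 hk hcop, rfl⟩
    all_goals
      intro h
      have := congrArg List.length h
      rw [length_christoffel, List.length_singleton] at this
      omega

end

section

variable {β γ x y : ℝ} {k q : ℕ} {s : ℕ → Bool} {a : List Bool} {J : Set ℝ}

/-! ### The words of Farey intervals -/

/-- The period of the digits of the largest point of a rotation orbit; these are the words whose
reflections are Farey words. -/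
def upperWord (k q : ℕ) : List Bool := (List.range q).map (rankSeq k q (q - 1))

theorem periodicSeq_map_range (hq : 0 < q) (hs : Function.Periodic s q) :
    periodicSeq ((List.range q).map s) = s := by
  funext n
  have hn : n % q < ((List.range q).map s).length := by simpa using Nat.mod_lt n hq
  rw [periodicSeq, List.length_map, List.length_range, List.getD_eq_getElem _ _ hn,
    List.getElem_map, List.getElem_range, hs.map_mod_nat]

theorem pred_add_mod {a b : ℕ} (hq : 0 < q) (h : q ∣ a + b) :
    (q - 1 + a) % q = q - 1 - b % q := by
  have hb := Nat.mod_lt b hq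
  obtain ⟨c, hc⟩ : q ∣ a + b % q :=
    (Nat.dvd_add_right (Dvd.intro (b / q) rfl)).1 (by rwa [add_left_comm, Nat.div_add_mod])
  rw [show q - 1 + a = q - 1 - b % q + q * c by omega, Nat.add_mul_mod_self_left,
    Nat.mod_eq_of_lt (by omega)]

theorem rankSeq_sub (hk : k ≤ q) (hq : 0 < q) (j : ℕ) :
    rankSeq (q - k) q 0 j = !rankSeq k q (q - 1) j := by
  have hdvd : q ∣ j * k + j * (q - k) := by
    rw [← mul_add, Nat.add_sub_of_le hk]
    exact dvd_mul_left q j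
  have hlt := Nat.mod_lt (j * (q - k)) hq
  rw [rankSeq, rankSeq, pred_add_mod hq hdvd, zero_add, ← decide_not, decide_eq_decide]
  omega

/-- Backwards in time, the orbit of the largest point is the mirror image of the orbit of the
smallest point. -/
theorem rankSeq_pred_sub (hk : k < q) {i : ℕ} (hi : i < q) :
    rankSeq k q (q - 1) (q - 1 - i) = rankSeq k q 0 i := by
  have hq : 0 < q := by omega
  have hdvd : q ∣ (q - 1 - i) * k + (i + 1) * k := by
    rw [← add_mul, show q - 1 - i + (i + 1) = q by omega]
    exact dvd_mul_right q k
  have hlt := Nat.mod_lt (i * k) hq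
  rw [rankSeq, rankSeq, pred_add_mod hq hdvd, zero_add, decide_eq_decide, add_one_mul,
    ← Nat.mod_add_mod]
  rcases lt_or_ge (i * k % q + k) q with h | h
  · rw [Nat.mod_eq_of_lt h]
    omega
  · rw [Nat.mod_eq_sub_mod h, Nat.mod_eq_of_lt (by omega)]
    omega

theorem reverse_upperWord (hk : k < q) : (upperWord k q).reverse = christoffel k q := by
  refine List.ext_getElem (by simp [upperWord, christoffel]) fun i _ hi => ?_
  rw [length_christoffel] at hi
  simp only [upperWord, christoffel, List.getElem_reverse, List.getElem_map, List.getElem_range,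
    List.length_map, List.length_range]
  exact rankSeq_pred_sub hk hi

theorem reflectWord_upperWord (hk : k ≤ q) (hq : 0 < q) :
    reflectWord (upperWord k q) = christoffel (q - k) q := by
  rw [reflectWord, upperWord, christoffel, List.map_map]
  exact List.map_congr_left fun j _ => (rankSeq_sub hk hq j).symm

theorem isNondegenerateFareyWord_reflectWord_iff : IsNondegenerateFareyWord (reflectWord a) ↔
    ∃ k q, 0 < k ∧ k < q ∧ k.Coprime q ∧ a = upperWord k q := by
  have hinj : Function.Injective reflectWord := List.map_injective_iff.2 Bool.not_injective
  rw [isNondegenerateFareyWord_iff]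
  constructor <;> rintro ⟨k, q, hk, hkq, hcop, h⟩ <;>
    refine ⟨q - k, q, by omega, by omega, (Nat.coprime_self_sub_left hkq.le).2 hcop, ?_⟩
  · refine hinj (h.trans ?_)
    rw [reflectWord_upperWord (Nat.sub_le _ _) (by omega), Nat.sub_sub_self hkq.le]
  · rw [h, reflectWord_upperWord hkq.le (by omega)]

theorem raiseLast_upperWord (p : ℕ) :
    raiseLast (upperWord k (p + 1)) = (List.range p).map (rankSeq k (p + 1) p) ++ [true] := by
  simp [raiseLast, upperWord, List.range_succ]

/-- The orbits of the largest and of the smallest point have the same digits except at the two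
ends of the period, so raising the last digit leaves a difference in the first digit only. -/
theorem prependWord_raiseLast_upperWord (hk0 : 0 < k) (hk : k < q) (hcop : k.Coprime q) :
    prependWord (raiseLast (upperWord k q)) (rankSeq k q 0) =
      fun n => decide (n = 0) || rankSeq k q 0 n := by
  obtain ⟨p, rfl⟩ : ∃ p, q = p + 1 := ⟨q - 1, by omega⟩
  funext n
  rw [prependWord, raiseLast_upperWord]
  simp only [List.length_append, List.length_map, List.length_range, List.length_singleton]
  split_ifs with hn
  · rcases Nat.lt_or_ge n p with hnp | hnp
    · rw [List.getD_append _ _ _ _ (by simpa using hnp),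
        List.getD_eq_getElem _ _ (by simpa using hnp), List.getElem_map, List.getElem_range]
      rcases Nat.eq_zero_or_pos n with rfl | hn0
      · exact rankSeq_pred_zero hk0 hk
      · rw [decide_eq_false hn0.ne', Bool.false_or]
        exact rankSeq_pred_eq hk hcop hn0 (by omega)
    · obtain rfl : n = p := by omega
      have hlast : rankSeq k (n + 1) 0 n = true := rankSeq_zero_pred hk0 hk
      rw [List.getD_append_right _ _ _ _ (by simp), hlast]
      simp
  · rw [← rankSeq_periodic k (p + 1) 0 (n - (p + 1)), Nat.sub_add_cancel (not_lt.1 hn),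
      decide_eq_false (by omega), Bool.false_or]

/-! ### Quasi-greedy expansions of `1` -/

theorem quasiGreedyMap_mem_Ioc (hγ : γ ∈ Ioc (1 : ℝ) 2) (hx : x ∈ Ioc (0 : ℝ) 1) :
    quasiGreedyMap γ x ∈ Ioc (0 : ℝ) 1 := by
  have hγ0 : 0 < γ := zero_lt_one.trans hγ.1
  rw [quasiGreedyMap]
  split_ifs with h
  · rw [le_div_iff₀ hγ0] at h
    exact ⟨mul_pos hγ0 hx.1, by linarith⟩
  · rw [not_le, div_lt_iff₀ hγ0] at h
    have := mul_le_mul_of_nonneg_left hx.2 hγ0.le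
    exact ⟨by linarith, by linarith [hγ.2]⟩

theorem iterate_quasiGreedyMap_mem_Ioc (hγ : γ ∈ Ioc (1 : ℝ) 2) (hx : x ∈ Ioc (0 : ℝ) 1) (n : ℕ) :
    (quasiGreedyMap γ)^[n] x ∈ Ioc (0 : ℝ) 1 := by
  induction n with
  | zero => exact hx
  | succ n ih =>
    rw [Function.iterate_succ_apply']
    exact quasiGreedyMap_mem_Ioc hγ ih

theorem quasiGreedyMap_eq_sub_toNat (γ x : ℝ) :
    quasiGreedyMap γ x = γ * x - (decide (1 / γ < x)).toNat := by
  rw [quasiGreedyMap]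
  split_ifs with h
  · rw [decide_eq_false (not_lt.2 h), Bool.toNat_false, Nat.cast_zero, sub_zero]
  · rw [decide_eq_true (not_le.1 h), Bool.toNat_true, Nat.cast_one]

theorem digitSeries_quasiGreedyOne (hγ : γ ∈ Ioc (1 : ℝ) 2) :
    digitSeries (quasiGreedyOne γ) (1 / γ) = 1 := by
  have hγ0 : γ ≠ 0 := (zero_lt_one.trans hγ.1).ne'
  refine (eq_digitSeries (one_div_mem_Ico hγ.1) (y := fun n => (quasiGreedyMap γ)^[n] 1)
    (fun n => Ioc_subset_Icc_self (iterate_quasiGreedyMap_mem_Ioc hγ ⟨one_pos, le_rfl⟩ n))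
    fun n => ?_).symm
  simp only [Function.iterate_succ_apply', quasiGreedyOne, quasiGreedyMap_eq_sub_toNat]
  field_simp
  ring

theorem one_div_lt_digitSeries_iff (hγ : 1 < γ)
    (hs : digitSeries (fun n => s (n + 1)) (1 / γ) ∈ Ioc (0 : ℝ) 1) :
    1 / γ < digitSeries s (1 / γ) ↔ s 0 = true := by
  rw [div_lt_iff₀ (zero_lt_one.trans hγ), mul_comm, mul_digitSeries_one_div hγ]
  cases s 0
  · simpa using hs.2
  · simpa using hs.1

theorem quasiGreedyMap_digitSeries (hγ : 1 < γ)
    (hs : digitSeries (fun n => s (n + 1)) (1 / γ) ∈ Ioc (0 : ℝ) 1) :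
    quasiGreedyMap γ (digitSeries s (1 / γ)) = digitSeries (fun n => s (n + 1)) (1 / γ) := by
  simp only [quasiGreedyMap_eq_sub_toNat, one_div_lt_digitSeries_iff hγ hs, Bool.decide_eq_true,
    mul_digitSeries_one_div hγ, add_sub_cancel_left]

theorem iterate_quasiGreedyMap_digitSeries (hγ : 1 < γ)
    (hs : ∀ n, digitSeries (fun i => s (i + (n + 1))) (1 / γ) ∈ Ioc (0 : ℝ) 1) (n : ℕ) :
    (quasiGreedyMap γ)^[n] (digitSeries s (1 / γ)) = digitSeries (fun i => s (i + n)) (1 / γ) := by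
  induction n with
  | zero => rfl
  | succ n ih =>
    have hn := hs n
    simp only [← add_assoc, add_right_comm _ n 1] at hn ⊢
    rw [Function.iterate_succ_apply', ih, quasiGreedyMap_digitSeries hγ hn]

/-- The quasi-greedy expansion is the only expansion of `1` all of whose tails represent numbers
in `(0, 1]`. -/
theorem quasiGreedyOne_eq (hγ : 1 < γ) (h1 : digitSeries s (1 / γ) = 1)
    (hs : ∀ n, digitSeries (fun i => s (i + (n + 1))) (1 / γ) ∈ Ioc (0 : ℝ) 1) :
    quasiGreedyOne γ = s := by
  funext n
  have hn := hs n
  simp only [← add_assoc, add_right_comm _ n 1] at hn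
  have hit := iterate_quasiGreedyMap_digitSeries hγ hs n
  rw [h1] at hit
  rw [quasiGreedyOne, hit, Bool.decide_congr (one_div_lt_digitSeries_iff hγ hn), zero_add,
    Bool.decide_eq_true]

theorem rankValue_pos (hγ : 1 < γ) (hk0 : 0 < k) (hk : k < q) (r : ℕ) : 0 < rankValue γ k q r :=
  calc 0 ≤ digitSeries (rankSeq k q 0) 0 := digitSeries_nonneg _ le_rfl
    _ < rankValue γ k q 0 := digitSeries_strictMono (rankSeq_zero_pred hk0 hk) le_rfl
      (one_div_pos.2 (zero_lt_one.trans hγ)) (one_div_mem_Ico hγ).2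
    _ ≤ rankValue γ k q r := (rankValue_mem_Icc hγ hk r).1

theorem digitSeries_rankSeq_add (γ : ℝ) (k q r n : ℕ) :
    digitSeries (fun i => rankSeq k q r (i + n)) (1 / γ) = rankValue γ k q (r + n * k) := by
  simp only [add_comm _ n, rankSeq_add, rankValue]

theorem quasiGreedyOne_eq_rankSeq_pred_iff (hγ : γ ∈ Ioc (1 : ℝ) 2) (hk0 : 0 < k) (hk : k < q) :
    quasiGreedyOne γ = rankSeq k q (q - 1) ↔ rankValue γ k q (q - 1) = 1 := by
  refine ⟨fun h => by rw [rankValue, ← h, digitSeries_quasiGreedyOne hγ],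
    fun h => quasiGreedyOne_eq hγ.1 h fun n => ?_⟩
  rw [digitSeries_rankSeq_add]
  exact ⟨rankValue_pos hγ.1 hk0 hk _, (rankValue_mem_Icc hγ.1 hk _).2.trans h.le⟩

theorem digitSeries_raise_first (hs : s 0 = false) (hx : x ∈ Ico (0 : ℝ) 1) :
    digitSeries (fun n => decide (n = 0) || s n) x = x + digitSeries s x := by
  rw [digitSeries_eq _ hx, digitSeries_eq s hx, hs]
  simp [mul_add]

theorem rankValue_pred_lt (hγ : 1 < γ) (hk0 : 0 < k) (hk : k < q) (hcop : k.Coprime q) :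
    rankValue γ k q (q - 1) < 1 / γ + rankValue γ k q 0 := by
  have hgap := rankValue_pred_sub_rankValue_zero hγ hk0 hk hcop
  have hinv : 0 < 1 / γ := one_div_pos.2 (zero_lt_one.trans hγ)
  have hinv1 : 1 / γ < 1 := (one_div_mem_Ico hγ).2
  have hpow : 0 < (1 / γ) ^ q := pow_pos hinv q
  have hpow1 : (1 / γ) ^ q < 1 := pow_lt_one₀ hinv.le hinv1 (by omega)
  have hlt : (rankValue γ k q (q - 1) - rankValue γ k q 0) * (1 - (1 / γ) ^ q) <
      1 / γ * (1 - (1 / γ) ^ q) := by nlinarith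
  linarith [lt_of_mul_lt_mul_right hlt (sub_pos.2 hpow1).le]

theorem quasiGreedyOne_eq_raise_first_iff (hγ : γ ∈ Ioc (1 : ℝ) 2) (hk0 : 0 < k) (hk : k < q)
    (hcop : k.Coprime q) :
    (quasiGreedyOne γ = fun n => decide (n = 0) || rankSeq k q 0 n) ↔
      1 / γ + rankValue γ k q 0 = 1 := by
  rw [rankValue, ← digitSeries_raise_first (rankSeq_zero_zero hk) (one_div_mem_Ico hγ.1)]
  refine ⟨fun h => by rw [← h, digitSeries_quasiGreedyOne hγ],
    fun h => quasiGreedyOne_eq hγ.1 h fun n => ?_⟩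
  rw [digitSeries_raise_first (rankSeq_zero_zero hk) (one_div_mem_Ico hγ.1)] at h
  simp only [← add_assoc, Nat.add_one_ne_zero, decide_false, Bool.false_or]
  simp only [add_assoc, digitSeries_rankSeq_add]
  exact ⟨rankValue_pos hγ.1 hk0 hk _, (rankValue_mem_Icc hγ.1 hk _).2.trans
    ((rankValue_pred_lt hγ.1 hk0 hk hcop).le.trans h.le)⟩

/-! ### Farey intervals -/

theorem isFareyInterval_iff : IsFareyInterval J ↔ ∃ k q, 0 < k ∧ k < q ∧ k.Coprime q ∧
    ∃ γL ∈ Ioc (1 : ℝ) 2, ∃ γR ∈ Ioc (1 : ℝ) 2, rankValue γL k q (q - 1) = 1 ∧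
      1 / γR + rankValue γR k q 0 = 1 ∧ J = Ioc γL γR := by
  constructor
  · rintro ⟨a, γL, γR, ha, hL, hR, hLs, hRs, hJ⟩
    obtain ⟨k, q, hk0, hk, hcop, rfl⟩ := isNondegenerateFareyWord_reflectWord_iff.1 ha
    have hq : 0 < q := hk0.trans hk
    rw [upperWord, periodicSeq_map_range hq (rankSeq_periodic k q _),
      quasiGreedyOne_eq_rankSeq_pred_iff hL hk0 hk] at hLs
    rw [reverse_upperWord hk, christoffel, periodicSeq_map_range hq (rankSeq_periodic k q _),
      prependWord_raiseLast_upperWord hk0 hk hcop,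
      quasiGreedyOne_eq_raise_first_iff hR hk0 hk hcop] at hRs
    exact ⟨k, q, hk0, hk, hcop, γL, hL, γR, hR, hLs, hRs, hJ⟩
  · rintro ⟨k, q, hk0, hk, hcop, γL, hL, γR, hR, hLs, hRs, hJ⟩
    have hq : 0 < q := hk0.trans hk
    refine ⟨upperWord k q, γL, γR,
      isNondegenerateFareyWord_reflectWord_iff.2 ⟨k, q, hk0, hk, hcop, rfl⟩, hL, hR, ?_, ?_, hJ⟩
    · rwa [upperWord, periodicSeq_map_range hq (rankSeq_periodic k q _),
        quasiGreedyOne_eq_rankSeq_pred_iff hL hk0 hk]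
    · rwa [reverse_upperWord hk, christoffel, periodicSeq_map_range hq (rankSeq_periodic k q _),
        prependWord_raiseLast_upperWord hk0 hk hcop,
        quasiGreedyOne_eq_raise_first_iff hR hk0 hk hcop]

theorem continuousOn_digitSeries (s : ℕ → Bool) : ContinuousOn (digitSeries s) (Ico (0 : ℝ) 1) := by
  intro x hx
  obtain ⟨b, hxb, hb⟩ := exists_between hx.2
  have hcont : ContinuousOn (digitSeries s) (Icc 0 b) := by
    refine continuousOn_tsum (u := fun n : ℕ => b ^ (n + 1)) (fun n => by fun_prop)
      ((summable_geometric_of_lt_one (hx.1.trans hxb.le) hb).comp_injective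
        (add_left_injective 1)) fun n y hy => ?_
    rw [Real.norm_of_nonneg (mul_nonneg (toNat_cast_mem_Icc _).1 (pow_nonneg hy.1 _))]
    exact (mul_le_of_le_one_left (pow_nonneg hy.1 _) (toNat_cast_mem_Icc _).2).trans
      (pow_le_pow_left₀ hy.1 hy.2 _)
  refine (hcont x ⟨hx.1, hxb.le⟩).mono_of_mem_nhdsWithin ?_
  filter_upwards [self_mem_nhdsWithin, mem_nhdsWithin_of_mem_nhds (Iio_mem_nhds hxb)]
    with y hy hyb using ⟨hy.1, le_of_lt hyb⟩

theorem exists_one_lt_digitSeries (hq : 0 < q) (hs : Function.Periodic s q) (hs0 : s 0 = true)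
    (hy : y ∈ Ico (0 : ℝ) 1) : ∃ x ∈ Ico y 1, 1 < digitSeries s x := by
  have hlim : Tendsto (fun x : ℝ => x + x ^ q) (𝓝[<] 1) (𝓝 2) := by
    have hcont : Continuous fun x : ℝ => x + x ^ q := by fun_prop
    refine (hcont.tendsto' 1 2 ?_).mono_left nhdsWithin_le_nhds
    norm_num
  obtain ⟨x, hx, hxy⟩ := ((hlim.eventually_const_lt one_lt_two).and
    (Ico_mem_nhdsLT hy.2)).exists
  have hx0 : 0 ≤ x := hy.1.trans hxy.1
  have hfirst : x ≤ ∑ i ∈ Finset.range q, ((s i).toNat : ℝ) * x ^ (i + 1) := by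
    have hle := Finset.single_le_sum (f := fun i => ((s i).toNat : ℝ) * x ^ (i + 1))
      (fun i _ => mul_nonneg (toNat_cast_mem_Icc _).1 (pow_nonneg hx0 _)) (Finset.mem_range.2 hq)
    simpa [hs0] using hle
  rw [← digitSeries_mul_one_sub_pow hs ⟨hx0, hxy.2⟩] at hfirst
  have hpow : 0 < 1 - x ^ q := sub_pos.2 (pow_lt_one₀ hx0 hxy.2 hq.ne')
  exact ⟨x, hxy, lt_of_mul_lt_mul_right (by linarith) hpow.le⟩

theorem exists_digitSeries_eq_one (hq : 0 < q) (hs : Function.Periodic s q) (hs0 : s 0 = true)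
    (hy : y ∈ Ico (0 : ℝ) 1) (hlt : digitSeries s y < 1) : ∃ x ∈ Ioo y 1, digitSeries s x = 1 := by
  obtain ⟨z, hz, hgt⟩ := exists_one_lt_digitSeries hq hs hs0 hy
  obtain ⟨x, hx, h1⟩ := intermediate_value_Ioo hz.1
    ((continuousOn_digitSeries s).mono fun w hw => ⟨hy.1.trans hw.1, hw.2.trans_lt hz.2⟩)
    ⟨hlt, hgt⟩
  exact ⟨x, ⟨hx.1, hx.2.trans hz.2⟩, h1⟩

theorem exists_add_digitSeries_eq_one (hs0 : s 0 = false) (hy : y ∈ Ico (1 / 2 : ℝ) 1)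
    (hge : 1 ≤ y + digitSeries s y) : ∃ x ∈ Icc (1 / 2) y, x + digitSeries s x = 1 := by
  have hhalf : 1 / 2 + digitSeries s (1 / 2) ≤ 1 := by
    have hle := digitSeries_le (fun n => s (n + 1)) (x := 1 / 2) (by norm_num)
    rw [digitSeries_eq s (by norm_num), hs0, Bool.toNat_false]
    norm_num at hle ⊢
    linarith
  have hcont : ContinuousOn (fun x => x + digitSeries s x) (Icc (1 / 2) y) :=
    continuousOn_id.add ((continuousOn_digitSeries s).mono fun w hw =>
      ⟨by linarith [hw.1], hw.2.trans_lt hy.2⟩)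
  exact intermediate_value_Icc hy.1 hcont ⟨hhalf, hge⟩

namespace RealizesRotation

theorem exists_left (h : RealizesRotation β k q) (hβ : 1 < β) :
    ∃ γ ∈ Ioo 1 β, rankValue γ k q (q - 1) = 1 := by
  obtain ⟨x, hx, hx1⟩ := exists_digitSeries_eq_one (h.pos.trans h.lt)
    (rankSeq_periodic k q _) (rankSeq_pred_zero h.pos h.lt) (one_div_mem_Ico hβ) h.lt_one
  have hx0 : 0 < x := (one_div_pos.2 (zero_lt_one.trans hβ)).trans hx.1
  refine ⟨1 / x, ⟨(one_lt_div hx0).2 hx.2, ?_⟩, by rwa [rankValue, one_div_one_div]⟩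
  exact (one_div_lt (zero_lt_one.trans hβ) hx0).1 hx.1

theorem exists_right (h : RealizesRotation β k q) (hβ : β ∈ Ioo (1 : ℝ) 2) :
    ∃ γ ∈ Icc β 2, 1 / γ + rankValue γ k q 0 = 1 := by
  have hβ0 : 0 < β := zero_lt_one.trans hβ.1
  obtain ⟨x, hx, hx1⟩ := exists_add_digitSeries_eq_one (rankSeq_zero_zero h.lt)
    ⟨one_div_le_one_div_of_le hβ0 hβ.2.le, (one_div_mem_Ico hβ.1).2⟩
    (sub_le_iff_le_add'.1 h.one_sub_one_div_le)
  have hx0 : 0 < x := by linarith [hx.1]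
  refine ⟨1 / x, ⟨(le_one_div hβ0 hx0).2 hx.2, (one_div_le hx0 two_pos).2 hx.1⟩, ?_⟩
  rwa [rankValue, one_div_one_div]

end RealizesRotation

theorem exists_isFareyInterval_iff (hβ : β ∈ Ioo (1 : ℝ) 2) :
    (∃ J, IsFareyInterval J ∧ β ∈ J) ↔ ∃ k q, RealizesRotation β k q := by
  simp only [isFareyInterval_iff]
  constructor
  · rintro ⟨_, ⟨k, q, hk0, hk, hcop, γL, hL, γR, hR, hL1, hR1, rfl⟩, hmem⟩
    have hγRβ : 1 / γR ≤ 1 / β := one_div_le_one_div_of_le (zero_lt_one.trans hβ.1) hmem.2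
    refine ⟨k, q, hk0, hk, hcop, ?_, ?_⟩
    · have hle : rankValue γR k q 0 ≤ rankValue β k q 0 :=
        digitSeries_mono _ (one_div_mem_Ico hR.1).1 hγRβ (one_div_mem_Ico hβ.1).2
      linarith
    · rw [← hL1]
      exact digitSeries_strictMono (rankSeq_pred_zero hk0 hk) (one_div_mem_Ico hβ.1).1
        (one_div_lt_one_div_of_lt (zero_lt_one.trans hL.1) hmem.1) (one_div_mem_Ico hL.1).2
  · rintro ⟨k, q, h⟩
    obtain ⟨γL, hL, hL1⟩ := h.exists_left hβ.1
    obtain ⟨γR, hR, hR1⟩ := h.exists_right hβ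
    exact ⟨Ioc γL γR, ⟨k, q, h.pos, h.lt, h.coprime, γL, ⟨hL.1, (hL.2.trans hβ.2).le⟩, γR,
      ⟨hβ.1.trans_le hR.1, hR.2⟩, hL1, hR1, rfl⟩, hL.2, hR.1⟩

theorem hasPeriodicAbove_iff (hβ : β ∈ Ioo (1 : ℝ) 2) :
    HasPeriodicAbove β ↔ ∃ k q, RealizesRotation β k q :=
  ⟨exists_realizesRotation hβ, fun ⟨_, _, h⟩ => h.hasPeriodicAbove hβ.1⟩

theorem isCantorSet_closure_orbitMinimalSet_iff (hβ : β ∈ Ioo (1 : ℝ) 2) :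
    IsCantorSet (closure (orbitMinimalSet β)) ↔ ¬ HasPeriodicAbove β := by
  refine ⟨fun hC hP => ?_, isCantorSet_closure_orbitMinimalSet hβ⟩
  obtain ⟨k, q, h⟩ := exists_realizesRotation hβ hP
  exact h.not_isCantorSet hβ hC

theorem IsCriticalValue.eq_one_sub_one_div_iff {τ : ℝ} (hτ : IsCriticalValue β τ)
    (hβ : β ∈ Ioo (1 : ℝ) 2) (hle : τ ≤ 1 - 1 / β) : τ = 1 - 1 / β ↔ ¬ HasPeriodicAbove β := by
  refine ⟨fun heq hP => ?_, fun hP => hτ.eq_of_not_hasPeriodicAbove hβ hP hle⟩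
  obtain ⟨k, q, h⟩ := exists_realizesRotation hβ hP
  exact (h.criticalValue_lt hβ hτ).ne heq

end

end BetaHole

theorem theorem4 (β : ℝ) (hβ : β ∈ Set.Ioo (1 : ℝ) 2) :
    (∃! τ : ℝ, BetaHole.IsCriticalValue β τ) ∧
    ∀ τ : ℝ, BetaHole.IsCriticalValue β τ →
      τ ≤ 1 - 1 / β ∧
      (τ = 1 - 1 / β ↔ BetaHole.IsCantorSet (closure (BetaHole.orbitMinimalSet β))) ∧
      (τ = 1 - 1 / β ↔ ∀ J : Set ℝ, BetaHole.IsFareyInterval J → β ∉ J) := by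
  obtain ⟨σ, hσ_le, hσ⟩ := BetaHole.exists_isCriticalValue hβ
  have hσ_lt_one : σ < 1 :=
    hσ_le.trans_lt (BetaHole.one_sub_one_div_lt_one (zero_lt_one.trans hβ.1))
  have hunique : ∀ τ, BetaHole.IsCriticalValue β τ → τ = σ := fun _ hτ => hσ.unique hσ_lt_one hτ
  refine ⟨⟨σ, hσ, hunique⟩, fun τ hτ => ?_⟩
  obtain rfl := hunique τ hτ
  have hfarey : (∀ J, BetaHole.IsFareyInterval J → β ∉ J) ↔ ¬ BetaHole.HasPeriodicAbove β := by
    rw [BetaHole.hasPeriodicAbove_iff hβ, ← BetaHole.exists_isFareyInterval_iff hβ]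
    simp only [not_exists, not_and]
  exact ⟨hσ_le,
    (hτ.eq_one_sub_one_div_iff hβ hσ_le).trans
      (BetaHole.isCantorSet_closure_orbitMinimalSet_iff hβ).symm,
    (hτ.eq_one_sub_one_div_iff hβ hσ_le).trans hfarey.symm⟩
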